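/- For a metric space $X$, points $a,b\in X$ and $\ell\ge 0$, order $X\times\mathbb{R}$ by $(x,t)\le(x',t')\iff d(x,x')\le t'-t$, and let $\mathrm{Cau}^\ell(X;a,b)$ be the poset of all $(x,t)$ with $(a,0)\le(x,t)\le(b,\ell)$. Let $\Delta\mathrm{Cau}^\ell(X;a,b)$ be its order complex, whose simplices are the nonempty finite chains $(x_0,t_0)<\dots<(x_n,t_n)$, and let $\dot\Delta\mathrm{Cau}^\ell(X;a,b)$ be the subcomplex of those chains with $d(x_0,x_1)+\dots+d(x_{n-1},x_n)<\ell$. The magnitude homotopy type is the pointed CW complex \[ \mathcal{M}^\ell(X;a,b)=|\Delta\mathrm{Cau}^\ell(X;a,b)|\,/\,|\dot\Delta\mathrm{Cau}^\ell(X;a,b)|, \] with the convention that $A/\emptyset$ is $A$ with a disjoint base point added. For a nonempty space $A$ let $\widetilde\chi(A)=\sum_{k\ge0}(-1)^k\operatorname{rank}\widetilde H_k(A)$ be its reduced Euler characteristic, where $\widetilde H_k$ is reduced singular homology with integral coefficients. **Theorem.** Let $X$ and $Y$ be finite metric spaces with $|X|=|Y|$ and let $f:X\to Y$ be a map. For every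 $\ell\ge0$, all of the spaces $\mathcal{M}^\ell(X;a,b)$ ($a,b\in X$) and $\mathcal{M}^\ell(Y;a,b)$ ($a,b\in Y$) have finitely generated reduced homology in each degree, nonzero in only finitely many degrees, so that their reduced Euler characteristics are defined; and the following are equivalent. - (a) The map $f$ is an isometry, i.e. $d_Y(f(a),f(b))=d_X(a,b)$ for all $a,b\in X$. - (b) $\mathcal{M}^\ell(X;a,b)$ and $\mathcal{M}^\ell(Y;f(a),f(b))$ are homotopy equivalent for all $\ell\ge0$ and $a,b\in X$. - (b$'$) $\mathcal{M}^\ell(X;a,b)$ and $\mathcal{M}^\ell(Y;f(a),f(b))$ are homotopy equivalent as pointed spaces for all $\ell\ge0$ and $a,b\in X$. - (c) $\widetilde\chi(\mathcal{M}^\ell(X;a,b))=\widetilde\chi(\mathcal{M}^\ell(Y;f(a),f(b)))$ for all $\ell\ge0$ and $a,b\in X$. -/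

import Mathlib

universe u v

namespace MagnitudeHomotopy

/-! ### Geometric realization of a simplicial complex -/

section Realization

variable {V : Type u}

/-- A point of the geometric realization `|K|`: barycentric coordinates whose support is a face
of `K`. -/
@[ext]
structure Realization (K : PreAbstractSimplicialComplex V) where
  weight : V →₀ ℝ
  nonneg : ∀ w, 0 ≤ weight w
  sum_eq_one : (weight.sum fun _ r => r) = 1
  support_mem : weight.support ∈ K

namespace Realization

/-- The closed simplex of `|K|` spanned by a finite set `s` of vertices. -/
def closedFace (K : PreAbstractSimplicialComplex V) (s : Finset V) : Set (Realization K) :=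
  {x | x.weight.support ⊆ s}

/-- The Euclidean topology of a closed simplex: the topology of the barycentric coordinates. -/
abbrev closedFaceTopology (K : PreAbstractSimplicialComplex V) (s : Finset V) :
    TopologicalSpace (closedFace K s) :=
  TopologicalSpace.induced (fun x (w : V) => x.1.weight w) Pi.topologicalSpace

/-- The CW (weak) topology of `|K|`: a set is open if and only if its trace on each closed
simplex is open. -/
instance (K : PreAbstractSimplicialComplex V) : TopologicalSpace (Realization K) :=
  ⨆ s : {s : Finset V // s ∈ K},
    TopologicalSpace.coinduced (Subtype.val : closedFace K s.1 → Realization K)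
      (closedFaceTopology K s.1)

/-- The subspace `|L| ⊆ |K|` given by a subcomplex `L` of `K`. -/
def subcomplexSet (K L : PreAbstractSimplicialComplex V) : Set (Realization K) :=
  {x | x.weight.support ∈ L}

end Realization

end Realization

/-! ### Quotients of pairs of spaces -/

section PointedQuotient

variable (A : Type u) (B : Set A)

/-- The relation on `A ⊔ {*}` that identifies all the points of `B ⊔ {*}` with each other. -/
def collapseSetoid : Setoid (A ⊕ Unit) where
  r x y := x = y ∨ (x ∈ Sum.inl '' B ∪ {Sum.inr ()} ∧ y ∈ Sum.inl '' B ∪ {Sum.inr ()})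
  iseqv :=
    { refl := fun _ => Or.inl rfl
      symm := by
        rintro x y (h | ⟨h, h'⟩)
        · exact Or.inl h.symm
        · exact Or.inr ⟨h', h⟩
      trans := by
        rintro x y z (rfl | ⟨h, h'⟩) (rfl | ⟨k, k'⟩)
        · exact Or.inl rfl
        · exact Or.inr ⟨k, k'⟩
        · exact Or.inr ⟨h, h'⟩
        · exact Or.inr ⟨h, k'⟩ }

/-- The pointed space `A / B`, as the quotient of `A ⊔ {*}` that collapses `B ⊔ {*}` to a point.
If `B` is nonempty this is the usual quotient of `A`, and `A / ∅ = A ⊔ {*}`. -/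
def PointedQuotient : Type u := Quotient (collapseSetoid A B)

instance [TopologicalSpace A] : TopologicalSpace (PointedQuotient A B) :=
  inferInstanceAs (TopologicalSpace (Quotient (collapseSetoid A B)))

/-- The base point of `A / B`. -/
def PointedQuotient.base : PointedQuotient A B := Quotient.mk (collapseSetoid A B) (Sum.inr ())

end PointedQuotient

/-! ### Order complexes -/

/-- The order complex of a poset: its faces are the nonempty finite chains. -/
def orderComplex (P : Type u) [PartialOrder P] : PreAbstractSimplicialComplex P where
  faces := {s | s.Nonempty ∧ IsChain (· ≤ ·) (s : Set P)}
  isRelLowerSet_faces := by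
    rintro s ⟨hs, hc⟩
    exact ⟨hs, fun t hts ht => ⟨ht, hc.mono (by exact_mod_cast hts)⟩⟩

/-! ### The causal order on a metric space -/

/-- The spacetime `X × ℝ`. -/
@[ext]
structure Spacetime (X : Type u) where
  point : X
  time : ℝ

/-- The causal order: `(x, t) ≤ (x', t')` if and only if `d(x, x') ≤ t' - t`. -/
instance (X : Type u) [MetricSpace X] : PartialOrder (Spacetime X) where
  le p q := dist p.point q.point ≤ q.time - p.time
  le_refl p := by simp
  le_trans p q r hpq hqr := by
    have := dist_triangle p.point q.point r.point
    linarith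
  le_antisymm p q hpq hqp := by
    have h : dist q.point p.point = dist p.point q.point := dist_comm _ _
    have h0 : 0 ≤ dist p.point q.point := dist_nonneg
    have ht : p.time = q.time := by linarith
    have hd : dist p.point q.point = 0 := by linarith
    exact Spacetime.ext (dist_eq_zero.mp hd) ht

/-- The causal interval between `(a, 0)` and `(b, ℓ)`. -/
abbrev CausalInterval (X : Type u) [MetricSpace X] (ℓ : ℝ) (a b : X) : Type u :=
  Set.Icc (⟨a, 0⟩ : Spacetime X) ⟨b, ℓ⟩

/-- The length `d(x₀, x₁) + ⋯ + d(xₙ₋₁, xₙ)` of a sequence of points. -/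
def seqLength {X : Type u} [MetricSpace X] : List X → ℝ
  | [] => 0
  | [_] => 0
  | x :: y :: l => dist x y + seqLength (y :: l)

theorem seqLength_nonneg {X : Type u} [MetricSpace X] : ∀ l : List X, 0 ≤ seqLength l
  | [] => le_rfl
  | [_] => le_rfl
  | _ :: y :: l => add_nonneg dist_nonneg (seqLength_nonneg (y :: l))

theorem seqLength_tail_le {X : Type u} [MetricSpace X] (x : X) :
    ∀ l : List X, seqLength l ≤ seqLength (x :: l)
  | [] => le_rfl
  | _ :: _ => le_add_of_nonneg_left dist_nonneg

theorem seqLength_erase_second {X : Type u} [MetricSpace X] (x y : X) :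
    ∀ l : List X, seqLength (x :: l) ≤ seqLength (x :: y :: l)
  | [] => add_nonneg dist_nonneg le_rfl
  | z :: l => by
    have := dist_triangle x y z
    simp only [seqLength]
    linarith

theorem seqLength_sublist {X : Type u} [MetricSpace X] {l l' : List X} (h : l.Sublist l') :
    seqLength l ≤ seqLength l' ∧ ∀ x, seqLength (x :: l) ≤ seqLength (x :: l') := by
  induction h with
  | slnil => exact ⟨le_rfl, fun _ => le_rfl⟩
  | cons y _ ih =>
    exact ⟨ih.1.trans (seqLength_tail_le _ _),
      fun x => (ih.2 x).trans (seqLength_erase_second x y _)⟩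
  | cons_cons y _ ih =>
    refine ⟨ih.2 y, fun x => ?_⟩
    have := ih.2 y
    simp only [seqLength]
    linarith

/-- The subcomplex of the order complex of the causal interval that consists of the causal
sequences `(x₀, t₀) < ⋯ < (xₙ, tₙ)` with `d(x₀, …, xₙ) < ℓ`. -/
def shortComplex (X : Type u) [MetricSpace X] (ℓ : ℝ) (a b : X) :
    PreAbstractSimplicialComplex (CausalInterval X ℓ a b) where
  faces := {s | s.Nonempty ∧ ∃ l : List (CausalInterval X ℓ a b),
    l.Pairwise (· < ·) ∧ (∀ p, p ∈ l ↔ p ∈ s) ∧ seqLength (l.map fun p => p.1.point) < ℓ}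
  isRelLowerSet_faces := by
    classical
    rintro s ⟨hs, l, hl, hls, hlen⟩
    refine ⟨hs, fun t hts ht => ⟨ht, l.filter (· ∈ t), hl.filter _, fun p => ?_, ?_⟩⟩
    · simp only [List.mem_filter, decide_eq_true_eq, hls]
      exact ⟨fun h => h.2, fun h => ⟨hts h, h⟩⟩
    · exact lt_of_le_of_lt (seqLength_sublist (List.filter_sublist.map _)).1 hlen

/-! ### The magnitude homotopy type -/

/-- The magnitude homotopy type `𝓜^ℓ(X; a, b)`: the quotient of the realization of the order
complex of the causal interval by the realization of the subcomplex of short sequences. -/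
abbrev MagnitudeHomotopyType (X : Type u) [MetricSpace X] (ℓ : ℝ) (a b : X) : Type u :=
  PointedQuotient (Realization (orderComplex (CausalInterval X ℓ a b)))
    (Realization.subcomplexSet (orderComplex (CausalInterval X ℓ a b)) (shortComplex X ℓ a b))

/-- The base point of `𝓜^ℓ(X; a, b)`. -/
abbrev MagnitudeHomotopyType.base (X : Type u) [MetricSpace X] (ℓ : ℝ) (a b : X) :
    MagnitudeHomotopyType X ℓ a b :=
  PointedQuotient.base _ _

/-- Homotopy equivalence of pointed spaces, through base point preserving maps and homotopies. -/
def PointedHomotopyEquivalent {A : Type u} {B : Type v} [TopologicalSpace A] [TopologicalSpace B]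
    (a₀ : A) (b₀ : B) : Prop :=
  ∃ (f : C(A, B)) (g : C(B, A)), f a₀ = b₀ ∧ g b₀ = a₀ ∧
    (g.comp f).HomotopicRel (ContinuousMap.id A) {a₀} ∧
    (f.comp g).HomotopicRel (ContinuousMap.id B) {b₀}

/-! ### Reduced Euler characteristic -/

noncomputable section

open CategoryTheory

/-- The functor of `k`-th singular homology with integral coefficients. -/
def singularHomology (k : ℕ) : TopCat.{u} ⥤ ModuleCat.{u} ℤ :=
  (AlgebraicTopology.singularHomologyFunctor (ModuleCat.{u} ℤ) k).obj
    (ModuleCat.of ℤ (ULift.{u} ℤ))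

/-- The `k`-th reduced singular homology of a nonempty space `A`: the kernel of
`H_k(A) → H_k(pt)`. -/
def reducedHomology (A : Type u) [TopologicalSpace A] (k : ℕ) :
    Submodule ℤ ((singularHomology.{u} k).obj (TopCat.of A)) :=
  LinearMap.ker ((singularHomology.{u} k).map
    (TopCat.ofHom (ContinuousMap.const A PUnit.unit.{u + 1}))).hom

/-- The reduced homology of `A` is finitely generated in each degree and vanishes in all but
finitely many degrees, so that the reduced Euler characteristic is defined. -/
def HasFiniteReducedHomology (A : Type u) [TopologicalSpace A] : Prop :=
  (∀ k, Module.Finite ℤ (reducedHomology A k)) ∧ {k | reducedHomology A k ≠ ⊥}.Finite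

/-- The reduced Euler characteristic `∑ₖ (-1)ᵏ rank H̃ₖ(A)`. -/
def reducedEulerChar (A : Type u) [TopologicalSpace A] : ℤ :=
  ∑ᶠ k : ℕ, (-1) ^ k * (Module.finrank ℤ (reducedHomology A k) : ℤ)

end

end MagnitudeHomotopy

set_option linter.unusedSectionVars false
namespace MagnitudeHomotopy
open CategoryTheory

/-! ### Euler characteristics of long exact sequences -/

section EulerAlgebra

variable {R : Type v} [CommRing R] [IsDomain R] [IsNoetherianRing R]

/-! The quotient `MagnitudeHomotopyType X ℓ a b` has few cells, although the causal interval may be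
uncountable. A chain of events between `(a, 0)` and `(b, ℓ)` has length at most its duration, hence
at most `ℓ`. If it is not short, all these inequalities are equalities: it starts in `(a, 0)`, ends
in `(b, ℓ)`, and each time is the distance travelled so far. The cells away from the base point are
therefore the sequences `a = x₀ ≠ x₁ ≠ ⋯ ≠ xₙ = b` of total length exactly `ℓ`, each giving one
`n`-cell (`exists_isPath_of_notMem`, `pathFace_injOn`). In a finite space the steps are bounded
below, so there are finitely many such paths, and the reduced Euler characteristic is their signed
count `pathChar`, the sum of `(-1)ⁿ` (`magnitudeHomotopyType_reduced`).

An isometry between finite spaces of equal cardinality is bijective and induces pointed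
homeomorphisms; pointed equivalences are equivalences, and these preserve the Euler characteristic.
The substance is the way back from Euler characteristics to the metric. At `ℓ = 0` the count is `1`
if `a = b` and `0` otherwise, so `f` is injective, hence bijective. If some distance is not
preserved, take the least value `ℓ` that occurs as a distance of such a pair, on either side. All
distances below `ℓ` are preserved in both directions, so paths of length `ℓ` with at least two steps
correspond. The direct step from `a` to `b` is a path of length `ℓ` on one side only, and the two
counts differ by one (`pathChar_ne`, `dist_eq_of_pathChar_eq`).

The Euler characteristic is computed without cellular homology. `HasChi` is homotopy invariant and
satisfies a Mayer–Vietoris formula (`HasChi.union`), which comes from barycentric subdivision of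
explicit singular chains (`exists_sub_sdiff_mem`) and a chain level comparison with Mathlib's
singular homology (`hasChi_iff`). Covering a space with an attached cell by the open cell and the
complement of its centre shows that an `n`-cell contributes `(-1)ⁿ` (`IsAttached.hasChi`). Induction
on the number of faces outside the subcomplex then gives `hasChi_relRealization`. -/

theorem finrank_eq_of_exact {A B C : Type*} [AddCommGroup A] [AddCommGroup B] [AddCommGroup C]
    [Module R A] [Module R B] [Module R C] [Module.Finite R B]
    (f : A →ₗ[R] B) (g : B →ₗ[R] C) (h : Function.Exact f g) :
    Module.finrank R B = Module.finrank R (LinearMap.range f) +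
      Module.finrank R (LinearMap.range g) := by
  rw [← (LinearMap.ker g).finrank_quotient_add_finrank, g.quotKerEquivRange.finrank_eq,
    h.linearMap_ker_eq, add_comm]

theorem finite_of_exact {A B C : Type*} [AddCommGroup A] [AddCommGroup B] [AddCommGroup C]
    [Module R A] [Module R B] [Module R C] [Module.Finite R A] [Module.Finite R C]
    (f : A →ₗ[R] B) (g : B →ₗ[R] C) (h : Function.Exact f g) : Module.Finite R B := by
  have h2 : Function.Exact f g.rangeRestrict := fun y => by
    rw [← h y]
    simp [Subtype.ext_iff]
  exact Module.Finite.of_exact h2 g.surjective_rangeRestrict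

theorem subsingleton_of_exact {A B C : Type*} [AddCommGroup A] [AddCommGroup B] [AddCommGroup C]
    [Module R A] [Module R B] [Module R C] [Subsingleton A] [Subsingleton C]
    (f : A →ₗ[R] B) (g : B →ₗ[R] C) (h : Function.Exact f g) : Subsingleton B := by
  refine subsingleton_of_forall_eq 0 fun y => ?_
  obtain ⟨x, rfl⟩ := (h y).1 (Subsingleton.elim _ _)
  rw [Subsingleton.elim x 0, map_zero]

/-- A sequence of modules that are finitely generated and almost all zero, with alternating sum of
ranks `c`. -/
def HasEulerChar (H : ℕ → ModuleCat.{u} R) (c : ℤ) : Prop :=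
  (∀ k, Module.Finite R (H k)) ∧ ∃ N, (∀ k, N ≤ k → Subsingleton (H k)) ∧
    ∑ k ∈ Finset.range N, (-1) ^ k * (Module.finrank R (H k) : ℤ) = c

variable {A B C : ℕ → ModuleCat.{u} R} {a b c : ℤ}

/-- The cutoff in `HasEulerChar` is existentially bound. Terms past a vanishing bound contribute
nothing, so any two cutoffs are compared through their sum. -/
theorem HasEulerChar.sum_eq (h : HasEulerChar A a) {N : ℕ} (hN : ∀ k, N ≤ k → Subsingleton (A k)) :
    ∑ k ∈ Finset.range N, (-1) ^ k * (Module.finrank R (A k) : ℤ) = a := by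
  obtain ⟨_, M, hM, rfl⟩ := h
  have key : ∀ N : ℕ, (∀ k, N ≤ k → Subsingleton (A k)) → ∀ d,
      ∑ k ∈ Finset.range (N + d), (-1) ^ k * (Module.finrank R (A k) : ℤ) =
        ∑ k ∈ Finset.range N, (-1) ^ k * (Module.finrank R (A k) : ℤ) := by
    intro N hN d
    induction d with
    | zero => rfl
    | succ d ih =>
      have := hN (N + d) (by omega)
      rw [← add_assoc, Finset.sum_range_succ, ih, Module.finrank_zero_of_subsingleton]
      simp
  rw [← key N hN M, ← key M hM N, add_comm]

theorem HasEulerChar.unique (h : HasEulerChar A a) (h' : HasEulerChar A b) : a = b := by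
  obtain ⟨_, M, hM, rfl⟩ := h'
  exact (h.sum_eq hM).symm

theorem HasEulerChar.congr (h : HasEulerChar A a) (e : ∀ k, Nonempty (A k ≃ₗ[R] B k)) :
    HasEulerChar B a := by
  obtain ⟨hf, M, hM, rfl⟩ := h
  replace e := fun k => (e k).some
  refine ⟨fun k => Module.Finite.equiv (e k), M, fun k hk => ?_, ?_⟩
  · have := hM k hk
    exact (e k).symm.injective.subsingleton
  · simp only [(e _).finrank_eq]

theorem HasEulerChar.zero (h : ∀ k, Subsingleton (A k)) : HasEulerChar A 0 :=
  ⟨fun _ => inferInstance, 0, fun k _ => h k, rfl⟩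

/-- A long exact sequence of homology type. -/
structure LongExact (A B C : ℕ → ModuleCat.{u} R) where
  f : ∀ k, A k →ₗ[R] B k
  g : ∀ k, B k →ₗ[R] C k
  δ : ∀ k, C (k + 1) →ₗ[R] A k
  exact_fg : ∀ k, Function.Exact (f k) (g k)
  exact_gδ : ∀ k, Function.Exact (g (k + 1)) (δ k)
  exact_δf : ∀ k, Function.Exact (δ k) (f k)
  surj : Function.Surjective (g 0)

theorem LongExact.euler (L : LongExact A B C) (hA : HasEulerChar A a) (hB : HasEulerChar B b)
    (hC : HasEulerChar C c) : b = a + c := by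
  have := hA.1
  have := hB.1
  have := hC.1
  obtain ⟨NA, hNA, -⟩ := hA.2
  obtain ⟨NB, hNB, -⟩ := hB.2
  obtain ⟨NC, hNC, -⟩ := hC.2
  set N := NA + NB + NC + 1 with hN
  rw [← hA.sum_eq (N := N) (fun k hk => hNA k (by omega)),
    ← hB.sum_eq (N := N) (fun k hk => hNB k (by omega)),
    ← hC.sum_eq (N := N) (fun k hk => hNC k (by omega))]
  -- Cutting the long exact sequence after degree `n` leaves one uncancelled rank, that of the
  -- connecting map into `A n`.
  have key : ∀ n, ∑ k ∈ Finset.range (n + 1), (-1) ^ k * (Module.finrank R (B k) : ℤ) =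
      ∑ k ∈ Finset.range (n + 1), (-1) ^ k * (Module.finrank R (A k) : ℤ) +
      ∑ k ∈ Finset.range (n + 1), (-1) ^ k * (Module.finrank R (C k) : ℤ) -
      (-1) ^ n * (Module.finrank R (LinearMap.range (L.δ n)) : ℤ) := by
    intro n
    induction n with
    | zero =>
      have h1 := finrank_eq_of_exact _ _ (L.exact_fg 0)
      have h2 := finrank_eq_of_exact _ _ (L.exact_δf 0)
      have h3 : Module.finrank R (LinearMap.range (L.g 0)) = Module.finrank R (C 0) := by
        rw [LinearMap.range_eq_top.2 L.surj]; exact finrank_top R _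
      simp only [zero_add, Finset.sum_range_one, pow_zero, one_mul]
      omega
    | succ n ih =>
      have h1 := finrank_eq_of_exact _ _ (L.exact_fg (n + 1))
      have h2 := finrank_eq_of_exact _ _ (L.exact_δf (n + 1))
      have h3 := finrank_eq_of_exact _ _ (L.exact_gδ n)
      rw [Finset.sum_range_succ, ih, Finset.sum_range_succ _ (n + 1),
        Finset.sum_range_succ _ (n + 1), h1, h2, h3]
      push_cast
      ring
  -- The `+ 1` in `N` makes `N - 1` an honest predecessor that is still at least `NA`, so the target
  -- of this connecting map is zero.
  have hz : Module.finrank R (LinearMap.range (L.δ (N - 1))) = 0 := by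
    have := hNA (N - 1) (by omega)
    exact Module.finrank_zero_of_subsingleton
  have := key (N - 1)
  rw [hz, show N - 1 + 1 = N by omega] at this
  simpa using this

theorem LongExact.hasEulerChar_right (L : LongExact A B C) (hA : HasEulerChar A a)
    (hB : HasEulerChar B b) : HasEulerChar C (b - a) := by
  have h1 := hA.1
  have h2 := hB.1
  obtain ⟨NA, hNA, -⟩ := hA.2
  obtain ⟨NB, hNB, -⟩ := hB.2
  -- `C (k + 1)` sits between `B (k + 1)` and `A k`; this shift in degree accounts for the `+ 1` in
  -- the cutoff.
  have hC : HasEulerChar C (∑ k ∈ Finset.range (NA + NB + 1),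
      (-1) ^ k * (Module.finrank R (C k) : ℤ)) := by
    refine ⟨fun k => ?_, _, fun k hk => ?_, rfl⟩
    · cases k with
      | zero => exact Module.Finite.of_surjective _ L.surj
      | succ k => exact finite_of_exact _ _ (L.exact_gδ k)
    · obtain ⟨k, rfl⟩ : ∃ j, k = j + 1 := ⟨k - 1, by omega⟩
      have := hNB (k + 1) (by omega)
      have := hNA k (by omega)
      exact subsingleton_of_exact _ _ (L.exact_gδ k)
  have := L.euler hA hB hC
  rwa [show b - a = _ from by rw [this, add_sub_cancel_left]]

theorem LongExact.hasEulerChar_middle (L : LongExact A B C) (hA : HasEulerChar A a)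
    (hC : HasEulerChar C c) : HasEulerChar B (a + c) := by
  have h1 := hA.1
  have h2 := hC.1
  obtain ⟨NA, hNA, -⟩ := hA.2
  obtain ⟨NC, hNC, -⟩ := hC.2
  have hB : HasEulerChar B (∑ k ∈ Finset.range (NA + NC),
      (-1) ^ k * (Module.finrank R (B k) : ℤ)) := by
    refine ⟨fun k => finite_of_exact _ _ (L.exact_fg k), _, fun k hk => ?_, rfl⟩
    have := hNA k (by omega)
    have := hNC k (by omega)
    exact subsingleton_of_exact _ _ (L.exact_fg k)
  have := L.euler hA hB hC
  rwa [← this]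

/-- The long exact homology sequence of a short exact sequence of chain complexes. -/
noncomputable def longExactOfShortExact {K₁ K₂ K₃ : ChainComplex (ModuleCat.{u} R) ℕ} (φ : K₁ ⟶ K₂)
    (ψ : K₂ ⟶ K₃) (inj : ∀ n, Function.Injective (φ.f n))
    (exact : ∀ n, Function.Exact (φ.f n) (ψ.f n)) (surj : ∀ n, Function.Surjective (ψ.f n)) :
    LongExact (fun k => K₁.homology k) (fun k => K₂.homology k) (fun k => K₃.homology k) := by
  have w : φ ≫ ψ = 0 := by
    ext n x
    exact (exact n _).2 ⟨x, rfl⟩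
  have hS : (ShortComplex.mk φ ψ w).ShortExact :=
    HomologicalComplex.shortExact_of_degreewise_shortExact _ fun n =>
      ModuleCat.shortComplex_shortExact _ (exact n) (inj n) (surj n)
  exact
    { f := fun k => (HomologicalComplex.homologyMap φ k).hom
      g := fun k => (HomologicalComplex.homologyMap ψ k).hom
      δ := fun k => (hS.δ (k + 1) k (by simp)).hom
      exact_fg := fun k =>
        (ShortComplex.ShortExact.moduleCat_exact_iff_function_exact _).1 (hS.homology_exact₂ k)
      exact_gδ := fun k =>
        (ShortComplex.ShortExact.moduleCat_exact_iff_function_exact _).1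
          (hS.homology_exact₃ (k + 1) k (by simp))
      exact_δf := fun k =>
        (ShortComplex.ShortExact.moduleCat_exact_iff_function_exact _).1
          (hS.homology_exact₁ (k + 1) k (by simp))
      surj := by
        -- No differential leaves degree `0`, so `H₀` is the module of opcycles, a quotient of the
        -- chains, and the surjection `ψ.f 0` passes to quotients.
        rw [← ModuleCat.epi_iff_surjective]
        have h0 : ¬ (ComplexShape.down ℕ).Rel 0 ((ComplexShape.down ℕ).next 0) := by simp
        have i2 : IsIso (K₂.homologyι 0) :=
          ShortComplex.isIso_homologyι (K₂.sc 0) (K₂.shape _ _ h0)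
        have i3 : IsIso (K₃.homologyι 0) :=
          ShortComplex.isIso_homologyι (K₃.sc 0) (K₃.shape _ _ h0)
        have e0 : Epi (ψ.f 0) := (ModuleCat.epi_iff_surjective _).2 (surj 0)
        have e1 : Epi (HomologicalComplex.homologyMap ψ 0 ≫ K₃.homologyι 0) := by
          rw [HomologicalComplex.homologyι_naturality]
          infer_instance
        have := epi_comp (HomologicalComplex.homologyMap ψ 0 ≫ K₃.homologyι 0)
          (inv (K₃.homologyι 0))
        rwa [Category.assoc, IsIso.hom_inv_id, Category.comp_id] at this }

end EulerAlgebra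

end MagnitudeHomotopy

namespace MagnitudeHomotopy
open CategoryTheory

/-! ### Subquotients of chain complexes -/

section Subquotients

variable {R : Type v} [CommRing R]

/-- A subcomplex of a chain complex of modules. -/
structure ChainSubcomplex (K : ChainComplex (ModuleCat.{u} R) ℕ) where
  carrier : ∀ n, Submodule R (K.X n)
  stable : ∀ n x, x ∈ carrier (n + 1) → (K.d (n + 1) n).hom x ∈ carrier n

namespace ChainSubcomplex

variable {K : ChainComplex (ModuleCat.{u} R) ℕ}

/-- The zero subcomplex. -/
def zero (K : ChainComplex (ModuleCat.{u} R) ℕ) : ChainSubcomplex K :=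
  ⟨fun _ => ⊥, fun n x hx => by rw [Submodule.mem_bot] at hx ⊢; rw [hx, map_zero]⟩

/-- The intersection of two subcomplexes. -/
def inf (P Q : ChainSubcomplex K) : ChainSubcomplex K :=
  ⟨fun n => P.carrier n ⊓ Q.carrier n, fun n x hx => ⟨P.stable n x hx.1, Q.stable n x hx.2⟩⟩

/-- The sum of two subcomplexes. -/
def sup (P Q : ChainSubcomplex K) : ChainSubcomplex K :=
  ⟨fun n => P.carrier n ⊔ Q.carrier n, fun n x hx => by
    obtain ⟨y, hy, z, hz, rfl⟩ := Submodule.mem_sup.1 hx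
    rw [map_add]
    exact Submodule.add_mem_sup (P.stable n y hy) (Q.stable n z hz)⟩

variable (P Q : ChainSubcomplex K)

/-- The differential of a subquotient complex. -/
def relD (n : ℕ) : (Q.carrier (n + 1) ⧸ (P.carrier (n + 1)).submoduleOf (Q.carrier (n + 1))) →ₗ[R]
    (Q.carrier n ⧸ (P.carrier n).submoduleOf (Q.carrier n)) :=
  Submodule.mapQ _ _ ((K.d (n + 1) n).hom.restrict (Q.stable n)) fun x hx => P.stable n x hx

/-- The subquotient complex `Q / (P ∩ Q)`. -/
def rel : ChainComplex (ModuleCat.{u} R) ℕ :=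
  ChainComplex.of (fun n => ModuleCat.of R (Q.carrier n ⧸ (P.carrier n).submoduleOf (Q.carrier n)))
    (fun n => ModuleCat.ofHom (relD P Q n)) fun n => by
      ext x
      change Submodule.Quotient.mk _ = 0
      rw [Submodule.Quotient.mk_eq_zero]
      change (K.d (n + 1) n).hom ((K.d (n + 2) (n + 1)).hom x) ∈ P.carrier n
      rw [← LinearMap.comp_apply, ← ModuleCat.hom_comp, K.d_comp_d]
      exact Submodule.zero_mem _

variable {P Q}

/-- The class of a chain in the subquotient complex. -/
def cls {n : ℕ} (x : K.X n) (hx : x ∈ Q.carrier n) : (rel P Q).X n :=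
  Submodule.Quotient.mk (⟨x, hx⟩ : Q.carrier n)

theorem cls_surjective {n : ℕ} (y : (rel P Q).X n) : ∃ x hx, cls x hx = y := by
  obtain ⟨x, rfl⟩ := Submodule.mkQ_surjective _ y
  exact ⟨x.1, x.2, rfl⟩

theorem cls_eq_cls {n : ℕ} {x y : K.X n} (hx : x ∈ Q.carrier n) (hy : y ∈ Q.carrier n) :
    (cls x hx : (rel P Q).X n) = cls y hy ↔ x - y ∈ P.carrier n :=
  Submodule.Quotient.eq _

theorem cls_eq_zero {n : ℕ} {x : K.X n} (hx : x ∈ Q.carrier n) :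
    (cls x hx : (rel P Q).X n) = 0 ↔ x ∈ P.carrier n :=
  Submodule.Quotient.mk_eq_zero _

theorem rel_d (n : ℕ) : (rel P Q).d (n + 1) n = ModuleCat.ofHom (relD P Q n) :=
  ChainComplex.of_d (fun n => ModuleCat.of R (Q.carrier n ⧸ (P.carrier n).submoduleOf (Q.carrier n)))
    (fun n => ModuleCat.ofHom (relD P Q n)) n

theorem d_cls {n : ℕ} {x : K.X (n + 1)} (hx : x ∈ Q.carrier (n + 1)) :
    ((rel P Q).d (n + 1) n).hom (cls x hx) = cls ((K.d (n + 1) n).hom x) (Q.stable n x hx) := by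
  rw [rel_d]
  rfl

variable {P' Q' : ChainSubcomplex K}

/-- The map of subquotient complexes induced by inclusions. -/
def relMap (hP : ∀ n, P.carrier n ≤ P'.carrier n) (hQ : ∀ n, Q.carrier n ≤ Q'.carrier n) :
    rel P Q ⟶ rel P' Q' :=
  ChainComplex.ofHom (fun n => ModuleCat.ofHom (Submodule.mapQ _ _ (Submodule.inclusion (hQ n))
    fun x hx => hP n hx)) fun n => by
      rw [rel_d, rel_d]
      ext x
      obtain ⟨x, hx, rfl⟩ := cls_surjective x
      rfl

/-- The long exact sequence of a triple `P ≤ Q ≤ T` of subcomplexes. -/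
noncomputable def longExactTriple {P Q T : ChainSubcomplex K}
    (hPQ : ∀ n, P.carrier n ≤ Q.carrier n) (hQT : ∀ n, Q.carrier n ≤ T.carrier n) :
    LongExact (fun k => (rel P Q).homology k) (fun k => (rel P T).homology k)
      (fun k => (rel Q T).homology k) :=
  longExactOfShortExact (relMap (fun _ => le_rfl) hQT) (relMap hPQ fun _ => le_rfl)
    (fun n => by
      refine (injective_iff_map_eq_zero _).2 fun x hx => ?_
      obtain ⟨x, hx', rfl⟩ := cls_surjective x
      exact (cls_eq_zero _).2 ((cls_eq_zero (hQT n hx')).1 hx))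
    (fun n x => by
      obtain ⟨x, hx, rfl⟩ := cls_surjective x
      constructor
      · intro h
        exact ⟨cls x ((cls_eq_zero hx).1 h), rfl⟩
      · rintro ⟨y, hy⟩
        obtain ⟨y, hy', rfl⟩ := cls_surjective y
        have h1 : y - x ∈ P.carrier n := (cls_eq_cls (hQT n hy') hx).1 hy
        refine (cls_eq_zero (P := Q) hx).2 ?_
        simpa using (Q.carrier n).sub_mem hy' (hPQ n h1))
    (fun n x => by
      obtain ⟨x, hx, rfl⟩ := cls_surjective x
      exact ⟨cls x hx, rfl⟩)

/-- The long exact sequence comparing `P / (P ∩ Q)` with `T / Q`, with third term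
`T / (P + Q)`. -/
noncomputable def longExactExcision {P Q T : ChainSubcomplex K}
    (hPT : ∀ n, P.carrier n ≤ T.carrier n) :
    LongExact (fun k => (rel (P.inf Q) P).homology k) (fun k => (rel Q T).homology k)
      (fun k => (rel (P.sup Q) T).homology k) :=
  longExactOfShortExact (relMap (fun _ => inf_le_right) hPT)
    (relMap (fun _ => le_sup_right) fun _ => le_rfl)
    (fun n => by
      refine (injective_iff_map_eq_zero _).2 fun x hx => ?_
      obtain ⟨x, hx', rfl⟩ := cls_surjective x
      exact (cls_eq_zero _).2 ⟨hx', (cls_eq_zero (hPT n hx')).1 hx⟩)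
    (fun n x => by
      obtain ⟨x, hx, rfl⟩ := cls_surjective x
      constructor
      · intro h
        obtain ⟨p, hp, q, hq, rfl⟩ := Submodule.mem_sup.1 ((cls_eq_zero hx).1 h)
        refine ⟨cls p hp, (cls_eq_cls (hPT n hp) hx).2 ?_⟩
        simpa using hq
      · rintro ⟨y, hy⟩
        obtain ⟨y, hy', rfl⟩ := cls_surjective y
        have h1 : y - x ∈ Q.carrier n := (cls_eq_cls (hPT n hy') hx).1 hy
        refine (cls_eq_zero (P := P.sup Q) hx).2 ?_
        rw [← sub_sub_cancel y x]
        exact Submodule.sub_mem _ (Submodule.mem_sup_left hy') (Submodule.mem_sup_right h1))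
    (fun n x => by
      obtain ⟨x, hx, rfl⟩ := cls_surjective x
      exact ⟨cls x hx, rfl⟩)

/-- An acyclicity criterion on representatives: every chain of `Q` whose boundary lies in `P` is a
boundary from `Q` modulo `P`. It is what subdivision provides for chains in a union modulo sums of
chains in the two parts. -/
theorem subsingleton_homology_rel
    (h0 : ∀ x ∈ Q.carrier 0, ∃ y ∈ Q.carrier 1, x - (K.d 1 0).hom y ∈ P.carrier 0)
    (hs : ∀ n, ∀ x ∈ Q.carrier (n + 1), (K.d (n + 1) n).hom x ∈ P.carrier n →
      ∃ y ∈ Q.carrier (n + 2), x - (K.d (n + 2) (n + 1)).hom y ∈ P.carrier (n + 1)) (k : ℕ) :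
    Subsingleton ((rel P Q).homology k) := by
  have key : (rel P Q).ExactAt k := by
    cases k with
    | zero =>
      rw [(rel P Q).exactAt_iff' 1 0 0 (by simp) (by simp), ShortComplex.moduleCat_exact_iff]
      intro x _
      obtain ⟨x, hx, rfl⟩ := cls_surjective (P := P) (Q := Q) (n := 0) x
      obtain ⟨y, hy, hxy⟩ := h0 x hx
      refine ⟨cls y hy, ?_⟩
      refine (d_cls (P := P) hy).trans ((cls_eq_cls _ hx).2 ?_)
      rw [← Submodule.neg_mem_iff, neg_sub]
      exact hxy
    | succ n =>
      rw [(rel P Q).exactAt_iff' (n + 2) (n + 1) n (by simp) (by simp),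
        ShortComplex.moduleCat_exact_iff]
      intro x h
      obtain ⟨x, hx, rfl⟩ := cls_surjective (P := P) (Q := Q) (n := n + 1) x
      have h' : (K.d (n + 1) n).hom x ∈ P.carrier n :=
        (cls_eq_zero (P := P) (Q.stable n x hx)).1 ((d_cls (P := P) hx).symm.trans h)
      obtain ⟨y, hy, hxy⟩ := hs n x hx h'
      refine ⟨cls y hy, ?_⟩
      refine (d_cls (P := P) hy).trans ((cls_eq_cls _ hx).2 ?_)
      rw [← Submodule.neg_mem_iff, neg_sub]
      exact hxy
  exact ModuleCat.subsingleton_of_isZero key.isZero_homology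

variable [IsDomain R] [IsNoetherianRing R]

/-- The Mayer–Vietoris formula for Euler characteristics. -/
theorem hasEulerChar_mayerVietoris {P Q T : ChainSubcomplex K} {p q r : ℤ}
    (hPT : ∀ n, P.carrier n ≤ T.carrier n) (hQT : ∀ n, Q.carrier n ≤ T.carrier n)
    (hT : ∀ k, Subsingleton ((rel (P.sup Q) T).homology k))
    (hP : HasEulerChar (fun k => (rel (zero K) P).homology k) p)
    (hQ : HasEulerChar (fun k => (rel (zero K) Q).homology k) q)
    (hPQ : HasEulerChar (fun k => (rel (zero K) (P.inf Q)).homology k) r) :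
    HasEulerChar (fun k => (rel (zero K) T).homology k) (p + q - r) := by
  -- The relative complex `P / (P ∩ Q)` has characteristic `p - r`. Excision carries this value to
  -- `T / Q`, since `T / (P + Q)` is acyclic, and adding `q` gives the value for `T`.
  have h1 := (longExactTriple (P := zero K) (Q := P.inf Q) (T := P) (fun _ => bot_le)
    fun _ => inf_le_left).hasEulerChar_right hPQ hP
  have h2 := (longExactExcision (P := P) (Q := Q) hPT).hasEulerChar_middle h1 (.zero hT)
  have h3 := (longExactTriple (P := zero K) (Q := Q) (T := T) (fun _ => bot_le)
    hQT).hasEulerChar_middle hQ h2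
  rwa [show p + q - r = q + (p - r + 0) by ring]

end ChainSubcomplex

end Subquotients

end MagnitudeHomotopy

namespace MagnitudeHomotopy
open CategoryTheory

/-! ### Affine chains in simplices and barycentric subdivision -/

section AffineMaps

variable {ι κ μ : Type*} [Fintype ι] [Fintype κ] [Fintype μ]

/-- The affine map of simplices with prescribed values on the vertices. -/
noncomputable def affineMap (v : ι → stdSimplex ℝ κ) : C(stdSimplex ℝ ι, stdSimplex ℝ κ) where
  toFun t := ⟨fun k => ∑ i, t i * v i k,
    fun k => Finset.sum_nonneg fun i _ => mul_nonneg (t.2.1 i) ((v i).2.1 k), by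
      rw [Finset.sum_comm]
      simp only [← Finset.mul_sum, stdSimplex.sum_eq_one, mul_one]⟩
  continuous_toFun := by
    refine Continuous.subtype_mk (continuous_pi fun k => continuous_finsetSum _ fun i _ => ?_) _
    exact ((continuous_apply i).comp continuous_subtype_val).mul continuous_const

theorem affineMap_apply (v : ι → stdSimplex ℝ κ) (t : stdSimplex ℝ ι) (k : κ) :
    affineMap v t k = ∑ i, t i * v i k := rfl

theorem affineMap_comp (v : ι → stdSimplex ℝ κ) (w : μ → stdSimplex ℝ ι) :
    (affineMap v).comp (affineMap w) = affineMap (affineMap v ∘ w) := by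
  ext t k
  change ∑ i, (∑ j, t j * w j i) * v i k = ∑ j, t j * ∑ i, w j i * v i k
  simp only [Finset.sum_mul, Finset.mul_sum]
  rw [Finset.sum_comm]
  simp only [mul_assoc]

variable [DecidableEq ι]

theorem affineMap_vertex (v : ι → stdSimplex ℝ κ) (i : ι) :
    affineMap v (stdSimplex.vertex i) = v i := by
  ext k
  rw [affineMap_apply, Finset.sum_eq_single i]
  · simp
  · intro j _ hj
    simp [hj]
  · simp

theorem affineMap_comp_vertex (v : ι → stdSimplex ℝ κ) :
    affineMap v ∘ (stdSimplex.vertex : ι → stdSimplex ℝ ι) = v :=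
  funext fun i => affineMap_vertex v i

theorem affineMap_vertex_eq_id :
    affineMap (stdSimplex.vertex : ι → stdSimplex ℝ ι) = ContinuousMap.id _ := by
  ext t k
  rw [affineMap_apply, Finset.sum_eq_single k]
  · simp
  · intro j _ hj
    simp [hj.symm]
  · simp

end AffineMaps

/-! ### Formal affine chains, cones and their subdivision -/

section AffineChains

/-- The standard simplex of dimension `n`. -/
abbrev Splx (n : ℕ) : Type := stdSimplex ℝ (Fin (n + 1))

/-- Formal chains of vertex sequences of length `m + 1`. -/
abbrev VChain (R : Type) [CommRing R] (E : Type*) (m : ℕ) := (Fin (m + 1) → E) →₀ R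

variable (R : Type) [CommRing R] {E F : Type*}

namespace VChain

/-- The boundary of formal chains. -/
noncomputable def bdry (m : ℕ) : VChain R E (m + 1) →ₗ[R] VChain R E m :=
  Finsupp.linearCombination R fun v =>
    ∑ i : Fin (m + 2), (-1 : R) ^ (i : ℕ) • Finsupp.single (v ∘ i.succAbove) 1

/-- The cone operator on formal chains. -/
noncomputable def cone (b : E) (m : ℕ) : VChain R E m →ₗ[R] VChain R E (m + 1) :=
  Finsupp.lmapDomain R R fun v => (Fin.cons b v : Fin (m + 2) → E)

/-- The augmentation of formal chains. -/
noncomputable def aug : VChain R E 0 →ₗ[R] R := Finsupp.linearCombination R fun _ => 1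

/-- The map of formal chains induced by a map of vertices. -/
noncomputable def map (θ : E → F) (m : ℕ) : VChain R E m →ₗ[R] VChain R F m :=
  Finsupp.lmapDomain R R fun v => θ ∘ v

variable {R}

theorem bdry_single (m : ℕ) (v : Fin (m + 2) → E) : bdry R m (Finsupp.single v 1) =
    ∑ i : Fin (m + 2), (-1 : R) ^ (i : ℕ) • Finsupp.single (v ∘ i.succAbove) 1 := by
  simp [bdry]

theorem cone_single (b : E) (m : ℕ) (v : Fin (m + 1) → E) :
    cone R b m (Finsupp.single v 1) = Finsupp.single (Fin.cons b v) 1 := by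
  simp [cone]

theorem map_single (θ : E → F) (m : ℕ) (v : Fin (m + 1) → E) :
    map R θ m (Finsupp.single v 1) = Finsupp.single (θ ∘ v) 1 := by
  simp [map]

/-- Deleting the apex returns `x`; deleting any other vertex gives the cone over a face of `x`, with
the sign shifted by one. The cone is thus a contracting homotopy in positive degrees. -/
theorem bdry_cone_succ (b : E) (m : ℕ) (x : VChain R E (m + 1)) :
    bdry R (m + 1) (cone R b (m + 1) x) = x - cone R b m (bdry R m x) := by
  suffices h : bdry R (m + 1) ∘ₗ cone R b (m + 1) = LinearMap.id - cone R b m ∘ₗ bdry R m from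
    LinearMap.congr_fun h x
  ext1 v
  ext1
  simp only [LinearMap.comp_apply, Finsupp.lsingle_apply, LinearMap.sub_apply, LinearMap.id_apply,
    cone_single, bdry_single, map_sum, map_smul]
  rw [Fin.sum_univ_succ, sub_eq_add_neg, ← Finset.sum_neg_distrib]
  congr 1
  · simp only [Fin.val_zero, pow_zero, one_smul]
    congr 1
  · refine Finset.sum_congr rfl fun i _ => ?_
    rw [Fin.val_succ, pow_succ, mul_neg_one, neg_smul]
    congr 3
    ext j
    refine Fin.cases ?_ (fun j => ?_) j
    · simp
    · simp

/-- In degree `0` deleting the second vertex leaves the apex alone, so the augmentation enters as a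
correction term. -/
theorem bdry_cone_zero (b : E) (x : VChain R E 0) :
    bdry R 0 (cone R b 0 x) = x - aug R x • Finsupp.single (fun _ => b) 1 := by
  suffices h : bdry R 0 ∘ₗ cone R b 0 =
      LinearMap.id - (aug R).smulRight (Finsupp.single (fun _ => b) 1) from
    LinearMap.congr_fun h x
  ext1 v
  ext1
  simp only [LinearMap.comp_apply, Finsupp.lsingle_apply, LinearMap.sub_apply, LinearMap.id_apply,
    cone_single, bdry_single, LinearMap.smulRight_apply, aug, Finsupp.linearCombination_single]
  rw [Fin.sum_univ_two, sub_eq_add_neg]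
  congr 1
  · simp only [Fin.val_zero, pow_zero, one_smul]
    congr 1
  · simp only [Fin.val_one, pow_one, one_smul, neg_smul]
    congr 2
    ext j
    fin_cases j
    rfl

theorem aug_bdry (x : VChain R E 1) : aug R (bdry R 0 x) = 0 := by
  suffices h : aug R ∘ₗ bdry R 0 = (0 : VChain R E 1 →ₗ[R] R) from LinearMap.congr_fun h x
  ext v
  simp [bdry_single, aug, Fin.sum_univ_two]

/-- Every simplex is the cone from its first vertex over its tail, so the cone formula gives the
identity by induction, without a double sum over pairs of faces. -/
theorem bdry_bdry (m : ℕ) (x : VChain R E (m + 2)) : bdry R m (bdry R (m + 1) x) = 0 := by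
  induction m with
  | zero =>
    suffices h : bdry R 0 ∘ₗ bdry R 1 = (0 : VChain R E 2 →ₗ[R] VChain R E 0) from
      LinearMap.congr_fun h x
    ext1 v
    ext1
    have : Finsupp.single v (1 : R) = cone R (v 0) 1 (Finsupp.single (Fin.tail v) 1) := by
      rw [cone_single, Fin.cons_self_tail]
    simp only [LinearMap.comp_apply, Finsupp.lsingle_apply, LinearMap.zero_apply]
    rw [this, bdry_cone_succ, map_sub, bdry_cone_zero, aug_bdry]
    simp
  | succ m ih =>
    suffices h : bdry R (m + 1) ∘ₗ bdry R (m + 2) =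
        (0 : VChain R E (m + 3) →ₗ[R] VChain R E (m + 1)) from LinearMap.congr_fun h x
    ext1 v
    ext1
    have : Finsupp.single v (1 : R) = cone R (v 0) (m + 2) (Finsupp.single (Fin.tail v) 1) := by
      rw [cone_single, Fin.cons_self_tail]
    simp only [LinearMap.comp_apply, Finsupp.lsingle_apply, LinearMap.zero_apply]
    rw [this, bdry_cone_succ, map_sub, bdry_cone_succ, ih]
    simp

theorem map_bdry (θ : E → F) (m : ℕ) (x : VChain R E (m + 1)) :
    map R θ m (bdry R m x) = bdry R m (map R θ (m + 1) x) := by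
  suffices h : map R θ m ∘ₗ bdry R m = bdry R m ∘ₗ map R θ (m + 1) from LinearMap.congr_fun h x
  ext1 v
  ext1
  simp only [LinearMap.comp_apply, Finsupp.lsingle_apply, map_single, bdry_single, map_sum,
    map_smul]
  rfl

theorem map_cone (θ : E → F) (b : E) (m : ℕ) (x : VChain R E m) :
    map R θ (m + 1) (cone R b m x) = cone R (θ b) m (map R θ m x) := by
  suffices h : map R θ (m + 1) ∘ₗ cone R b m = cone R (θ b) m ∘ₗ map R θ m from
    LinearMap.congr_fun h x
  ext1 v
  ext1
  simp only [LinearMap.comp_apply, Finsupp.lsingle_apply, map_single, cone_single]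
  congr 1
  ext j
  refine Fin.cases ?_ (fun j => ?_) j <;> simp

end VChain

open VChain

variable {n n' : ℕ}

/-- The barycenter of the vertices of an affine simplex. -/
noncomputable def vbary {m : ℕ} (v : Fin (m + 1) → Splx n) : Splx n :=
  affineMap v stdSimplex.barycenter

theorem vbary_map {m : ℕ} (w : Fin (n + 1) → Splx n') (v : Fin (m + 1) → Splx n) :
    vbary (affineMap w ∘ v) = affineMap w (vbary v) := by
  rw [vbary, vbary, ← affineMap_comp]
  rfl

/-- Barycentric subdivision of affine chains. -/
noncomputable def subdiv : ∀ m, VChain R (Splx n) m →ₗ[R] VChain R (Splx n) m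
  | 0 => LinearMap.id
  | m + 1 => Finsupp.linearCombination R fun v =>
      cone R (vbary v) m (subdiv m (bdry R m (Finsupp.single v 1)))

/-- The chain homotopy between the identity and barycentric subdivision of affine chains. -/
noncomputable def subdivHtpy : ∀ m, VChain R (Splx n) m →ₗ[R] VChain R (Splx n) (m + 1)
  | 0 => 0
  | m + 1 => Finsupp.linearCombination R fun v => cone R (v 0) (m + 1)
      (Finsupp.single v 1 - subdiv R (m + 1) (Finsupp.single v 1) -
        subdivHtpy m (bdry R m (Finsupp.single v 1)))

variable {R}

theorem subdiv_succ_single {m : ℕ} (v : Fin (m + 2) → Splx n) :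
    subdiv R (m + 1) (Finsupp.single v 1) =
      cone R (vbary v) m (subdiv R m (bdry R m (Finsupp.single v 1))) := by
  simp [subdiv]

theorem subdivHtpy_succ_single {m : ℕ} (v : Fin (m + 2) → Splx n) :
    subdivHtpy R (m + 1) (Finsupp.single v 1) = cone R (v 0) (m + 1)
      (Finsupp.single v 1 - subdiv R (m + 1) (Finsupp.single v 1) -
        subdivHtpy R m (bdry R m (Finsupp.single v 1))) := by
  simp [subdivHtpy]

/-- A simplex is subdivided as the cone from its barycenter over its subdivided boundary. The cone
formula returns that boundary, since by induction it is a cycle, or in the lowest degree has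
augmentation zero. -/
theorem bdry_subdiv (m : ℕ) (x : VChain R (Splx n) (m + 1)) :
    bdry R m (subdiv R (m + 1) x) = subdiv R m (bdry R m x) := by
  induction m with
  | zero =>
    suffices h : bdry R 0 ∘ₗ subdiv R 1 = subdiv R 0 ∘ₗ bdry R 0 from LinearMap.congr_fun h x
    ext1 v
    ext1
    simp only [LinearMap.comp_apply, Finsupp.lsingle_apply]
    rw [subdiv_succ_single, bdry_cone_zero]
    simp [subdiv, aug_bdry]
  | succ m ih =>
    suffices h : bdry R (m + 1) ∘ₗ subdiv R (m + 2) = subdiv R (m + 1) ∘ₗ bdry R (m + 1) from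
      LinearMap.congr_fun h x
    ext1 v
    ext1
    simp only [LinearMap.comp_apply, Finsupp.lsingle_apply]
    rw [subdiv_succ_single, bdry_cone_succ, ih, bdry_bdry]
    simp

/-- By induction `v - subdiv v - subdivHtpy (∂ v)` is a cycle, hence the boundary of the cone over
it. The apex `v 0` is used because it is compatible with affine maps. -/
theorem bdry_subdivHtpy (m : ℕ) (x : VChain R (Splx n) (m + 1)) :
    bdry R (m + 1) (subdivHtpy R (m + 1) x) =
      x - subdiv R (m + 1) x - subdivHtpy R m (bdry R m x) := by
  have main : ∀ m, (∀ v : Fin (m + 2) → Splx n, bdry R m (Finsupp.single v 1 -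
      subdiv R (m + 1) (Finsupp.single v 1) -
        subdivHtpy R m (bdry R m (Finsupp.single v 1))) = 0) → ∀ x : VChain R (Splx n) (m + 1),
      bdry R (m + 1) (subdivHtpy R (m + 1) x) =
        x - subdiv R (m + 1) x - subdivHtpy R m (bdry R m x) := by
    intro m hm x
    suffices h : bdry R (m + 1) ∘ₗ subdivHtpy R (m + 1) =
        LinearMap.id - subdiv R (m + 1) - subdivHtpy R m ∘ₗ bdry R m from LinearMap.congr_fun h x
    ext1 v
    ext1
    simp only [LinearMap.comp_apply, Finsupp.lsingle_apply, LinearMap.sub_apply, LinearMap.id_apply]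
    rw [subdivHtpy_succ_single, bdry_cone_succ, hm, map_zero, sub_zero]
  induction m with
  | zero =>
    refine main 0 (fun v => ?_) x
    rw [map_sub, map_sub, bdry_subdiv]
    simp [subdiv, subdivHtpy]
  | succ m ih =>
    refine main (m + 1) (fun v => ?_) x
    rw [map_sub, map_sub, bdry_subdiv, ih, bdry_bdry]
    simp

theorem map_subdiv (w : Fin (n + 1) → Splx n') (m : ℕ) (x : VChain R (Splx n) m) :
    map R (affineMap w) m (subdiv R m x) = subdiv R m (map R (affineMap w) m x) := by
  induction m with
  | zero => rfl
  | succ m ih =>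
    suffices h : map R (affineMap w) (m + 1) ∘ₗ subdiv R (m + 1) =
        subdiv R (m + 1) ∘ₗ map R (affineMap w) (m + 1) from LinearMap.congr_fun h x
    ext1 v
    ext1
    simp only [LinearMap.comp_apply, Finsupp.lsingle_apply]
    rw [subdiv_succ_single, map_cone, ih, map_bdry, map_single, subdiv_succ_single, vbary_map]

theorem map_subdivHtpy (w : Fin (n + 1) → Splx n') (m : ℕ) (x : VChain R (Splx n) m) :
    map R (affineMap w) (m + 1) (subdivHtpy R m x) =
      subdivHtpy R m (map R (affineMap w) m x) := by
  induction m with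
  | zero => simp [subdivHtpy]
  | succ m ih =>
    suffices h : map R (affineMap w) (m + 2) ∘ₗ subdivHtpy R (m + 1) =
        subdivHtpy R (m + 1) ∘ₗ map R (affineMap w) (m + 1) from LinearMap.congr_fun h x
    ext1 v
    ext1
    simp only [LinearMap.comp_apply, Finsupp.lsingle_apply]
    simp only [subdivHtpy_succ_single, map_cone, map_sub (map R (affineMap w) _)]
    rw [map_subdiv, ih, map_bdry, map_single,
      subdivHtpy_succ_single]
    rfl

end AffineChains

end MagnitudeHomotopy

namespace MagnitudeHomotopy
open CategoryTheory

/-! ### Iterated subdivision makes affine simplices small -/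

section Small

variable {R : Type} [CommRing R]

theorem apply_mem_of_mem_supported {α M : Type*} [AddCommGroup M] [Module R M]
    (L : (α →₀ R) →ₗ[R] M) {s : Set α} {N : Submodule R M}
    (h : ∀ a ∈ s, L (Finsupp.single a 1) ∈ N) {x : α →₀ R} (hx : x ∈ Finsupp.supported R R s) :
    L x ∈ N := by
  rw [Finsupp.supported_eq_span_single] at hx
  have : Submodule.span R ((fun a => Finsupp.single a (1 : R)) '' s) ≤ N.comap L := by
    rw [Submodule.span_le]
    rintro _ ⟨a, ha, rfl⟩
    exact h a ha
  exact this hx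

theorem single_mem_supported_of_mem {α : Type*} {s : Set α} {a : α} (h : a ∈ s) :
    Finsupp.single a (1 : R) ∈ Finsupp.supported R R s :=
  Finsupp.single_mem_supported R 1 h

open VChain

variable {n m : ℕ}

theorem affineMap_mem_convexHull (v : Fin (m + 1) → Splx n) (t : Splx m) :
    (affineMap v t).1 ∈ convexHull ℝ (Set.range fun i => (v i).1) := by
  have : (affineMap v t).1 = ∑ i, t i • (v i).1 := by
    ext k
    simp only [Finset.sum_apply, Pi.smul_apply, smul_eq_mul]
    rfl
  rw [this]
  exact (convex_convexHull ℝ _).sum_mem (fun i _ => t.2.1 i) t.2.2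
    fun i _ => subset_convexHull ℝ _ ⟨i, rfl⟩

/-- The vector from the barycenter to `v i` is the mean of the `m + 1` differences `v i - v j`, one
of which is zero; hence the factor `m / (m + 1)`. -/
theorem dist_vbary_le (v : Fin (m + 1) → Splx n) {r : ℝ} (hv : ∀ i j, dist (v i) (v j) ≤ r)
    (i : Fin (m + 1)) : dist (v i) (vbary v) ≤ m / (m + 1) * r := by
  have h1 : (v i).1 - (vbary v).1 = ∑ j, ((m : ℝ) + 1)⁻¹ • ((v i).1 - (v j).1) := by
    have h2 : (vbary v).1 = ∑ j, ((m : ℝ) + 1)⁻¹ • (v j).1 := by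
      ext k
      simp only [Finset.sum_apply, Pi.smul_apply, smul_eq_mul]
      change ∑ j, (stdSimplex.barycenter : Splx m).1 j * (v j).1 k = _
      simp
    simp only [smul_sub, Finset.sum_sub_distrib]
    rw [← h2, Finset.sum_const, Finset.card_univ, Fintype.card_fin, ← Nat.cast_smul_eq_nsmul ℝ,
      smul_smul]
    push_cast
    rw [mul_inv_cancel₀ (by positivity), one_smul]
  rw [Subtype.dist_eq, dist_eq_norm, h1]
  calc ‖∑ j, ((m : ℝ) + 1)⁻¹ • ((v i).1 - (v j).1)‖
      ≤ ∑ j, ((m : ℝ) + 1)⁻¹ * dist (v i) (v j) := by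
        refine (norm_sum_le _ _).trans (Finset.sum_le_sum fun j _ => ?_)
        rw [norm_smul, Subtype.dist_eq, dist_eq_norm, Real.norm_of_nonneg (by positivity)]
    _ = ∑ j ∈ Finset.univ.erase i, ((m : ℝ) + 1)⁻¹ * dist (v i) (v j) := by
        rw [← Finset.add_sum_erase _ _ (Finset.mem_univ i)]
        simp
    _ ≤ ∑ j ∈ Finset.univ.erase i, ((m : ℝ) + 1)⁻¹ * r :=
        Finset.sum_le_sum fun j _ => mul_le_mul_of_nonneg_left (hv i j) (by positivity)
    _ = m / (m + 1) * r := by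
        rw [Finset.sum_const, Finset.card_erase_of_mem (Finset.mem_univ i), Finset.card_univ,
          Fintype.card_fin, nsmul_eq_mul]
        simp only [add_tsub_cancel_right]
        ring

/-- The hull condition is there for the induction: vertices of the subdivided boundary stay in the
hull of the vertices of `v`, hence, by convexity of balls, within the required distance of the new
apex. -/
theorem subdiv_single_mem : ∀ (m : ℕ) (v : Fin (m + 1) → Splx n) (r : ℝ),
    (∀ i j, dist (v i) (v j) ≤ r) → subdiv R m (Finsupp.single v 1) ∈ Finsupp.supported R R
      {w : Fin (m + 1) → Splx n | (∀ i j, dist (w i) (w j) ≤ m / (m + 1) * r) ∧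
        ∀ i, (w i).1 ∈ convexHull ℝ (Set.range fun i => (v i).1)} := by
  intro m
  induction m with
  | zero =>
    intro v r hv
    refine single_mem_supported_of_mem ⟨fun i j => ?_, fun i => subset_convexHull ℝ _ ⟨i, rfl⟩⟩
    rw [show i = j from Subsingleton.elim (α := Fin 1) i j]
    simp
  | succ m ih =>
    intro v r hv
    have hr : 0 ≤ r := dist_nonneg.trans (hv 0 0)
    have hb : ∀ i, dist (v i) (vbary v) ≤ (m + 1 : ℕ) / ((m + 1 : ℕ) + 1) * r := dist_vbary_le v hv
    have hsub : convexHull ℝ (Set.range fun i => (v i).1) ⊆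
        Metric.closedBall (vbary v).1 ((m + 1 : ℕ) / ((m + 1 : ℕ) + 1) * r) := by
      refine convexHull_min ?_ (convex_closedBall _ _)
      rintro _ ⟨i, rfl⟩
      exact hb i
    rw [subdiv_succ_single]
    refine apply_mem_of_mem_supported (s := {w : Fin (m + 1) → Splx n |
      (∀ i j, dist (w i) (w j) ≤ m / (m + 1) * r) ∧
        ∀ i, (w i).1 ∈ convexHull ℝ (Set.range fun i => (v i).1)}) (cone R (vbary v) m) ?_ ?_
    · rintro w ⟨hw, hw'⟩
      rw [cone_single]
      refine single_mem_supported_of_mem ⟨?_, ?_⟩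
      · have h0 : ∀ j, dist (w j) (vbary v) ≤ (m + 1 : ℕ) / ((m + 1 : ℕ) + 1) * r :=
          fun j => hsub (hw' j)
        refine Fin.cases ?_ fun i => ?_
        · refine Fin.cases ?_ fun j => ?_
          · simp only [Fin.cons_zero, dist_self]
            positivity
          · simpa only [Fin.cons_zero, Fin.cons_succ, dist_comm (vbary v)] using h0 j
        · refine Fin.cases ?_ fun j => ?_
          · simpa only [Fin.cons_zero, Fin.cons_succ] using h0 i
          · simp only [Fin.cons_succ]
            -- Edges inside a subdivided face shrink by `m / (m + 1)`, which is at most the factor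
            -- allowed one dimension higher.
            refine (hw i j).trans (mul_le_mul_of_nonneg_right ?_ hr)
            push_cast
            rw [div_le_div_iff₀ (by positivity) (by positivity)]
            nlinarith
      · refine Fin.cases ?_ fun i => ?_
        · exact affineMap_mem_convexHull v _
        · exact hw' i
    · rw [bdry_single, map_sum]
      refine Submodule.sum_mem _ fun i _ => ?_
      rw [map_smul]
      refine Submodule.smul_mem _ _ (Finsupp.supported_mono ?_
        (ih (v ∘ i.succAbove) r fun j k => hv _ _))
      rintro w ⟨hw, hw'⟩
      refine ⟨hw, fun j => convexHull_mono ?_ (hw' j)⟩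
      rintro _ ⟨k, rfl⟩
      exact ⟨_, rfl⟩

theorem subdiv_iterate_mem (m : ℕ) {r : ℝ} {x : VChain R (Splx n) m}
    (hx : x ∈ Finsupp.supported R R {w : Fin (m + 1) → Splx n | ∀ i j, dist (w i) (w j) ≤ r})
    (k : ℕ) : (subdiv R m)^[k] x ∈ Finsupp.supported R R
      {w : Fin (m + 1) → Splx n | ∀ i j, dist (w i) (w j) ≤ ((m : ℝ) / (m + 1)) ^ k * r} := by
  induction k with
  | zero => simpa using hx
  | succ k ih =>
    rw [Function.iterate_succ_apply', pow_succ', mul_assoc]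
    refine apply_mem_of_mem_supported _ (fun v hv => ?_) ih
    exact Finsupp.supported_mono (fun w hw => hw.1) (subdiv_single_mem m v _ hv)

end Small

/-! ### Singular chains -/

section Singular

variable (R : Type) [CommRing R] {A : Type u} [TopologicalSpace A]

/-- Singular chains. -/
abbrev SChain (A : Type u) [TopologicalSpace A] (n : ℕ) : Type u := C(Splx n, A) →₀ R

/-- The push forward of affine chains along a singular simplex. -/
noncomputable def push {n : ℕ} (σ : C(Splx n, A)) (m : ℕ) :
    VChain R (Splx n) m →ₗ[R] SChain R A m :=
  Finsupp.lmapDomain R R fun v => σ.comp (affineMap v)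

variable {R}

theorem push_single {n : ℕ} (σ : C(Splx n, A)) (m : ℕ) (v : Fin (m + 1) → Splx n) :
    push R σ m (Finsupp.single v 1) = Finsupp.single (σ.comp (affineMap v)) 1 := by
  simp [push]

theorem push_comp_affineMap {n n' : ℕ} (σ : C(Splx n, A)) (w : Fin (n' + 1) → Splx n) (m : ℕ)
    (x : VChain R (Splx n') m) :
    push R (σ.comp (affineMap w)) m x = push R σ m (VChain.map R (affineMap w) m x) := by
  suffices h : push R (σ.comp (affineMap w)) m = push R σ m ∘ₗ VChain.map R (affineMap w) m from
    LinearMap.congr_fun h x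
  ext1 v
  ext1
  simp only [LinearMap.comp_apply, Finsupp.lsingle_apply, push_single, VChain.map_single]
  rw [ContinuousMap.comp_assoc, affineMap_comp]

theorem push_vertex {n : ℕ} (σ : C(Splx n, A)) :
    push R σ n (Finsupp.single stdSimplex.vertex 1) = Finsupp.single σ 1 := by
  rw [push_single, affineMap_vertex_eq_id]
  rfl

theorem push_mem_supported {n : ℕ} {σ : C(Splx n, A)} {U : Set A} (hσ : Set.range σ ⊆ U) (m : ℕ)
    (x : VChain R (Splx n) m) :
    push R σ m x ∈ Finsupp.supported R R {τ : C(Splx m, A) | Set.range τ ⊆ U} := by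
  refine apply_mem_of_mem_supported (s := Set.univ) _ (fun v _ => ?_)
    (by rw [Finsupp.supported_univ]; trivial)
  rw [push_single]
  refine single_mem_supported_of_mem (subset_trans ?_ hσ)
  rintro _ ⟨t, rfl⟩
  exact ⟨_, rfl⟩

/-- The natural operation on singular chains determined by an affine chain. -/
noncomputable def natOp {n m : ℕ} (c : VChain R (Splx n) m) : SChain R A n →ₗ[R] SChain R A m :=
  Finsupp.linearCombination R fun σ => push R σ m c

theorem natOp_single {n m : ℕ} (c : VChain R (Splx n) m) (σ : C(Splx n, A)) :
    natOp c (Finsupp.single σ 1) = push R σ m c := by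
  simp [natOp]

/-- An operation on affine chains that commutes with affine maps is determined by its value on the
identity simplex. Pushing that value forward agrees with applying the operation first, so identities
between such operations pass to singular chains. -/
theorem natOp_push {n m : ℕ} (op : ∀ k, VChain R (Splx k) n →ₗ[R] VChain R (Splx k) m)
    (hop : ∀ k (w : Fin (n + 1) → Splx k) (x : VChain R (Splx n) n),
      VChain.map R (affineMap w) m (op n x) = op k (VChain.map R (affineMap w) n x))
    {k : ℕ} (σ : C(Splx k, A)) (x : VChain R (Splx k) n) :
    natOp (op n (Finsupp.single stdSimplex.vertex 1)) (push R σ n x) = push R σ m (op k x) := by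
  suffices h : natOp (op n (Finsupp.single stdSimplex.vertex 1)) ∘ₗ push R σ n =
      push R σ m ∘ₗ op k from LinearMap.congr_fun h x
  ext1 v
  ext1
  simp only [LinearMap.comp_apply, Finsupp.lsingle_apply]
  rw [push_single, natOp_single, push_comp_affineMap, hop, VChain.map_single,
    affineMap_comp_vertex]

theorem natOp_mem_supported {n m : ℕ} (c : VChain R (Splx n) m) {U : Set A} {x : SChain R A n}
    (hx : x ∈ Finsupp.supported R R {τ : C(Splx n, A) | Set.range τ ⊆ U}) :
    natOp c x ∈ Finsupp.supported R R {τ : C(Splx m, A) | Set.range τ ⊆ U} := by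
  refine apply_mem_of_mem_supported _ (fun σ hσ => ?_) hx
  rw [natOp_single]
  exact push_mem_supported hσ m c

variable (R A) in
/-- The differential of singular chains. -/
noncomputable def sdiff (n : ℕ) : SChain R A (n + 1) →ₗ[R] SChain R A n :=
  natOp (VChain.bdry R n (Finsupp.single stdSimplex.vertex 1))

variable (R A) in
/-- Barycentric subdivision of singular chains. -/
noncomputable def ssubdiv (n : ℕ) : SChain R A n →ₗ[R] SChain R A n :=
  natOp (subdiv R n (Finsupp.single stdSimplex.vertex 1))

variable (R A) in
/-- The chain homotopy between the identity and barycentric subdivision of singular chains. -/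
noncomputable def ssubdivHtpy (n : ℕ) : SChain R A n →ₗ[R] SChain R A (n + 1) :=
  natOp (subdivHtpy R n (Finsupp.single stdSimplex.vertex 1))

theorem sdiff_push {k n : ℕ} (σ : C(Splx k, A)) (x : VChain R (Splx k) (n + 1)) :
    sdiff R A n (push R σ (n + 1) x) = push R σ n (VChain.bdry R n x) :=
  natOp_push (fun _ => VChain.bdry R n) (fun _ _ _ => VChain.map_bdry _ _ _) σ x

theorem ssubdiv_push {k n : ℕ} (σ : C(Splx k, A)) (x : VChain R (Splx k) n) :
    ssubdiv R A n (push R σ n x) = push R σ n (subdiv R n x) :=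
  natOp_push (fun _ => subdiv R n) (fun _ _ _ => map_subdiv _ _ _) σ x

theorem ssubdivHtpy_push {k n : ℕ} (σ : C(Splx k, A)) (x : VChain R (Splx k) n) :
    ssubdivHtpy R A n (push R σ n x) = push R σ (n + 1) (subdivHtpy R n x) :=
  natOp_push (fun _ => subdivHtpy R n) (fun _ _ _ => map_subdivHtpy _ _ _) σ x

theorem SChain.ext_single {M : Type*} [AddCommGroup M] [Module R M] {n : ℕ}
    {f g : SChain R A n →ₗ[R] M}
    (h : ∀ σ : C(Splx n, A), f (push R σ n (Finsupp.single stdSimplex.vertex 1)) =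
      g (push R σ n (Finsupp.single stdSimplex.vertex 1))) : f = g := by
  ext1 σ
  ext1
  have := h σ
  rwa [push_vertex] at this

theorem sdiff_sdiff (n : ℕ) (x : SChain R A (n + 2)) : sdiff R A n (sdiff R A (n + 1) x) = 0 := by
  suffices h : sdiff R A n ∘ₗ sdiff R A (n + 1) = 0 from LinearMap.congr_fun h x
  refine SChain.ext_single fun σ => ?_
  simp only [LinearMap.comp_apply, sdiff_push, VChain.bdry_bdry, map_zero, LinearMap.zero_apply]

theorem sdiff_ssubdiv (n : ℕ) (x : SChain R A (n + 1)) :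
    sdiff R A n (ssubdiv R A (n + 1) x) = ssubdiv R A n (sdiff R A n x) := by
  suffices h : sdiff R A n ∘ₗ ssubdiv R A (n + 1) = ssubdiv R A n ∘ₗ sdiff R A n from
    LinearMap.congr_fun h x
  refine SChain.ext_single fun σ => ?_
  simp only [LinearMap.comp_apply, sdiff_push, ssubdiv_push, bdry_subdiv]

theorem sdiff_ssubdivHtpy (n : ℕ) (x : SChain R A (n + 1)) :
    sdiff R A (n + 1) (ssubdivHtpy R A (n + 1) x) =
      x - ssubdiv R A (n + 1) x - ssubdivHtpy R A n (sdiff R A n x) := by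
  suffices h : sdiff R A (n + 1) ∘ₗ ssubdivHtpy R A (n + 1) =
      LinearMap.id - ssubdiv R A (n + 1) - ssubdivHtpy R A n ∘ₗ sdiff R A n from
    LinearMap.congr_fun h x
  refine SChain.ext_single fun σ => ?_
  simp only [LinearMap.comp_apply, sdiff_push, ssubdiv_push, ssubdivHtpy_push, LinearMap.sub_apply,
    LinearMap.id_apply, bdry_subdivHtpy, map_sub]

theorem ssubdiv_zero (x : SChain R A 0) : ssubdiv R A 0 x = x := by
  suffices h : ssubdiv R A 0 = LinearMap.id from LinearMap.congr_fun h x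
  refine SChain.ext_single fun σ => ?_
  rw [ssubdiv_push]
  rfl

theorem ssubdiv_iterate_push {k n : ℕ} (σ : C(Splx k, A)) (x : VChain R (Splx k) n) (j : ℕ) :
    (ssubdiv R A n)^[j] (push R σ n x) = push R σ n ((subdiv R n)^[j] x) := by
  induction j with
  | zero => rfl
  | succ j ih => rw [Function.iterate_succ_apply', ih, ssubdiv_push, Function.iterate_succ_apply']

variable (R) in
/-- The singular chains with all simplices in `U`. -/
def chainsIn (U : Set A) (n : ℕ) : Submodule R (SChain R A n) :=
  Finsupp.supported R R {τ : C(Splx n, A) | Set.range τ ⊆ U}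

/-- Once iterated subdivision has made the affine simplices smaller than a Lebesgue number of the
pulled back cover, each of them maps into `U` or into `V`. -/
theorem exists_push_iterate_mem {U V : Set A} (hU : IsOpen U) (hV : IsOpen V) {n : ℕ}
    (σ : C(Splx n, A)) (hσ : Set.range σ ⊆ U ∪ V) :
    ∃ j₀, ∀ j ≥ j₀, (ssubdiv R A n)^[j] (Finsupp.single σ 1) ∈
      chainsIn R U n ⊔ chainsIn R V n := by
  obtain ⟨δ, hδ, hδ'⟩ := lebesgue_number_lemma_of_metric (s := (Set.univ : Set (Splx n)))
    (c := fun b : Bool => σ ⁻¹' (cond b U V)) isCompact_univ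
    (fun b => by cases b; exacts [hV.preimage σ.continuous, hU.preimage σ.continuous])
    (fun t _ => by
      rcases hσ ⟨t, rfl⟩ with h | h
      · exact Set.mem_iUnion.2 ⟨true, h⟩
      · exact Set.mem_iUnion.2 ⟨false, h⟩)
  -- The sum of all distances between vertices is a crude bound for each of them; any finite bound
  -- would do.
  set r : ℝ := ∑ i : Fin (n + 1), ∑ j : Fin (n + 1),
    dist (stdSimplex.vertex i : Splx n) (stdSimplex.vertex j) with hr
  have hv : ∀ i j : Fin (n + 1), dist (stdSimplex.vertex i : Splx n) (stdSimplex.vertex j) ≤ r := by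
    intro i j
    refine le_trans ?_ (Finset.single_le_sum (f := fun i => ∑ j : Fin (n + 1),
      dist (stdSimplex.vertex i : Splx n) (stdSimplex.vertex j))
      (fun i _ => Finset.sum_nonneg fun j _ => dist_nonneg) (Finset.mem_univ i))
    exact Finset.single_le_sum (f := fun j => dist (stdSimplex.vertex i : Splx n)
      (stdSimplex.vertex j)) (fun j _ => dist_nonneg) (Finset.mem_univ j)
  have hlim : Filter.Tendsto (fun k : ℕ => ((n : ℝ) / (n + 1)) ^ k * r) Filter.atTop
      (nhds (0 * r)) :=
    (tendsto_pow_atTop_nhds_zero_of_lt_one (by positivity)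
      (by rw [div_lt_one (by positivity)]; linarith)).mul_const r
  rw [zero_mul] at hlim
  obtain ⟨j₀, hj₀⟩ := Filter.eventually_atTop.1 (hlim.eventually (gt_mem_nhds hδ))
  refine ⟨j₀, fun j hj => ?_⟩
  rw [← push_vertex, ssubdiv_iterate_push]
  refine apply_mem_of_mem_supported _ (fun w hw => ?_)
    (subdiv_iterate_mem n (r := r) (single_mem_supported_of_mem hv) j)
  rw [push_single]
  have hsub : ∀ t, affineMap w t ∈ Metric.ball (w 0) δ := by
    intro t
    have h1 : convexHull ℝ (Set.range fun i => (w i).1) ⊆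
        Metric.closedBall (w 0).1 (((n : ℝ) / (n + 1)) ^ j * r) := by
      refine convexHull_min ?_ (convex_closedBall _ _)
      rintro _ ⟨i, rfl⟩
      exact hw i 0
    exact lt_of_le_of_lt (h1 (affineMap_mem_convexHull w t)) (hj₀ j hj)
  obtain ⟨b, hb⟩ := hδ' (w 0) trivial
  have hb' : Set.range (σ.comp (affineMap w)) ⊆ cond b U V := by
    rintro _ ⟨t, rfl⟩
    exact hb (hsub t)
  cases b
  · exact Submodule.mem_sup_right (single_mem_supported_of_mem hb')
  · exact Submodule.mem_sup_left (single_mem_supported_of_mem hb')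

/-- The conclusion is required for all later iterates so that finitely many simplices can be handled
with a common bound. -/
theorem exists_iterate_mem {U V : Set A} (hU : IsOpen U) (hV : IsOpen V) {n : ℕ}
    {x : SChain R A n} (hx : x ∈ chainsIn R (U ∪ V) n) :
    ∃ j₀, ∀ j ≥ j₀, (ssubdiv R A n)^[j] x ∈ chainsIn R U n ⊔ chainsIn R V n := by
  rw [chainsIn, Finsupp.supported_eq_span_single] at hx
  induction hx using Submodule.span_induction with
  | mem x hx =>
    obtain ⟨σ, hσ, rfl⟩ := hx
    exact exists_push_iterate_mem hU hV σ hσ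
  | zero => exact ⟨0, fun j _ => by rw [iterate_map_zero]; exact Submodule.zero_mem _⟩
  | add x y _ _ hx hy =>
    obtain ⟨j, hj⟩ := hx
    obtain ⟨k, hk⟩ := hy
    refine ⟨max j k, fun l hl => ?_⟩
    rw [iterate_map_add]
    exact Submodule.add_mem _ (hj l (le_of_max_le_left hl)) (hk l (le_of_max_le_right hl))
  | smul c x _ hx =>
    obtain ⟨j, hj⟩ := hx
    refine ⟨j, fun l hl => ?_⟩
    rw [← Module.End.pow_apply, map_smul, Module.End.pow_apply]
    exact Submodule.smul_mem _ _ (hj l hl)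

/-- Induction on the number of subdivisions that make `x` small. One subdivision changes `x` by the
boundary of a chain in `U ∪ V` plus the homotopy applied to `∂x`; the latter is already small
because `∂x` is and natural operations preserve supports. -/
theorem exists_sub_sdiff_mem {U V : Set A} (hU : IsOpen U) (hV : IsOpen V) {n : ℕ}
    {x : SChain R A (n + 1)} (hx : x ∈ chainsIn R (U ∪ V) (n + 1))
    (hdx : sdiff R A n x ∈ chainsIn R U n ⊔ chainsIn R V n) :
    ∃ y ∈ chainsIn R (U ∪ V) (n + 2),
      x - sdiff R A (n + 1) y ∈ chainsIn R U (n + 1) ⊔ chainsIn R V (n + 1) := by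
  have hop : ∀ {k l : ℕ} (c : VChain R (Splx k) l) {x : SChain R A k},
      x ∈ chainsIn R U k ⊔ chainsIn R V k → natOp c x ∈ chainsIn R U l ⊔ chainsIn R V l := by
    intro k l c x hx
    obtain ⟨y, hy, z, hz, rfl⟩ := Submodule.mem_sup.1 hx
    rw [map_add]
    exact Submodule.add_mem_sup (natOp_mem_supported c hy) (natOp_mem_supported c hz)
  obtain ⟨j, hj⟩ := exists_iterate_mem hU hV hx
  replace hj := hj j le_rfl
  induction j generalizing x with
  | zero => exact ⟨0, Submodule.zero_mem _, by simpa using hj⟩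
  | succ j ih =>
    obtain ⟨y, hy, hxy⟩ := ih (x := ssubdiv R A (n + 1) x) (natOp_mem_supported _ hx)
      (by rw [sdiff_ssubdiv]; exact hop _ hdx) hj
    refine ⟨y + ssubdivHtpy R A (n + 1) x,
      Submodule.add_mem _ hy (natOp_mem_supported _ hx), ?_⟩
    rw [map_add, sdiff_ssubdivHtpy]
    have := Submodule.add_mem _ hxy (hop (subdivHtpy R n (Finsupp.single stdSimplex.vertex 1)) hdx)
    convert this using 1
    rw [ssubdivHtpy]
    abel

variable (R A) in
/-- The singular chain complex. -/
noncomputable def SComplex : ChainComplex (ModuleCat.{u} R) ℕ :=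
  ChainComplex.of (fun n => ModuleCat.of R (SChain R A n)) (fun n => ModuleCat.ofHom (sdiff R A n))
    fun n => by
      ext1
      exact LinearMap.ext fun x => sdiff_sdiff n x

theorem SComplex_d (n : ℕ) : (SComplex R A).d (n + 1) n = ModuleCat.ofHom (sdiff R A n) :=
  ChainComplex.of_d (fun n => ModuleCat.of R (SChain R A n))
    (fun n => ModuleCat.ofHom (sdiff R A n)) n

variable (R) in
/-- The subcomplex of the singular simplices in a subset. -/
noncomputable def subsetComplex (U : Set A) : ChainSubcomplex (SComplex R A) where
  carrier n := chainsIn R U n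
  stable n x hx := by
    rw [SComplex_d]
    exact natOp_mem_supported _ hx

/-! ### Mayer–Vietoris for two open sets -/

variable [IsDomain R] [IsNoetherianRing R]

theorem hasEulerChar_union {U V : Set A} (hU : IsOpen U) (hV : IsOpen V) {p q r : ℤ}
    (hp : HasEulerChar (fun k => (ChainSubcomplex.rel (.zero _) (subsetComplex R U)).homology k) p)
    (hq : HasEulerChar (fun k => (ChainSubcomplex.rel (.zero _) (subsetComplex R V)).homology k) q)
    (hr : HasEulerChar
      (fun k => (ChainSubcomplex.rel (.zero _) (subsetComplex R (U ∩ V))).homology k) r) :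
    HasEulerChar (fun k => (ChainSubcomplex.rel (.zero _) (subsetComplex R (U ∪ V))).homology k)
      (p + q - r) := by
  have hinf : subsetComplex R (U ∩ V) = (subsetComplex R U).inf (subsetComplex R V) := by
    rw [subsetComplex, ChainSubcomplex.inf]
    congr 1
    ext1 n
    refine Eq.trans ?_ (Finsupp.supported_inter _ _)
    simp only [chainsIn, Set.subset_inter_iff, Set.ofPred_and]
  have mono : ∀ {U V : Set A}, U ⊆ V → ∀ n, chainsIn R U n ≤ chainsIn R V n :=
    fun h n => Finsupp.supported_mono fun σ hσ => subset_trans hσ h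
  rw [hinf] at hr
  refine ChainSubcomplex.hasEulerChar_mayerVietoris (mono Set.subset_union_left)
    (mono Set.subset_union_right)
    (ChainSubcomplex.subsingleton_homology_rel ?_ ?_) hp hq hr
  · intro x hx
    refine ⟨0, Submodule.zero_mem _, ?_⟩
    rw [map_zero, sub_zero]
    obtain ⟨j, hj⟩ := exists_iterate_mem hU hV hx
    -- Subdivision fixes `0`-chains, so a `0`-chain in the union is already a sum of chains in the
    -- two sets.
    have h0 : (ssubdiv R A 0)^[j] x = x := Function.iterate_fixed (ssubdiv_zero x) j
    have := hj j le_rfl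
    rw [h0] at this
    exact this
  · intro n x hx hdx
    rw [SComplex_d] at hdx
    obtain ⟨y, hy, hxy⟩ := exists_sub_sdiff_mem hU hV hx hdx
    refine ⟨y, hy, ?_⟩
    rw [SComplex_d]
    exact hxy

end Singular

end MagnitudeHomotopy

namespace MagnitudeHomotopy
open CategoryTheory

/-! ### Comparison with the singular homology of Mathlib -/

section Comparison

variable {R : Type} [CommRing R] {A : Type u} [TopologicalSpace A]

theorem sdiff_single (n : ℕ) (σ : C(Splx (n + 1), A)) :
    sdiff R A n (Finsupp.single σ 1) = ∑ i : Fin (n + 2), (-1 : R) ^ (i : ℕ) •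
      Finsupp.single (σ.comp (affineMap (stdSimplex.vertex ∘ i.succAbove))) 1 := by
  rw [sdiff, natOp_single, VChain.bdry_single, map_sum]
  simp only [map_smul, push_single]

theorem affineMap_vertex_comp {ι κ : Type*} [Fintype ι] [Fintype κ] [DecidableEq κ] (f : ι → κ)
    (t : stdSimplex ℝ ι) : affineMap (stdSimplex.vertex ∘ f) t = stdSimplex.map f t := by
  classical
  ext k
  rw [affineMap_apply, stdSimplex.map_coe, FunOnFinite.linearMap_apply_apply, Finset.sum_filter]
  refine Finset.sum_congr rfl fun i _ => ?_
  simp [Pi.single_apply, eq_comm]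

/-- Simplices of the singular simplicial set are singular simplices. -/
noncomputable def singularEquiv (A : TopCat.{u}) (n : ℕ) :
    (TopCat.toSSet.obj A).obj (Opposite.op (SimplexCategory.mk n)) ≃ C(Splx n, A) :=
  A.toSSetObjEquiv _

theorem singularEquiv_δ (A : TopCat.{u}) {n : ℕ} (i : Fin (n + 2))
    (x : (TopCat.toSSet.obj A).obj (Opposite.op (SimplexCategory.mk (n + 1)))) :
    singularEquiv A n ((TopCat.toSSet.obj A).δ i x) =
      (singularEquiv A (n + 1) x).comp (affineMap (stdSimplex.vertex ∘ i.succAbove)) := by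
  ext t
  rw [ContinuousMap.comp_apply, affineMap_vertex_comp]
  rfl

/-- The coefficient module of singular homology. -/
abbrev coeffs : ModuleCat.{u} ℤ := ModuleCat.of ℤ (ULift.{u} ℤ)

/-- The summand of the singular chain group that corresponds to a singular simplex. -/
noncomputable def simplexHom (A : TopCat.{u}) {n : ℕ} (σ : C(Splx n, A)) :
    coeffs.{u} ⟶ (SComplex ℤ A).X n :=
  ModuleCat.ofHom ((Finsupp.lsingle σ : ℤ →ₗ[ℤ] SChain ℤ A n) ∘ₗ
    (ULift.moduleEquiv : ULift.{u} ℤ ≃ₗ[ℤ] ℤ).toLinearMap)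

theorem simplexHom_hom_ext {A : TopCat.{u}} {n : ℕ} {M : ModuleCat.{u} ℤ}
    {f g : (SComplex ℤ A).X n ⟶ M} (h : ∀ σ, simplexHom A σ ≫ f = simplexHom A σ ≫ g) : f = g := by
  ext1
  refine Finsupp.lhom_ext fun σ r => ?_
  exact LinearMap.congr_fun (congrArg ModuleCat.Hom.hom (h σ)) (ULift.up r)

theorem simplexHom_d (A : TopCat.{u}) (n : ℕ) (σ : C(Splx (n + 1), A)) :
    simplexHom A σ ≫ (SComplex ℤ A).d (n + 1) n = ∑ i : Fin (n + 2), (-1 : ℤ) ^ (i : ℕ) •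
      simplexHom A (σ.comp (affineMap (stdSimplex.vertex ∘ i.succAbove))) := by
  rw [SComplex_d]
  ext1
  refine LinearMap.ext fun y => ?_
  refine (congrArg (sdiff ℤ A n) (show Finsupp.single σ y.down =
    y.down • Finsupp.single σ (1 : ℤ) by simp)).trans ?_
  rw [map_smul, sdiff_single, ModuleCat.hom_sum, LinearMap.sum_apply, Finset.smul_sum]
  refine Finset.sum_congr rfl fun i _ => ?_
  rw [ModuleCat.hom_zsmul]
  refine (?_ : _ = (-1 : ℤ) ^ (i : ℕ) • Finsupp.single (σ.comp
    (affineMap (stdSimplex.vertex ∘ i.succAbove)) : C(Splx n, A)) y.down)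
  rw [smul_comm, Finsupp.smul_single_one]

/-- The singular chain groups of Mathlib map to those given by finitely supported functions. -/
noncomputable def chainHom (A : TopCat.{u}) (n : ℕ) :
    ((TopCat.toSSet.obj A).chainComplex coeffs.{u}).X n ⟶ (SComplex ℤ A).X n :=
  Limits.Cofan.IsColimit.desc
    ((TopCat.toSSet.obj A).isColimitChainComplexXCofan coeffs.{u} n)
    fun x => simplexHom A (singularEquiv A n x)

theorem ι_chainHom (A : TopCat.{u}) (n : ℕ)
    (x : (TopCat.toSSet.obj A).obj (Opposite.op (SimplexCategory.mk n))) :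
    (TopCat.toSSet.obj A).ιChainComplex x ≫ chainHom A n = simplexHom A (singularEquiv A n x) :=
  Limits.Cofan.IsColimit.fac ((TopCat.toSSet.obj A).isColimitChainComplexXCofan coeffs.{u} n) _ x

/-- The inverse of `chainHom`. -/
noncomputable def chainInv (A : TopCat.{u}) (n : ℕ) :
    (SComplex ℤ A).X n ⟶ ((TopCat.toSSet.obj A).chainComplex coeffs.{u}).X n :=
  ModuleCat.ofHom (Finsupp.lsum ℕ fun σ : C(Splx n, A) =>
    ((TopCat.toSSet.obj A).ιChainComplex (R := coeffs.{u}) ((singularEquiv A n).symm σ)).hom ∘ₗ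
      (ULift.moduleEquiv : ULift.{u} ℤ ≃ₗ[ℤ] ℤ).symm.toLinearMap)

theorem simplexHom_chainInv (A : TopCat.{u}) (n : ℕ) (σ : C(Splx n, A)) :
    simplexHom A σ ≫ chainInv A n =
      (TopCat.toSSet.obj A).ιChainComplex ((singularEquiv A n).symm σ) := by
  ext1
  refine LinearMap.ext fun y => ?_
  refine (Finsupp.sum_single_index ?_).trans rfl
  exact map_zero _

/-- The two models of the singular chain groups are isomorphic. -/
noncomputable def chainIso (A : TopCat.{u}) (n : ℕ) :
    ((TopCat.toSSet.obj A).chainComplex coeffs.{u}).X n ≅ (SComplex ℤ A).X n where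
  hom := chainHom A n
  inv := chainInv A n
  hom_inv_id := by
    refine SSet.chainComplex_hom_ext fun x => ?_
    rw [← Category.assoc, ι_chainHom, Category.comp_id, simplexHom_chainInv,
      Equiv.symm_apply_apply]
  inv_hom_id := by
    refine simplexHom_hom_ext fun σ => ?_
    rw [← Category.assoc, simplexHom_chainInv, ι_chainHom, Category.comp_id,
      Equiv.apply_symm_apply]

theorem chainHom_d (A : TopCat.{u}) (n : ℕ) :
    chainHom A (n + 1) ≫ (SComplex ℤ A).d (n + 1) n =
      ((TopCat.toSSet.obj A).chainComplex coeffs.{u}).d (n + 1) n ≫ chainHom A n := by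
  refine SSet.chainComplex_hom_ext fun x => ?_
  rw [← Category.assoc, ι_chainHom, SSet.ιChainComplex_d_assoc, simplexHom_d]
  simp only [Preadditive.sum_comp, Preadditive.zsmul_comp, ι_chainHom, singularEquiv_δ]

/-- The two models of the singular chain complex are isomorphic. -/
noncomputable def complexIso (A : TopCat.{u}) :
    (TopCat.toSSet.obj A).chainComplex coeffs.{u} ≅ SComplex ℤ A :=
  HomologicalComplex.Hom.isoOfComponents (chainIso A) (by
    rintro _ n rfl
    exact chainHom_d A n)

end Comparison

/-! ### Euler characteristics of spaces -/

section HasChi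

/-- The singular homology of `A` is finitely generated and almost all zero, with Euler
characteristic `c`. -/
def HasChi (A : Type u) [TopologicalSpace A] (c : ℤ) : Prop :=
  HasEulerChar (fun k => (singularHomology.{u} k).obj (TopCat.of A)) c

theorem hasChi_iff (A : Type u) [TopologicalSpace A] (c : ℤ) :
    HasChi A c ↔ HasEulerChar (fun k => (SComplex ℤ A).homology k) c := by
  have e : ∀ k, (singularHomology.{u} k).obj (TopCat.of A) ≅ (SComplex ℤ A).homology k :=
    fun k => (HomologicalComplex.homologyFunctor _ _ k).mapIso (complexIso (TopCat.of A))
  exact ⟨fun h => h.congr fun k => ⟨(e k).toLinearEquiv⟩,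
    fun h => h.congr fun k => ⟨(e k).symm.toLinearEquiv⟩⟩

end HasChi

end MagnitudeHomotopy

namespace MagnitudeHomotopy
open CategoryTheory

/-! ### Singular chains of a subspace -/

section Subspace

variable {R : Type} [CommRing R] {A : Type u} [TopologicalSpace A] (U : Set A)

/-- The inclusion of a subspace. -/
def subspaceIncl : C(U, A) := ⟨Subtype.val, continuous_subtype_val⟩

variable (R) in
/-- The map of singular chains induced by the inclusion of a subspace. -/
noncomputable def inclChain (n : ℕ) : SChain R U n →ₗ[R] SChain R A n :=
  Finsupp.lmapDomain R R fun σ => (subspaceIncl U).comp σ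

theorem inclChain_injective (n : ℕ) : Function.Injective (inclChain R U n) := by
  refine Finsupp.mapDomain_injective fun σ τ h => ?_
  ext t
  exact DFunLike.congr_fun h t

theorem range_inclChain (n : ℕ) : LinearMap.range (inclChain R U n) = chainsIn R U n := by
  rw [← Submodule.map_top, ← Finsupp.supported_univ, inclChain, Finsupp.lmapDomain_supported,
    chainsIn]
  congr 1
  ext σ
  constructor
  · rintro ⟨τ, -, rfl⟩
    rintro _ ⟨t, rfl⟩
    exact (τ t).2
  · intro h
    exact ⟨⟨fun t => ⟨σ t, h ⟨t, rfl⟩⟩, σ.continuous.subtype_mk _⟩, trivial, rfl⟩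

theorem inclChain_sdiff (n : ℕ) (x : SChain R U (n + 1)) :
    inclChain R U n (sdiff R U n x) = sdiff R A n (inclChain R U (n + 1) x) := by
  suffices h : inclChain R U n ∘ₗ sdiff R U n = sdiff R A n ∘ₗ inclChain R U (n + 1) from
    LinearMap.congr_fun h x
  ext1 σ
  ext1
  simp only [LinearMap.comp_apply, Finsupp.lsingle_apply, sdiff_single, map_sum, map_smul,
    inclChain, Finsupp.lmapDomain_apply, Finsupp.mapDomain_single]
  rfl

theorem inclChain_mem {n : ℕ} (x : SChain R U n) :
    inclChain R U n x ∈ (subsetComplex R U).carrier n :=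
  (range_inclChain U n).le ⟨x, rfl⟩

/-- The singular chains of a subspace form a subquotient of the singular chains. -/
noncomputable def subspaceChain (n : ℕ) :
    SChain R U n →ₗ[R] (ChainSubcomplex.rel (.zero _) (subsetComplex R U)).X n :=
  Submodule.mkQ _ ∘ₗ (inclChain R U n).codRestrict (chainsIn R U n)
    fun x => by rw [← range_inclChain]; exact ⟨x, rfl⟩

theorem subspaceChain_bijective (n : ℕ) :
    Function.Bijective (subspaceChain (R := R) U n) := by
  constructor
  · refine (injective_iff_map_eq_zero _).2 fun x hx => ?_
    have : inclChain R U n x ∈ (ChainSubcomplex.zero (SComplex R A)).carrier n :=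
      (ChainSubcomplex.cls_eq_zero (Q := subsetComplex R U)
        (inclChain_mem U x)).1 hx
    exact (injective_iff_map_eq_zero _).1 (inclChain_injective U n) x ((Submodule.mem_bot R).1 this)
  · intro y
    obtain ⟨y, hy, rfl⟩ := ChainSubcomplex.cls_surjective y
    obtain ⟨x, rfl⟩ : y ∈ LinearMap.range (inclChain R U n) := by
      rw [range_inclChain]; exact hy
    exact ⟨x, rfl⟩

/-- The singular chain complex of a subspace as a subquotient. -/
noncomputable def subspaceIso :
    SComplex R U ≅ ChainSubcomplex.rel (.zero _) (subsetComplex R U) :=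
  HomologicalComplex.Hom.isoOfComponents
    (fun n => (LinearEquiv.ofBijective (subspaceChain U n)
      (subspaceChain_bijective U n)).toModuleIso (X₁ := (SComplex R U).X n)) (by
    rintro _ n rfl
    rw [SComplex_d]
    ext1
    refine LinearMap.ext fun x => ?_
    refine (ChainSubcomplex.d_cls (Q := subsetComplex R U) (x := inclChain R U (n + 1) x)
      (inclChain_mem U x)).trans ?_
    refine (ChainSubcomplex.cls_eq_cls (Q := subsetComplex R U) _
      (y := inclChain R U n (sdiff R U n x)) (inclChain_mem U _)).2 ?_
    rw [SComplex_d]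
    exact (Submodule.mem_bot R).2 (sub_eq_zero.2 (inclChain_sdiff U n x).symm))

/-- This places the chains of all subspaces inside the one complex of the ambient space, where sums
and intersections make sense. -/
theorem hasChi_subset_iff (c : ℤ) : HasChi U c ↔ HasEulerChar
    (fun k => (ChainSubcomplex.rel (.zero _) (subsetComplex ℤ U)).homology k) c := by
  rw [hasChi_iff]
  have e : ∀ k, (SComplex ℤ U).homology k ≅
      (ChainSubcomplex.rel (.zero _) (subsetComplex ℤ U)).homology k :=
    fun k => (HomologicalComplex.homologyFunctor _ _ k).mapIso (subspaceIso U)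
  exact ⟨fun h => h.congr fun k => ⟨(e k).toLinearEquiv⟩,
    fun h => h.congr fun k => ⟨(e k).symm.toLinearEquiv⟩⟩

variable {U}

/-- The Mayer–Vietoris formula for Euler characteristics. -/
theorem HasChi.union {V : Set A} (hU : IsOpen U) (hV : IsOpen V) {p q r : ℤ} (hp : HasChi U p)
    (hq : HasChi V q) (hr : HasChi ↥(U ∩ V) r) : HasChi ↥(U ∪ V) (p + q - r) := by
  rw [hasChi_subset_iff] at *
  exact hasEulerChar_union hU hV hp hq hr

end Subspace

/-! ### Basic properties of the Euler characteristic -/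

section Basic

variable {A B : Type u} [TopologicalSpace A] [TopologicalSpace B]

theorem HasChi.of_homotopyEquiv {c : ℤ} (h : HasChi A c) (e : ContinuousMap.HomotopyEquiv A B) :
    HasChi B c := by
  refine HasEulerChar.congr h fun k => ⟨Iso.toLinearEquiv
    { hom := (singularHomology.{u} k).map (TopCat.ofHom e.toFun)
      inv := (singularHomology.{u} k).map (TopCat.ofHom e.invFun)
      hom_inv_id := ?_
      inv_hom_id := ?_ }⟩
  · rw [← Functor.map_comp, ← CategoryTheory.Functor.map_id]
    exact TopCat.Homotopy.congr_homologyMap_singularChainComplexFunctor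
      (f := TopCat.ofHom e.toFun ≫ TopCat.ofHom e.invFun) (g := 𝟙 (TopCat.of A)) e.left_inv.some _ k
  · rw [← Functor.map_comp, ← CategoryTheory.Functor.map_id]
    exact TopCat.Homotopy.congr_homologyMap_singularChainComplexFunctor
      (f := TopCat.ofHom e.invFun ≫ TopCat.ofHom e.toFun) (g := 𝟙 (TopCat.of B)) e.right_inv.some _ k

theorem HasChi.of_homeomorph {c : ℤ} (h : HasChi A c) (e : A ≃ₜ B) : HasChi B c :=
  h.of_homotopyEquiv e.toHomotopyEquiv

theorem finrank_singularHomology_punit (k : ℕ) :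
    Module.Finite ℤ ((singularHomology.{u} k).obj (TopCat.of PUnit.{u + 1})) ∧
    (k ≠ 0 → Subsingleton ((singularHomology.{u} k).obj (TopCat.of PUnit.{u + 1}))) ∧
    Module.finrank ℤ ((singularHomology.{u} k).obj (TopCat.of PUnit.{u + 1})) =
      if k = 0 then 1 else 0 := by
  by_cases hk : k = 0
  · subst hk
    have : TotallyDisconnectedSpace (TopCat.of PUnit.{u + 1}) :=
      inferInstanceAs (TotallyDisconnectedSpace PUnit.{u + 1})
    have e : (singularHomology.{u} 0).obj (TopCat.of PUnit.{u + 1}) ≅ coeffs.{u} :=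
      AlgebraicTopology.singularHomologyFunctorZeroOfTotallyDisconnectedSpace _ coeffs.{u}
        (TopCat.of PUnit.{u + 1}) ≪≫
      Limits.coproductUniqueIso (β := PUnit.{u + 1}) fun _ => coeffs.{u}
    have e' := e.toLinearEquiv.trans (ULift.moduleEquiv : ULift.{u} ℤ ≃ₗ[ℤ] ℤ)
    refine ⟨Module.Finite.equiv e'.symm, fun h => absurd rfl h, ?_⟩
    rw [e'.finrank_eq, if_pos rfl, Module.finrank_self]
  · have : TotallyDisconnectedSpace (TopCat.of PUnit.{u + 1}) :=
      inferInstanceAs (TotallyDisconnectedSpace PUnit.{u + 1})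
    have h : Subsingleton ((singularHomology.{u} k).obj (TopCat.of PUnit.{u + 1})) :=
      ModuleCat.subsingleton_of_isZero
        (AlgebraicTopology.isZero_singularHomologyFunctor_of_totallyDisconnectedSpace _ k _ _ hk)
    refine ⟨inferInstance, fun _ => h, ?_⟩
    rw [if_neg hk, Module.finrank_zero_of_subsingleton]

theorem hasChi_punit : HasChi PUnit.{u + 1} 1 := by
  refine ⟨fun k => (finrank_singularHomology_punit k).1, 1,
    fun k hk => (finrank_singularHomology_punit k).2.1 (by omega), ?_⟩
  rw [Finset.sum_range_one, (finrank_singularHomology_punit 0).2.2]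
  simp

theorem hasChi_of_contractible [ContractibleSpace A] : HasChi A 1 := by
  have e : ContinuousMap.HomotopyEquiv A PUnit.{u + 1} :=
    (ContractibleSpace.hequiv A PUnit.{u + 1}).some
  exact hasChi_punit.of_homotopyEquiv e.symm

theorem hasChi_of_isEmpty [IsEmpty A] : HasChi A 0 := by
  rw [hasChi_iff]
  refine HasEulerChar.zero fun k => ModuleCat.subsingleton_of_isZero ?_
  rw [← HomologicalComplex.exactAt_iff_isZero_homology]
  refine ShortComplex.exact_of_isZero_X₂ _ ?_
  have : Subsingleton (SChain ℤ A k) := by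
    have : IsEmpty C(Splx k, A) := ⟨fun σ => isEmptyElim (σ (stdSimplex.vertex 0))⟩
    infer_instance
  exact ModuleCat.isZero_of_subsingleton (ModuleCat.of ℤ (SChain ℤ A k))

end Basic

/-! ### Reduced homology -/

section Reduced

/-- The kernel defining reduced homology carries both the module structure of a submodule and the
one of an additive group. They agree because a `ℤ`-module structure is unique, though not by
unfolding. -/
theorem intModule_finrank {M : Type*} [AddCommGroup M] (i : Module ℤ M) :
    @Module.finrank ℤ M _ _ (AddCommGroup.toIntModule M) = @Module.finrank ℤ M _ _ i := by
  rw [Subsingleton.elim i (AddCommGroup.toIntModule M)]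

theorem intModule_finite {M : Type*} [AddCommGroup M] (i : Module ℤ M)
    (h : @Module.Finite ℤ M _ _ i) : @Module.Finite ℤ M _ _ (AddCommGroup.toIntModule M) := by
  rwa [Subsingleton.elim i (AddCommGroup.toIntModule M)] at h

theorem finrank_ker_of_surjective {R M N : Type*} [CommRing R] [IsDomain R] [AddCommGroup M]
    [AddCommGroup N] [Module R M] [Module R N] [Module.Finite R M] (f : M →ₗ[R] N)
    (hf : Function.Surjective f) :
    Module.finrank R M = Module.finrank R N + Module.finrank R (LinearMap.ker f) := by
  rw [← (LinearMap.ker f).finrank_quotient_add_finrank,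
    (f.quotKerEquivOfSurjective hf).finrank_eq]

theorem finite_ker {R M N : Type*} [CommRing R] [IsNoetherianRing R] [AddCommGroup M]
    [AddCommGroup N] [Module R M] [Module R N] [Module.Finite R M] (f : M →ₗ[R] N) :
    Module.Finite R (LinearMap.ker f) := inferInstance

variable {A : Type u} [TopologicalSpace A]

/-- A point of `A` splits the map to the one-point space, so it is surjective on homology. Passing
to kernels lowers the rank by one in degree `0` and changes no other rank. -/
theorem HasChi.reduced [Nonempty A] {c : ℤ} (h : HasChi A c) :
    HasFiniteReducedHomology A ∧ reducedEulerChar A = c - 1 := by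
  set f : ∀ k, (singularHomology.{u} k).obj (TopCat.of A) →ₗ[ℤ]
    (singularHomology.{u} k).obj (TopCat.of PUnit.{u + 1}) := fun k =>
      ((singularHomology.{u} k).map
        (TopCat.ofHom (ContinuousMap.const A PUnit.unit.{u + 1}))).hom with hf
  have hsurj : ∀ k, Function.Surjective (f k) := by
    intro k x
    let i : TopCat.of PUnit.{u + 1} ⟶ TopCat.of A :=
      TopCat.ofHom (ContinuousMap.const _ (Classical.arbitrary A))
    refine ⟨((singularHomology.{u} k).map i).hom x, ?_⟩
    rw [hf, ← LinearMap.comp_apply, ← ModuleCat.hom_comp, ← Functor.map_comp]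
    have : i ≫ TopCat.ofHom (ContinuousMap.const A PUnit.unit.{u + 1}) = 𝟙 _ := rfl
    rw [this, CategoryTheory.Functor.map_id]
    rfl
  have hfin := h.1
  obtain ⟨N, hN, hc⟩ := h.2
  have hsub : ∀ k, N ≤ k → reducedHomology A k = ⊥ := by
    intro k hk
    have := hN k hk
    exact Submodule.eq_bot_of_subsingleton
  -- Degree `0` must occur in the sum for the correction by one to be counted; it does, since `H₀`
  -- surjects onto the homology of a point.
  have hN0 : N ≠ 0 := by
    rintro rfl
    have := hN 0 le_rfl
    have h1 := (hsurj 0).subsingleton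
    have := (finrank_singularHomology_punit.{u} 0).2.2
    rw [Module.finrank_zero_of_subsingleton] at this
    simp at this
  refine ⟨⟨fun k => intModule_finite _ (finite_ker (f k)), ?_⟩, ?_⟩
  · refine (Finset.range N).finite_toSet.subset fun k hk => ?_
    by_contra hk'
    exact hk (hsub k (by simpa using hk'))
  · rw [reducedEulerChar, finsum_eq_sum_of_support_subset (s := Finset.range N)]
    · rw [← hc, eq_sub_iff_add_eq, ← Nat.succ_pred_eq_of_ne_zero hN0]
      have key : ∀ k, (Module.finrank ℤ (reducedHomology A k) : ℤ) =
          Module.finrank ℤ ((singularHomology.{u} k).obj (TopCat.of A)) -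
            if k = 0 then 1 else 0 := by
        intro k
        have h1 := finrank_ker_of_surjective (f k) (hsurj k)
        have h2 := (finrank_singularHomology_punit.{u} k).2.2
        rw [h2] at h1
        have h3 := intModule_finrank (M := reducedHomology A k) (Submodule.module _)
        rw [h3, h1]
        push_cast
        exact (add_sub_cancel_left _ _).symm
      simp only [key, mul_sub, Finset.sum_sub_distrib]
      simp
    · intro k hk
      by_contra hk'
      refine hk ?_
      have hk'' : N ≤ k := by simpa using hk'
      have : Subsingleton (reducedHomology A k) := by
        rw [hsub k hk'']
        infer_instance
      simp only [Module.finrank_zero_of_subsingleton]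
      simp

end Reduced

end MagnitudeHomotopy

namespace MagnitudeHomotopy

/-! ### Attaching a cell -/

section Cell

/-- A space `D` with a closed subset `S` and a point `b` outside of it, that looks like the closed
disc of dimension `n` with its boundary sphere and its centre. -/
structure CellData (D : Type u) [TopologicalSpace D] [T1Space D] (S : Set D) (b : D) (n : ℕ) where
  isClosed : IsClosed S
  notMem : b ∉ S
  ρ : C(unitInterval × {x : D // x ≠ b}, {x : D // x ≠ b})
  ρ_zero : ∀ x, ρ (0, x) = x
  ρ_one : ∀ x, (ρ (1, x)).1 ∈ S
  ρ_of_mem : ∀ t x, x.1 ∈ S → ρ (t, x) = x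
  hasChi_interior : HasChi ↥Sᶜ 1
  hasChi_punctured : HasChi ↥(Sᶜ \ {b}) (1 - (-1) ^ n)

variable {D : Type u} [TopologicalSpace D] [T1Space D] {S : Set D} {b : D} {n : ℕ}
  {Q' Q : Type u} [TopologicalSpace Q'] [TopologicalSpace Q]

/-- The space `Q` is obtained from `Q'` by attaching `D` along `S`. -/
structure IsAttached (S : Set D) (i : C(Q', Q)) (p : C(D, Q)) (φ : C(S, Q')) : Prop where
  comm : ∀ x : S, i (φ x) = p x
  inj : Function.Injective i
  injOn : Set.InjOn p Sᶜ
  notMem_range : ∀ x ∉ S, p x ∉ Set.range i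
  cover : ∀ q, q ∈ Set.range i ∨ ∃ x ∉ S, p x = q
  isOpen : ∀ W : Set Q, IsOpen (i ⁻¹' W) → IsOpen (p ⁻¹' W) → IsOpen W

variable {i : C(Q', Q)} {p : C(D, Q)} {φ : C(S, Q')}

theorem IsAttached.isOpen_image (h : IsAttached S i p φ) {O : Set D} (hO : IsOpen O)
    (hOS : O ⊆ Sᶜ) : IsOpen (p '' O) := by
  refine h.isOpen _ ?_ ?_
  · convert isOpen_empty
    refine Set.eq_empty_of_forall_notMem ?_
    rintro y ⟨x, hx, hxy⟩
    exact h.notMem_range x (hOS hx) ⟨y, hxy.symm⟩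
  · convert hO
    ext x
    constructor
    · rintro ⟨y, hy, hxy⟩
      have hx : x ∉ S := fun hx =>
        h.notMem_range y (hOS hy) ⟨φ ⟨x, hx⟩, (h.comm ⟨x, hx⟩).trans hxy.symm⟩
      rwa [← h.injOn (hOS hy) hx hxy]
    · exact fun hx => ⟨x, hx, rfl⟩

theorem IsAttached.hasChi_image (h : IsAttached S i p φ) {O : Set D} (hO : IsOpen O)
    (hOS : O ⊆ Sᶜ) {c : ℤ} (hc : HasChi O c) : HasChi ↥(p '' O) c := by
  have he : Topology.IsOpenEmbedding (p ∘ (Subtype.val : O → D)) := by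
    refine .of_continuous_injective_isOpenMap (p.continuous.comp continuous_subtype_val) ?_ ?_
    · intro x y hxy
      exact Subtype.ext (h.injOn (hOS x.2) (hOS y.2) hxy)
    · intro W hW
      rw [Set.image_comp]
      refine h.isOpen_image (hO.isOpenEmbedding_subtypeVal.isOpenMap W hW) ?_
      rintro _ ⟨x, -, rfl⟩
      exact hOS x.2
  have e := he.isEmbedding.toHomeomorph
  rw [Set.range_comp, Subtype.range_coe] at e
  exact hc.of_homeomorph e

theorem IsAttached.ne_of_mem_range (h : IsAttached S i p φ) (hb : b ∉ S) (y : Q') :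
    i y ∈ ({p b}ᶜ : Set Q) := fun hy => h.notMem_range b hb ⟨y, hy⟩

theorem IsAttached.ne_of_ne (h : IsAttached S i p φ) (hb : b ∉ S) {x : D} (hx : x ≠ b) :
    p x ∈ ({p b}ᶜ : Set Q) := by
  intro hxb
  by_cases hxS : x ∈ S
  · exact h.notMem_range b hb ⟨φ ⟨x, hxS⟩, (h.comm ⟨x, hxS⟩).trans hxb⟩
  · exact hx (h.injOn hxS hb hxb)

theorem IsAttached.isOpen_compl (h : IsAttached S i p φ) (hb : b ∉ S) :
    IsOpen ({p b}ᶜ : Set Q) := by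
  refine h.isOpen _ ?_ ?_
  · convert isOpen_univ
    exact Set.eq_univ_of_forall fun y => h.ne_of_mem_range hb y
  · convert isOpen_compl_singleton (x := b)
    ext x
    exact ⟨fun hx hxb => hx (congrArg p hxb), fun hx => h.ne_of_ne hb hx⟩

/-- Maps out of the complement of the centre of the attached cell. -/
theorem IsAttached.exists_glue (h : IsAttached S i p φ) (hb : b ∉ S) {T : Type*}
    [TopologicalSpace T] (g₁ : C(Q', T)) (g₂ : C({x : D // x ≠ b}, T))
    (hg : ∀ x : {x : D // x ≠ b}, ∀ hx : x.1 ∈ S, g₁ (φ ⟨x.1, hx⟩) = g₂ x) :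
    ∃ g : C(({p b}ᶜ : Set Q), T), (∀ y, g ⟨i y, h.ne_of_mem_range hb y⟩ = g₁ y) ∧
      ∀ x : {x : D // x ≠ b}, g ⟨p x, h.ne_of_ne hb x.2⟩ = g₂ x := by
  classical
  -- The two prescriptions overlap only at images of points of `S`, where `hg` makes them agree.
  have hcov : ∀ q : ({p b}ᶜ : Set Q), ∃ t : T, (∀ y, i y = q → g₁ y = t) ∧
      ∀ x : {x : D // x ≠ b}, p x = q → g₂ x = t := by
    rintro ⟨q, hq⟩
    rcases h.cover q with ⟨y, rfl⟩ | ⟨x, hx, rfl⟩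
    · refine ⟨g₁ y, fun y' hy' => by rw [h.inj hy'], fun x hx => ?_⟩
      have hxS : x.1 ∈ S := by
        by_contra hxS
        exact h.notMem_range x.1 hxS ⟨y, hx.symm⟩
      rw [← hg x hxS]
      exact congrArg g₁ (h.inj ((h.comm _).trans hx))
    · have hxb : x ≠ b := fun hxb => hq (congrArg p hxb)
      refine ⟨g₂ ⟨x, hxb⟩, fun y hy => absurd ⟨y, hy⟩ (h.notMem_range x hx), fun x' hx' => ?_⟩
      have hx'S : x'.1 ∉ S := fun hxS => h.notMem_range x hx
        ⟨φ ⟨x', hxS⟩, (h.comm ⟨x', hxS⟩).trans hx'⟩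
      exact congrArg g₂ (Subtype.ext (h.injOn hx'S hx hx'))
  choose g hg₁ hg₂ using hcov
  have hg₁' : ∀ y, g ⟨i y, h.ne_of_mem_range hb y⟩ = g₁ y := fun y => (hg₁ _ y rfl).symm
  have hg₂' : ∀ x : {x : D // x ≠ b}, g ⟨p x, h.ne_of_ne hb x.2⟩ = g₂ x :=
    fun x => (hg₂ _ x rfl).symm
  refine ⟨⟨g, ⟨fun W hW => ?_⟩⟩, hg₁', hg₂'⟩
  rw [(h.isOpen_compl hb).isOpenEmbedding_subtypeVal.isOpen_iff_image_isOpen]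
  refine h.isOpen _ ?_ ?_
  · convert hW.preimage g₁.continuous
    ext y
    constructor
    · rintro ⟨q, hq, hqy⟩
      rw [Set.mem_preimage, ← hg₁' y]
      have : q = ⟨i y, h.ne_of_mem_range hb y⟩ := Subtype.ext hqy
      rwa [← this]
    · intro hy
      exact ⟨⟨i y, h.ne_of_mem_range hb y⟩, by rw [Set.mem_preimage, hg₁']; exact hy, rfl⟩
  · convert (isOpen_compl_singleton (x := b)).isOpenEmbedding_subtypeVal.isOpenMap _
      (hW.preimage g₂.continuous)
    ext x
    constructor
    · rintro ⟨q, hq, hqx⟩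
      have hxb : x ≠ b := fun hxb => q.2 (hqx.trans (congrArg p hxb))
      refine ⟨⟨x, hxb⟩, ?_, rfl⟩
      have : q = ⟨p x, h.ne_of_ne hb hxb⟩ := Subtype.ext hqx
      change g₂ ⟨x, hxb⟩ ∈ W
      rw [← hg₂' ⟨x, hxb⟩, ← this]
      exact hq
    · rintro ⟨x, hx, rfl⟩
      exact ⟨⟨p x, h.ne_of_ne hb x.2⟩, by
        have hx' : g₂ ⟨x.1, x.2⟩ ∈ W := hx
        rwa [← hg₂' ⟨x.1, x.2⟩] at hx', rfl⟩

/-- The complement of the centre of the attached cell deformation retracts onto `Q'`. -/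
theorem IsAttached.nonempty_homotopyEquiv (h : IsAttached S i p φ) (cell : CellData D S b n) :
    Nonempty (ContinuousMap.HomotopyEquiv ({p b}ᶜ : Set Q) Q') := by
  have hb := cell.notMem
  obtain ⟨r, hr₁, hr₂⟩ := h.exists_glue hb (ContinuousMap.id Q')
    (φ.comp ⟨fun x => ⟨(cell.ρ (1, x)).1, cell.ρ_one x⟩, by fun_prop⟩)
    (fun x hx => congrArg φ (Subtype.ext (by
      change x.1 = (cell.ρ (1, x)).1
      rw [cell.ρ_of_mem 1 x hx])))
  let j : C(Q', ({p b}ᶜ : Set Q)) :=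
    ⟨fun y => ⟨i y, h.ne_of_mem_range hb y⟩, i.continuous.subtype_mk _⟩
  let p' : C({x : D // x ≠ b}, ({p b}ᶜ : Set Q)) :=
    ⟨fun x => ⟨p x, h.ne_of_ne hb x.2⟩, (p.continuous.comp continuous_subtype_val).subtype_mk _⟩
  -- The homotopy is glued as a map into the space of paths. This reduces its continuity to the
  -- gluing statement already proved; uncurrying is continuous because the interval is locally
  -- compact.
  let k₁ : C(Q' × unitInterval, ({p b}ᶜ : Set Q)) := j.comp ContinuousMap.fst
  let k₂ : C({x : D // x ≠ b} × unitInterval, ({p b}ᶜ : Set Q)) :=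
    p'.comp (cell.ρ.comp ContinuousMap.prodSwap)
  obtain ⟨G, hG₁, hG₂⟩ := h.exists_glue hb k₁.curry k₂.curry (fun x hx => by
    ext t
    change i (φ ⟨x.1, hx⟩) = p (cell.ρ (t, x)).1
    rw [h.comm, cell.ρ_of_mem t x hx])
  have hcov : ∀ {P : ({p b}ᶜ : Set Q) → Prop}, (∀ y, P ⟨i y, h.ne_of_mem_range hb y⟩) →
      (∀ x : {x : D // x ≠ b}, P ⟨p x, h.ne_of_ne hb x.2⟩) → ∀ q, P q := by
    rintro P h₁ h₂ ⟨q, hq⟩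
    rcases h.cover q with ⟨y, rfl⟩ | ⟨x, hx, rfl⟩
    · exact h₁ y
    · exact h₂ ⟨x, fun hxb => hq (congrArg p hxb)⟩
  refine ⟨⟨r, j, ⟨ContinuousMap.Homotopy.symm
    { toFun := fun z => G z.2 z.1
      continuous_toFun :=
        (ContinuousMap.continuous_uncurry_of_continuous G).comp continuous_swap
      map_zero_left := ?_
      map_one_left := ?_ }⟩, ?_⟩⟩
  · refine hcov (fun y => ?_) (fun x => ?_)
    · simp only [hG₁]
      rfl
    · simp only [hG₂]
      exact congrArg p' (cell.ρ_zero x)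
  · refine hcov (fun y => ?_) (fun x => ?_)
    · simp only [hG₁, ContinuousMap.comp_apply, hr₁]
      rfl
    · simp only [hG₂, ContinuousMap.comp_apply, hr₂]
      exact Subtype.ext (h.comm ⟨(cell.ρ (1, x)).1, cell.ρ_one x⟩).symm
  · convert ContinuousMap.Homotopic.refl _
    ext y
    exact (hr₁ y).symm

/-- Cover `Q` by the complement of the centre, which deforms onto `Q'`, and by the open cell. They
meet in the punctured open cell, so the value is `c + 1 - (1 - (-1)ⁿ)`. -/
theorem IsAttached.hasChi (h : IsAttached S i p φ) (cell : CellData D S b n) {c : ℤ}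
    (hc : HasChi Q' c) : HasChi Q (c + (-1) ^ n) := by
  have hb := cell.notMem
  have hU : HasChi ↥({p b}ᶜ : Set Q) c :=
    hc.of_homotopyEquiv (h.nonempty_homotopyEquiv cell).some.symm
  have hV : HasChi ↥(p '' Sᶜ) 1 :=
    h.hasChi_image cell.isClosed.isOpen_compl subset_rfl cell.hasChi_interior
  have hO : IsOpen (Sᶜ \ {b}) := cell.isClosed.isOpen_compl.sdiff isClosed_singleton
  have hUV : HasChi ↥(({p b}ᶜ : Set Q) ∩ p '' Sᶜ) (1 - (-1) ^ n) := by
    have e : ({p b}ᶜ : Set Q) ∩ p '' Sᶜ = p '' (Sᶜ \ {b}) := by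
      ext q
      constructor
      · rintro ⟨hq, x, hx, rfl⟩
        exact ⟨x, ⟨hx, fun hxb => hq (congrArg p hxb)⟩, rfl⟩
      · rintro ⟨x, ⟨hx, hxb⟩, rfl⟩
        exact ⟨h.ne_of_ne hb hxb, x, hx, rfl⟩
    rw [e]
    exact h.hasChi_image hO Set.sdiff_subset cell.hasChi_punctured
  have hu : ({p b}ᶜ : Set Q) ∪ p '' Sᶜ = Set.univ := by
    refine Set.eq_univ_of_forall fun q => ?_
    rcases h.cover q with ⟨y, rfl⟩ | ⟨x, hx, rfl⟩
    · exact Or.inl (h.ne_of_mem_range hb y)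
    · exact Or.inr ⟨x, hx, rfl⟩
  have := hU.union (h.isOpen_compl hb)
    (h.isOpen_image cell.isClosed.isOpen_compl subset_rfl) hV hUV
  rw [hu] at this
  have := this.of_homeomorph (Homeomorph.Set.univ Q)
  rwa [show c + (-1) ^ n = c + 1 - (1 - (-1) ^ n) by ring]

end Cell

end MagnitudeHomotopy

namespace MagnitudeHomotopy

/-! ### Punctured Euclidean spaces -/

section Punctured

/-- The Euler characteristic of a sphere. -/
theorem hasChi_ne_zero (κ : Type u) [Finite κ] :
    HasChi ↥{y : κ → ℝ | y ≠ 0} (1 - (-1) ^ Nat.card κ) := by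
  classical
  induction κ using Finite.induction_empty_option with
  | @of_equiv α β e h =>
    rw [← Nat.card_congr e]
    let E : (α → ℝ) ≃ₜ (β → ℝ) :=
      { toFun := fun y j => y (e.symm j)
        invFun := fun y i => y (e i)
        left_inv := fun y => by simp
        right_inv := fun y => by simp
        continuous_toFun := continuous_pi fun j => continuous_apply _
        continuous_invFun := continuous_pi fun j => continuous_apply _ }
    refine h.of_homeomorph (Homeomorph.subtype E fun y => not_congr ⟨?_, fun hy => ?_⟩)
    · rintro rfl
      rfl
    · exact E.injective hy
  | h_empty =>
    have : IsEmpty ↥{y : PEmpty → ℝ | y ≠ 0} := ⟨fun y => y.2 (Subsingleton.elim _ _)⟩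
    simpa using hasChi_of_isEmpty (A := ↥{y : PEmpty.{u + 1} → ℝ | y ≠ 0})
  | @h_option α _ ih =>
    -- For `s = ±1` this is the space without a closed ray along the new axis. It is star-shaped
    -- about the opposite unit vector, hence contractible.
    let U : ℝ → Set (Option α → ℝ) := fun s => {y | 0 < s * y none ∨ ∃ i, y (some i) ≠ 0}
    have hUo : ∀ s, IsOpen (U s) := by
      intro s
      have e : {y : Option α → ℝ | ∃ i, y (some i) ≠ 0} = ⋃ i, {y | y (some i) ≠ 0} := by
        ext y
        simp
      change IsOpen ({y : Option α → ℝ | 0 < s * y none} ∪ {y | ∃ i, y (some i) ≠ 0})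
      rw [e]
      exact (isOpen_lt continuous_const (continuous_const.mul (continuous_apply none))).union
        (isOpen_iUnion fun i => isOpen_ne_fun (continuous_apply (some i)) continuous_const)
    have hUc : ∀ s, s * s = 1 → HasChi ↥(U s) 1 := by
      intro s hs
      have hmem : Pi.single none s ∈ U s := by
        refine Or.inl ?_
        simp [hs]
      have hstar : StarConvex ℝ (Pi.single none s) (U s) := by
        intro y hy c d hc hd hcd
        rcases hd.eq_or_lt with rfl | hd
        · obtain rfl : c = 1 := by linarith
          simpa using hmem
        · rcases hy with hy | ⟨i, hi⟩
          · refine Or.inl ?_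
            have : s * (c • (Pi.single none s : Option α → ℝ) + d • y) none =
                c * (s * s) + d * (s * y none) := by
              simp
              ring
            rw [this, hs]
            have := mul_pos hd hy
            linarith
          · refine Or.inr ⟨i, ?_⟩
            simpa using ⟨hd.ne', hi⟩
      have := hstar.contractibleSpace ⟨_, hmem⟩
      exact hasChi_of_contractible
    -- The two sets meet in the complement of the new axis. Scaling the new coordinate to zero
    -- retracts it onto the punctured space of one dimension less.
    have hinter : HasChi ↥(U 1 ∩ U (-1)) (1 - (-1) ^ Nat.card α) := by
      have hiff : ∀ y : Option α → ℝ, y ∈ U 1 ∩ U (-1) ↔ (fun i => y (some i)) ≠ 0 := by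
        intro y
        rw [Function.ne_iff]
        constructor
        · rintro ⟨h₁ | h, h₂ | h'⟩
          · linarith
          all_goals assumption
        · exact fun h => ⟨Or.inr h, Or.inr h⟩
      refine ih.of_homotopyEquiv
        ⟨⟨fun z => ⟨fun o => o.elim 0 z.1, (hiff _).2 z.2⟩, ?_⟩,
        ⟨fun y => ⟨fun i => y.1 (some i), (hiff _).1 y.2⟩, ?_⟩, ?_, ?_⟩
      · refine Continuous.subtype_mk (continuous_pi fun o => ?_) _
        cases o
        · exact continuous_const
        · exact (continuous_apply _).comp continuous_subtype_val
      · refine Continuous.subtype_mk (continuous_pi fun i => ?_) _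
        exact (continuous_apply (some i)).comp continuous_subtype_val
      · exact ContinuousMap.Homotopic.refl _
      · refine ⟨⟨⟨fun z => ⟨fun o => o.elim (z.1 * z.2.1 none) fun i => z.2.1 (some i),
          (hiff _).2 ((hiff _).1 z.2.2)⟩, ?_⟩, fun y => ?_, fun y => ?_⟩⟩
        · refine Continuous.subtype_mk (continuous_pi fun o => ?_) _
          cases o
          · exact (continuous_subtype_val.comp continuous_fst).mul
              ((continuous_apply none).comp (continuous_subtype_val.comp continuous_snd))
          · exact (continuous_apply _).comp (continuous_subtype_val.comp continuous_snd)
        · refine Subtype.ext (funext fun o => ?_)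
          cases o <;> simp
        · refine Subtype.ext (funext fun o => ?_)
          cases o <;> simp
    have hunion : U 1 ∪ U (-1) = {y | y ≠ 0} := by
      ext y
      constructor
      · rintro ((h | ⟨i, h⟩) | (h | ⟨i, h⟩)) rfl <;> simp at h
      · intro hy
        obtain ⟨o, ho⟩ := Function.ne_iff.1 hy
        cases o with
        | none =>
          rcases lt_or_gt_of_ne ho with h | h
          · exact Or.inr (Or.inl (by simpa using h))
          · exact Or.inl (Or.inl (by simpa using h))
        | some i => exact Or.inl (Or.inr ⟨i, ho⟩)
    have := (hUc 1 (by norm_num)).union (hUo 1) (hUo (-1)) (hUc (-1) (by norm_num)) hinter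
    rw [hunion] at this
    rw [Finite.card_option, pow_succ]
    convert this using 1
    ring

end Punctured

/-! ### The simplex as a cell -/

section SimplexCell

variable (ι : Type u) [Fintype ι]

/-- The boundary of a simplex. -/
def simplexBoundary : Set (stdSimplex ℝ ι) := {x | ∃ i, x i = 0}

variable {ι}

theorem stdSimplex_continuous_apply (i : ι) : Continuous fun x : stdSimplex ℝ ι => x i :=
  (continuous_apply i).comp continuous_subtype_val

theorem isClosed_simplexBoundary : IsClosed (simplexBoundary ι) := by
  simp only [simplexBoundary, Set.ofPred_exists]
  exact isClosed_iUnion_of_finite fun i =>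
    isClosed_eq (stdSimplex_continuous_apply i) continuous_const

theorem pos_of_notMem_simplexBoundary {x : stdSimplex ℝ ι} (hx : x ∉ simplexBoundary ι) (i : ι) :
    0 < x i :=
  lt_of_le_of_ne (stdSimplex.zero_le x i) fun h => hx ⟨i, h.symm⟩

/-- The logarithms of the coordinates of a point of the open simplex, relative to a vertex. -/
noncomputable def logCoord (i₀ : ι) (x : stdSimplex ℝ ι) (i : {i : ι // i ≠ i₀}) : ℝ :=
  Real.log (x i) - Real.log (x i₀)

open Classical in
/-- Extension of a vector by zero. -/
noncomputable def extendZero (i₀ : ι) (y : {i : ι // i ≠ i₀} → ℝ) (i : ι) : ℝ :=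
  if h : i = i₀ then 0 else y ⟨i, h⟩

theorem continuous_extendZero (i₀ i : ι) : Continuous fun y => extendZero i₀ y i := by
  unfold extendZero
  split_ifs
  · exact continuous_const
  · exact continuous_apply _

theorem sum_exp_pos [Nonempty ι] (y : ι → ℝ) : 0 < ∑ j, Real.exp (y j) :=
  Finset.sum_pos (fun _ _ => Real.exp_pos _) Finset.univ_nonempty

/-- The softmax function. -/
noncomputable def softmax [Nonempty ι] (y : ι → ℝ) : stdSimplex ℝ ι :=
  ⟨fun i => Real.exp (y i) / ∑ j, Real.exp (y j),
    fun i => div_nonneg (Real.exp_pos _).le (sum_exp_pos y).le, by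
    rw [← Finset.sum_div, div_self (sum_exp_pos y).ne']⟩

theorem softmax_apply [Nonempty ι] (y : ι → ℝ) (i : ι) :
    softmax y i = Real.exp (y i) / ∑ j, Real.exp (y j) := rfl

theorem continuous_softmax [Nonempty ι] : Continuous (softmax : (ι → ℝ) → stdSimplex ℝ ι) :=
  Continuous.subtype_mk (continuous_pi fun i =>
    Continuous.div (by fun_prop) (by fun_prop) fun y => (sum_exp_pos y).ne') _

theorem softmax_notMem [Nonempty ι] (y : ι → ℝ) : softmax y ∉ simplexBoundary ι := by
  rintro ⟨i, hi⟩
  exact (div_pos (Real.exp_pos _) (sum_exp_pos y)).ne' hi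

theorem logCoord_softmax [Nonempty ι] (i₀ : ι) (y : {i : ι // i ≠ i₀} → ℝ) :
    logCoord i₀ (softmax (extendZero i₀ y)) = y := by
  ext ⟨i, hi⟩
  have h := (sum_exp_pos (extendZero i₀ y)).ne'
  rw [logCoord, softmax_apply, softmax_apply, Real.log_div (Real.exp_pos _).ne' h,
    Real.log_div (Real.exp_pos _).ne' h, Real.log_exp, Real.log_exp]
  simp [extendZero, hi]

theorem softmax_logCoord [Nonempty ι] (i₀ : ι) {x : stdSimplex ℝ ι} (hx : x ∉ simplexBoundary ι) :
    softmax (extendZero i₀ (logCoord i₀ x)) = x := by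
  have hpos := pos_of_notMem_simplexBoundary hx
  have key : ∀ i, Real.exp (extendZero i₀ (logCoord i₀ x) i) = x i / x i₀ := by
    intro i
    by_cases hi : i = i₀
    · subst hi
      simp [extendZero, (hpos i).ne']
    · simp [extendZero, hi, logCoord, Real.exp_sub, Real.exp_log (hpos _)]
  refine stdSimplex.ext (funext fun i => ?_)
  rw [softmax_apply, key]
  simp only [key]
  rw [← Finset.sum_div, stdSimplex.sum_eq_one]
  have := (hpos i₀).ne'
  field_simp

theorem continuous_logCoord (i₀ : ι) {T : Type*} [TopologicalSpace T] {g : T → stdSimplex ℝ ι}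
    (hg : Continuous g) (hS : ∀ t, g t ∉ simplexBoundary ι) :
    Continuous fun t => logCoord i₀ (g t) :=
  continuous_pi fun _ => Continuous.sub
    (((stdSimplex_continuous_apply _).comp hg).log fun t =>
      (pos_of_notMem_simplexBoundary (hS t) _).ne')
    (((stdSimplex_continuous_apply _).comp hg).log fun t =>
      (pos_of_notMem_simplexBoundary (hS t) _).ne')

theorem barycenter_apply [Nonempty ι] (i : ι) :
    (stdSimplex.barycenter : stdSimplex ℝ ι) i = (Fintype.card ι : ℝ)⁻¹ := rfl

theorem logCoord_barycenter [Nonempty ι] (i₀ : ι) :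
    logCoord i₀ (stdSimplex.barycenter : stdSimplex ℝ ι) = 0 := by
  ext i
  simp [logCoord, barycenter_apply]

theorem barycenter_notMem [Nonempty ι] :
    (stdSimplex.barycenter : stdSimplex ℝ ι) ∉ simplexBoundary ι := by
  rintro ⟨i, hi⟩
  rw [barycenter_apply] at hi
  simp at hi

theorem continuous_softmax_extendZero [Nonempty ι] (i₀ : ι) :
    Continuous fun y => softmax (extendZero i₀ y) :=
  continuous_softmax.comp (continuous_pi (continuous_extendZero i₀))

/-- Logarithmic coordinates relative to a vertex identify the open simplex with a Euclidean space,
softmax being the inverse. -/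
theorem hasChi_simplex_interior [Nonempty ι] : HasChi ↥(simplexBoundary ι)ᶜ 1 := by
  obtain ⟨i₀⟩ := ‹Nonempty ι›
  have : Nonempty ι := ⟨i₀⟩
  have h : HasChi ({i : ι // i ≠ i₀} → ℝ) 1 := hasChi_of_contractible
  refine h.of_homeomorph
    { toFun := fun y => ⟨softmax (extendZero i₀ y), softmax_notMem _⟩
      invFun := fun x => logCoord i₀ x.1
      left_inv := logCoord_softmax i₀
      right_inv := fun x => Subtype.ext (softmax_logCoord i₀ x.2)
      continuous_toFun := (continuous_softmax_extendZero i₀).subtype_mk _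
      continuous_invFun := continuous_logCoord i₀ continuous_subtype_val fun x => x.2 }

/-- The logarithmic coordinates send the barycenter to the origin, which leaves a punctured
Euclidean space of dimension one less than the number of vertices. -/
theorem hasChi_simplex_punctured [Nonempty ι] :
    HasChi ↥((simplexBoundary ι)ᶜ \ {stdSimplex.barycenter}) (1 - (-1) ^ (Fintype.card ι - 1)) := by
  classical
  obtain ⟨i₀⟩ := ‹Nonempty ι›
  have : Nonempty ι := ⟨i₀⟩
  have h := hasChi_ne_zero {i : ι // i ≠ i₀}
  rw [Nat.card_eq_fintype_card, Fintype.card_subtype_compl, Fintype.card_subtype_eq] at h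
  refine h.of_homeomorph
    { toFun := fun y => ⟨softmax (extendZero i₀ y.1), softmax_notMem _, fun hb => y.2 ?_⟩
      invFun := fun x => ⟨logCoord i₀ x.1, fun h0 => x.2.2 ?_⟩
      left_inv := fun y => Subtype.ext (logCoord_softmax i₀ y.1)
      right_inv := fun x => Subtype.ext (softmax_logCoord i₀ x.2.1)
      continuous_toFun :=
        ((continuous_softmax_extendZero i₀).comp continuous_subtype_val).subtype_mk _
      continuous_invFun :=
        (continuous_logCoord i₀ continuous_subtype_val fun x => x.2.1).subtype_mk _ }
  · rw [← logCoord_softmax i₀ y.1, Set.mem_singleton_iff.1 hb, logCoord_barycenter]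
  · rw [Set.mem_singleton_iff, ← softmax_logCoord i₀ x.2.1, h0, ← logCoord_barycenter i₀,
      softmax_logCoord i₀ barycenter_notMem]

/-- The smallest coordinate of a point of a simplex. -/
noncomputable def minCoord [Nonempty ι] (x : stdSimplex ℝ ι) : ℝ :=
  Finset.univ.inf' Finset.univ_nonempty fun i => x i

theorem continuous_minCoord [Nonempty ι] : Continuous (minCoord : stdSimplex ℝ ι → ℝ) :=
  Continuous.finset_inf'_apply _ fun i _ => stdSimplex_continuous_apply i

theorem minCoord_le [Nonempty ι] (x : stdSimplex ℝ ι) (i : ι) : minCoord x ≤ x i :=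
  Finset.inf'_le _ (Finset.mem_univ i)

theorem exists_minCoord [Nonempty ι] (x : stdSimplex ℝ ι) : ∃ i, x i = minCoord x := by
  obtain ⟨i, -, hi⟩ := Finset.exists_mem_eq_inf' (Finset.univ_nonempty (α := ι)) fun i => x i
  exact ⟨i, hi.symm⟩

theorem minCoord_nonneg [Nonempty ι] (x : stdSimplex ℝ ι) : 0 ≤ minCoord x := by
  obtain ⟨i, hi⟩ := exists_minCoord x
  exact hi ▸ stdSimplex.zero_le x i

/-- The least coordinate is at most the mean `1 / N`, where `N` is the number of vertices, with
equality only if all coordinates are equal. -/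
theorem card_mul_minCoord_lt [Nonempty ι] {x : stdSimplex ℝ ι} (hx : x ≠ stdSimplex.barycenter) :
    Fintype.card ι * minCoord x < 1 := by
  have hle : Fintype.card ι * minCoord x ≤ 1 := by
    rw [← stdSimplex.sum_eq_one x]
    simpa using Finset.card_nsmul_le_sum Finset.univ (fun i => x i) (minCoord x)
      fun i _ => minCoord_le x i
  refine lt_of_le_of_ne hle fun h => hx (stdSimplex.ext (funext fun i => ?_))
  have hs : ∑ i, (x i - minCoord x) = 0 := by
    simp [Finset.sum_sub_distrib, stdSimplex.sum_eq_one, h]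
  have hi := (Finset.sum_eq_zero_iff_of_nonneg fun i _ => sub_nonneg.2 (minCoord_le x i)).1 hs i
    (Finset.mem_univ i)
  have hN : (Fintype.card ι : ℝ) ≠ 0 := by simp
  rw [barycenter_apply, sub_eq_zero.1 hi]
  exact eq_inv_of_mul_eq_one_right h

theorem push_denominator_pos [Nonempty ι] {x : stdSimplex ℝ ι} (hx : x ≠ stdSimplex.barycenter)
    (t : unitInterval) : 0 < 1 - Fintype.card ι * ((t : ℝ) * minCoord x) := by
  have h₁ := card_mul_minCoord_lt hx
  have h₂ : (t : ℝ) * (Fintype.card ι * minCoord x) ≤ 1 * (Fintype.card ι * minCoord x) :=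
    mul_le_mul_of_nonneg_right t.2.2 (mul_nonneg (Nat.cast_nonneg _) (minCoord_nonneg x))
  nlinarith

/-- The deformation of the punctured simplex onto its boundary. -/
noncomputable def simplexPush [Nonempty ι] (t : unitInterval) (x : stdSimplex ℝ ι)
    (hx : x ≠ stdSimplex.barycenter) : stdSimplex ℝ ι :=
  -- Subtracting the same amount from each coordinate and rescaling moves the point radially away
  -- from the barycenter. At `t = 1` a coordinate vanishes; on the boundary the minimum is zero and
  -- nothing moves.
  ⟨fun i => (x i - (t : ℝ) * minCoord x) / (1 - Fintype.card ι * ((t : ℝ) * minCoord x)),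
    fun i => div_nonneg (sub_nonneg.2 ((mul_le_of_le_one_left (minCoord_nonneg x) t.2.2).trans
      (minCoord_le x i))) (push_denominator_pos hx t).le, by
    rw [← Finset.sum_div, Finset.sum_sub_distrib, stdSimplex.sum_eq_one]
    simpa using div_self (push_denominator_pos hx t).ne'⟩

theorem simplexPush_apply [Nonempty ι] (t : unitInterval) (x : stdSimplex ℝ ι)
    (hx : x ≠ stdSimplex.barycenter) (i : ι) : simplexPush t x hx i =
      (x i - (t : ℝ) * minCoord x) / (1 - Fintype.card ι * ((t : ℝ) * minCoord x)) := rfl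

theorem simplexPush_ne [Nonempty ι] (t : unitInterval) (x : stdSimplex ℝ ι)
    (hx : x ≠ stdSimplex.barycenter) : simplexPush t x hx ≠ stdSimplex.barycenter := by
  refine fun h => hx (stdSimplex.ext (funext fun i => ?_))
  have hi : simplexPush t x hx i = (stdSimplex.barycenter : stdSimplex ℝ ι) i := by rw [h]
  have hN : (Fintype.card ι : ℝ) ≠ 0 := by simp
  rw [simplexPush_apply, barycenter_apply, div_eq_iff (push_denominator_pos hx t).ne', mul_sub,
    mul_one, inv_mul_cancel_left₀ hN] at hi
  rw [barycenter_apply]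
  linarith

/-- A simplex is a cell. -/
noncomputable def simplexCell [Nonempty ι] :
    CellData (stdSimplex ℝ ι) (simplexBoundary ι) stdSimplex.barycenter (Fintype.card ι - 1) where
  isClosed := isClosed_simplexBoundary
  notMem := barycenter_notMem
  ρ := ⟨fun z => ⟨simplexPush z.1 z.2.1 z.2.2, simplexPush_ne _ _ _⟩,
    Continuous.subtype_mk (Continuous.subtype_mk (continuous_pi fun i => by
      have h₁ : Continuous fun z : unitInterval × {x : stdSimplex ℝ ι // x ≠ stdSimplex.barycenter}
          => z.2.1 i := (stdSimplex_continuous_apply i).comp (by fun_prop)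
      have h₂ : Continuous fun z : unitInterval × {x : stdSimplex ℝ ι // x ≠ stdSimplex.barycenter}
          => minCoord z.2.1 := continuous_minCoord.comp (by fun_prop)
      exact Continuous.div (by fun_prop) (by fun_prop)
        fun z => (push_denominator_pos z.2.2 z.1).ne') _) _⟩
  ρ_zero x := Subtype.ext (stdSimplex.ext (funext fun i => by
    change simplexPush 0 x.1 x.2 i = _
    simp [simplexPush_apply]))
  ρ_one x := by
    obtain ⟨i, hi⟩ := exists_minCoord x.1
    refine ⟨i, ?_⟩
    change simplexPush 1 x.1 x.2 i = _
    simp [simplexPush_apply, hi]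
  ρ_of_mem t x hx := by
    have h0 : minCoord x.1 = 0 := by
      obtain ⟨i, hi⟩ := hx
      exact le_antisymm (hi ▸ minCoord_le x.1 i) (minCoord_nonneg _)
    refine Subtype.ext (stdSimplex.ext (funext fun i => ?_))
    change simplexPush t x.1 x.2 i = _
    simp [simplexPush_apply, h0]
  hasChi_interior := hasChi_simplex_interior
  hasChi_punctured := hasChi_simplex_punctured

end SimplexCell

end MagnitudeHomotopy

namespace MagnitudeHomotopy

/-! ### The topology of a geometric realization -/

namespace Realization

section

variable {V : Type u} {K : PreAbstractSimplicialComplex V}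

/-- The weak topology is hard to map into in general, but a map with values in a single closed
simplex may be checked coordinatewise. -/
theorem continuous_of_support_subset {T : Type*} [TopologicalSpace T] {g : T → Realization K}
    {s : Finset V} (hs : s ∈ K) (hg : ∀ t, (g t).weight.support ⊆ s)
    (hc : ∀ w, Continuous fun t => (g t).weight w) : Continuous g := by
  let := closedFaceTopology K s
  let g' : T → closedFace K s := fun t => ⟨g t, hg t⟩
  have hg' : Continuous g' := continuous_induced_rng.2 (continuous_pi hc)
  have hv : Continuous (Subtype.val : closedFace K s → Realization K) :=
    continuous_iff_coinduced_le.2 (le_iSup (fun s : {s : Finset V // s ∈ K} =>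
      TopologicalSpace.coinduced (Subtype.val : closedFace K s.1 → Realization K)
        (closedFaceTopology K s.1)) ⟨s, hs⟩)
  exact hv.comp hg'

open Classical in
/-- The barycentric coordinates of a point of a simplex, extended by zero. -/
noncomputable def faceWeight {s : Finset V} (x : stdSimplex ℝ s) : V →₀ ℝ :=
  Finsupp.onFinset s (fun w => if h : w ∈ s then x ⟨w, h⟩ else 0) fun w hw => by
    by_contra h
    simp [h] at hw

theorem faceWeight_apply {s : Finset V} (x : stdSimplex ℝ s) (w : s) : faceWeight x w = x w := by
  simp [faceWeight]

theorem faceWeight_of_notMem {s : Finset V} (x : stdSimplex ℝ s) {w : V} (hw : w ∉ s) :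
    faceWeight x w = 0 := by
  simp [faceWeight, hw]

theorem support_faceWeight_subset {s : Finset V} (x : stdSimplex ℝ s) :
    (faceWeight x).support ⊆ s := by
  intro w hw
  by_contra h
  exact Finsupp.mem_support_iff.1 hw (faceWeight_of_notMem x h)

theorem faceWeight_nonneg {s : Finset V} (x : stdSimplex ℝ s) (w : V) : 0 ≤ faceWeight x w := by
  by_cases hw : w ∈ s
  · rw [faceWeight_apply x ⟨w, hw⟩]
    exact stdSimplex.zero_le x _
  · rw [faceWeight_of_notMem x hw]

theorem faceWeight_sum {s : Finset V} (x : stdSimplex ℝ s) :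
    ((faceWeight x).sum fun _ r => r) = 1 := by
  rw [Finsupp.sum_of_support_subset _ (support_faceWeight_subset x) _ (fun _ _ => rfl),
    ← Finset.sum_coe_sort, ← stdSimplex.sum_eq_one x]
  exact Finset.sum_congr rfl fun w _ => faceWeight_apply x w

theorem support_nonempty_of_sum {f : V →₀ ℝ} (h : (f.sum fun _ r => r) = 1) :
    f.support.Nonempty := by
  by_contra h0
  rw [Finset.not_nonempty_iff_eq_empty, Finsupp.support_eq_empty] at h0
  simp [h0] at h

theorem mem_of_subset {s t : Finset V} (hs : s ∈ K) (hts : t ⊆ s) (ht : t.Nonempty) : t ∈ K :=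
  (K.isRelLowerSet_faces hs).2 hts ht

/-- The characteristic map of a face. -/
noncomputable def faceMap {s : Finset V} (hs : s ∈ K) (x : stdSimplex ℝ s) : Realization K where
  weight := faceWeight x
  nonneg := faceWeight_nonneg x
  sum_eq_one := faceWeight_sum x
  support_mem := mem_of_subset hs (support_faceWeight_subset x)
    (support_nonempty_of_sum (faceWeight_sum x))

theorem continuous_faceWeight {s : Finset V} (w : V) :
    Continuous fun x : stdSimplex ℝ s => faceWeight x w := by
  by_cases hw : w ∈ s
  · exact (stdSimplex_continuous_apply (⟨w, hw⟩ : s)).congr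
      fun x => (faceWeight_apply x ⟨w, hw⟩).symm
  · exact continuous_const.congr fun x => (faceWeight_of_notMem x hw).symm

theorem continuous_faceMap {s : Finset V} (hs : s ∈ K) : Continuous (faceMap hs) :=
  continuous_of_support_subset hs support_faceWeight_subset continuous_faceWeight

theorem faceWeight_injective {s : Finset V} :
    Function.Injective (faceWeight : stdSimplex ℝ s → V →₀ ℝ) := by
  intro x y hxy
  refine stdSimplex.ext (funext fun w => ?_)
  rw [← faceWeight_apply, ← faceWeight_apply, hxy]

/-- The coordinates in a face of a point of the realization. -/
noncomputable def faceCoord {s : Finset V} (x : Realization K) (hx : x.weight.support ⊆ s) :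
    stdSimplex ℝ s :=
  ⟨fun w => x.weight w, fun w => x.nonneg w, by
    rw [Finset.sum_coe_sort s fun w => x.weight w, ← x.sum_eq_one,
      Finsupp.sum_of_support_subset _ hx _ (fun _ _ => rfl)]⟩

theorem faceWeight_faceCoord {s : Finset V} (x : Realization K) (hx : x.weight.support ⊆ s) :
    faceWeight (faceCoord x hx) = x.weight := by
  ext w
  by_cases hw : w ∈ s
  · exact faceWeight_apply _ ⟨w, hw⟩
  · rw [faceWeight_of_notMem _ hw, Finsupp.notMem_support_iff.1 fun h => hw (hx h)]

theorem faceMap_faceCoord {s : Finset V} (hs : s ∈ K) (x : Realization K)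
    (hx : x.weight.support ⊆ s) : faceMap hs (faceCoord x hx) = x :=
  Realization.ext (faceWeight_faceCoord x hx)

/-- This replaces closed simplices, topologized by coordinates over all vertices, by standard
simplices on the vertices of each face. -/
theorem isOpen_iff {W : Set (Realization K)} :
    IsOpen W ↔ ∀ (s : Finset V) (hs : s ∈ K), IsOpen (faceMap hs ⁻¹' W) := by
  refine ⟨fun h s hs => h.preimage (continuous_faceMap hs), fun h => ?_⟩
  rw [isOpen_iSup_iff]
  rintro ⟨s, hs⟩
  rw [isOpen_coinduced]
  obtain ⟨O, hO, hOW⟩ := isOpen_induced_iff.1 (h s hs)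
  refine isOpen_induced_iff.2 ⟨(fun (y : V → ℝ) (w : s) => y w) ⁻¹' O,
    hO.preimage (continuous_pi fun w => continuous_apply _), ?_⟩
  ext x
  have hx := Set.ext_iff.1 hOW (faceCoord (s := s) x.1 x.2)
  rw [Set.mem_preimage, Set.mem_preimage, faceMap_faceCoord hs x.1 x.2] at hx
  exact hx

theorem continuous_iff {T : Type*} [TopologicalSpace T] {g : Realization K → T} :
    Continuous g ↔ ∀ (s : Finset V) (hs : s ∈ K), Continuous (g ∘ faceMap hs) := by
  refine ⟨fun h s hs => h.comp (continuous_faceMap hs), fun h => ⟨fun W hW => ?_⟩⟩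
  exact isOpen_iff.2 fun s hs => hW.preimage (h s hs)

/-- The inclusion of a subcomplex. -/
def incl {K' : PreAbstractSimplicialComplex V} (h : ∀ s ∈ K', s ∈ K) :
    C(Realization K', Realization K) where
  toFun x := ⟨x.weight, x.nonneg, x.sum_eq_one, h _ x.support_mem⟩
  continuous_toFun := continuous_iff.2 fun _ hs =>
    continuous_of_support_subset (h _ hs) support_faceWeight_subset continuous_faceWeight

/-- The map of realizations induced by an injective simplicial map. -/
noncomputable def embMap {V' : Type v} {K' : PreAbstractSimplicialComplex V'} (φ : V ↪ V')
    (h : ∀ s ∈ K, s.map φ ∈ K') : C(Realization K, Realization K') where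
  toFun x :=
    { weight := x.weight.embDomain φ
      nonneg := fun w => by
        by_cases hw : w ∈ Set.range φ
        · obtain ⟨w, rfl⟩ := hw
          rw [Finsupp.embDomain_apply_self]
          exact x.nonneg w
        · rw [Finsupp.embDomain_of_notMem_range _ _ _ hw]
      sum_eq_one := by
        rw [Finsupp.sum_embDomain]
        exact x.sum_eq_one
      support_mem := by
        rw [Finsupp.support_embDomain]
        exact h _ x.support_mem }
  continuous_toFun := continuous_iff.2 fun s hs => by
    refine continuous_of_support_subset (h s hs) (fun x => ?_) (fun w => ?_)
    · change ((faceWeight x).embDomain φ).support ⊆ _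
      rw [Finsupp.support_embDomain]
      exact Finset.map_subset_map.2 (support_faceWeight_subset x)
    · change Continuous fun x : stdSimplex ℝ s => (faceWeight x).embDomain φ w
      by_cases hw : w ∈ Set.range φ
      · obtain ⟨w, rfl⟩ := hw
        simp only [Finsupp.embDomain_apply_self]
        exact continuous_faceWeight w
      · simp only [Finsupp.embDomain_of_notMem_range _ _ _ hw]
        exact continuous_const

end

end Realization

/-! ### Quotients of realizations -/

namespace PointedQuotient

section

variable {A : Type u} {B : Set A}

/-- The projection `A → A / B`. -/
def proj (B : Set A) (x : A) : PointedQuotient A B := Quotient.mk (collapseSetoid A B) (Sum.inl x)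

theorem proj_eq_base_iff {x : A} : proj B x = base A B ↔ x ∈ B := by
  refine Quotient.eq.trans ?_
  change (Sum.inl x = Sum.inr () ∨ Sum.inl x ∈ Sum.inl '' B ∪ {Sum.inr ()} ∧
    Sum.inr () ∈ Sum.inl '' B ∪ {Sum.inr ()}) ↔ _
  simp

theorem proj_eq_proj_iff {x y : A} : proj B x = proj B y ↔ x = y ∨ (x ∈ B ∧ y ∈ B) := by
  refine Quotient.eq.trans ?_
  change ((Sum.inl x : A ⊕ Unit) = Sum.inl y ∨ Sum.inl x ∈ Sum.inl '' B ∪ {Sum.inr ()} ∧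
    Sum.inl y ∈ Sum.inl '' B ∪ {Sum.inr ()}) ↔ _
  simp

theorem eq_base_or_proj (q : PointedQuotient A B) : q = base A B ∨ ∃ x ∉ B, proj B x = q := by
  obtain ⟨x | ⟨⟩, rfl⟩ := Quotient.exists_rep q
  · by_cases hx : x ∈ B
    · exact Or.inl (proj_eq_base_iff.2 hx)
    · exact Or.inr ⟨x, hx, rfl⟩
  · exact Or.inl rfl

instance : Nonempty (PointedQuotient A B) := ⟨base A B⟩

variable [TopologicalSpace A]

theorem continuous_proj : Continuous (proj B) := continuous_quotient_mk'.comp continuous_inl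

theorem isOpen_iff {W : Set (PointedQuotient A B)} : IsOpen W ↔ IsOpen (proj B ⁻¹' W) := by
  refine ⟨fun h => h.preimage continuous_proj, fun h => ?_⟩
  refine isOpen_coinduced.2 (isOpen_sum_iff.2 ⟨h, isOpen_discrete _⟩)

/-- Functoriality of the quotient of a pair. -/
def map {A' : Type v} {B' : Set A'} [TopologicalSpace A'] (f : C(A, A'))
    (hf : ∀ x ∈ B, f x ∈ B') : C(PointedQuotient A B, PointedQuotient A' B') where
  toFun := Quotient.map (Sum.map f id) (by
    rintro x y (rfl | ⟨hx, hy⟩)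
    · exact Or.inl rfl
    · have key : ∀ z ∈ Sum.inl '' B ∪ {Sum.inr ()},
          Sum.map f id z ∈ Sum.inl '' B' ∪ {Sum.inr ()} := by
        rintro _ (⟨z, hz, rfl⟩ | rfl)
        · exact Or.inl ⟨f z, hf z hz, rfl⟩
        · exact Or.inr rfl
      exact Or.inr ⟨key x hx, key y hy⟩)
  continuous_toFun := ⟨fun W hW => isOpen_iff.2
    (hW.preimage (continuous_proj.comp f.continuous))⟩

theorem map_proj {A' : Type v} {B' : Set A'} [TopologicalSpace A'] (f : C(A, A'))
    (hf : ∀ x ∈ B, f x ∈ B') (x : A) : map f hf (proj B x) = proj B' (f x) := rfl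

theorem map_map_of_leftInverse {A' : Type v} {B' : Set A'} [TopologicalSpace A'] (f : C(A, A'))
    (hf : ∀ x ∈ B, f x ∈ B') (g : C(A', A)) (hg : ∀ x ∈ B', g x ∈ B)
    (hgf : Function.LeftInverse g f) : Function.LeftInverse (map g hg) (map f hf) := by
  intro q
  rcases eq_base_or_proj q with rfl | ⟨x, -, rfl⟩
  · rfl
  · rw [map_proj, map_proj, hgf]

/-- The homeomorphism of quotients induced by a homeomorphism of pairs. -/
def homeomorph {A' : Type v} {B' : Set A'} [TopologicalSpace A'] (f : C(A, A'))
    (hf : ∀ x ∈ B, f x ∈ B') (g : C(A', A)) (hg : ∀ x ∈ B', g x ∈ B)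
    (hgf : Function.LeftInverse g f) (hfg : Function.LeftInverse f g) :
    PointedQuotient A B ≃ₜ PointedQuotient A' B' where
  toFun := map f hf
  invFun := map g hg
  left_inv := map_map_of_leftInverse f hf g hg hgf
  right_inv := map_map_of_leftInverse g hg f hf hfg
  continuous_toFun := (map f hf).continuous
  continuous_invFun := (map g hg).continuous

end

end PointedQuotient

/-! ### Pairs of simplicial complexes and their cells -/

section RelativeRealization

open Realization

variable {V : Type u}

/-- The quotient of the realization of `K` by the realization of `L`. -/
abbrev RelRealization (K L : PreAbstractSimplicialComplex V) : Type u :=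
  PointedQuotient (Realization K) (subcomplexSet K L)

/-- An isomorphism of pairs of simplicial complexes induces a homeomorphism of quotients. -/
theorem exists_homeomorph_relRealization {V' : Type v} {K L : PreAbstractSimplicialComplex V}
    {K' L' : PreAbstractSimplicialComplex V'} (e : V ≃ V')
    (hK : ∀ s, s.map e.toEmbedding ∈ K' ↔ s ∈ K) (hL : ∀ s, s.map e.toEmbedding ∈ L' ↔ s ∈ L) :
    ∃ E : RelRealization K L ≃ₜ RelRealization K' L',
      E (PointedQuotient.base _ _) = PointedQuotient.base _ _ := by
  have hs : ∀ s : Finset V', (s.map e.symm.toEmbedding).map e.toEmbedding = s := fun s => by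
    ext
    simp
  have hK' : ∀ s ∈ K', s.map e.symm.toEmbedding ∈ K := fun s h => (hK _).1 (by rwa [hs])
  have hL' : ∀ s ∈ L', s.map e.symm.toEmbedding ∈ L := fun s h => (hL _).1 (by rwa [hs])
  refine ⟨PointedQuotient.homeomorph (embMap e.toEmbedding fun s h => (hK s).2 h) ?_
    (embMap e.symm.toEmbedding hK') ?_ ?_ ?_, rfl⟩
  · intro x hx
    change (x.weight.embDomain e.toEmbedding).support ∈ L'
    rw [Finsupp.support_embDomain]
    exact (hL _).2 hx
  · intro x hx
    change (x.weight.embDomain e.symm.toEmbedding).support ∈ L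
    rw [Finsupp.support_embDomain]
    exact hL' _ hx
  · intro x
    refine Realization.ext (Finsupp.ext fun w => ?_)
    change (x.weight.embDomain e.toEmbedding).embDomain e.symm.toEmbedding w = _
    obtain ⟨w, rfl⟩ := e.symm.surjective w
    have h₁ := Finsupp.embDomain_apply_self e.symm.toEmbedding (x.weight.embDomain e.toEmbedding) w
    have h₂ := Finsupp.embDomain_apply_self e.toEmbedding x.weight (e.symm w)
    simp only [Equiv.coe_toEmbedding, Equiv.apply_symm_apply] at h₁ h₂
    rw [h₁, h₂]
  · intro x
    refine Realization.ext (Finsupp.ext fun w => ?_)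
    change (x.weight.embDomain e.symm.toEmbedding).embDomain e.toEmbedding w = _
    obtain ⟨w, rfl⟩ := e.surjective w
    have h₁ := Finsupp.embDomain_apply_self e.toEmbedding (x.weight.embDomain e.symm.toEmbedding) w
    have h₂ := Finsupp.embDomain_apply_self e.symm.toEmbedding x.weight (e w)
    simp only [Equiv.coe_toEmbedding, Equiv.symm_apply_apply] at h₁ h₂
    rw [h₁, h₂]

variable {K L : PreAbstractSimplicialComplex V}

theorem relRealization_isOpen_iff {W : Set (RelRealization K L)} : IsOpen W ↔
    ∀ (s : Finset V) (hs : s ∈ K), IsOpen ((PointedQuotient.proj _ ∘ faceMap hs) ⁻¹' W) := by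
  rw [PointedQuotient.isOpen_iff, Realization.isOpen_iff]
  rfl

/-- Removal of a maximal face. -/
def eraseFace (K : PreAbstractSimplicialComplex V) (σ : Finset V)
    (hmax : ∀ t ∈ K, σ ⊆ t → t = σ) : PreAbstractSimplicialComplex V where
  faces := K.faces \ {σ}
  isRelLowerSet_faces := by
    rintro s ⟨hs, hsσ⟩
    refine ⟨(K.isRelLowerSet_faces hs).1, fun t hts ht => ⟨mem_of_subset hs hts ht, ?_⟩⟩
    rintro rfl
    exact hsσ (hmax s hs hts)

variable {σ : Finset V} {hmax : ∀ t ∈ K, σ ⊆ t → t = σ}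

theorem mem_eraseFace {s : Finset V} : s ∈ eraseFace K σ hmax ↔ s ∈ K ∧ s ≠ σ := Iff.rfl

theorem support_faceWeight_eq {s : Finset V} {x : stdSimplex ℝ s} :
    (faceWeight x).support = s ↔ x ∉ simplexBoundary s := by
  constructor
  · rintro h ⟨w, hw⟩
    have := Finsupp.mem_support_iff.1 (h.symm ▸ w.2 : (w : V) ∈ (faceWeight x).support)
    exact this ((faceWeight_apply x w).trans hw)
  · intro h
    refine (support_faceWeight_subset x).antisymm fun w hw => Finsupp.mem_support_iff.2 fun h0 => ?_
    exact h ⟨⟨w, hw⟩, (faceWeight_apply x ⟨w, hw⟩).symm.trans h0⟩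

/-- The attaching map of a maximal face, with values in the realization. -/
noncomputable def attachMap (hσ : σ ∈ K) (hmax : ∀ t ∈ K, σ ⊆ t → t = σ) :
    C(simplexBoundary σ, Realization (eraseFace K σ hmax)) where
  toFun x := ⟨faceWeight x.1, faceWeight_nonneg x.1, faceWeight_sum x.1,
    (faceMap hσ x.1).support_mem, fun h => support_faceWeight_eq.1 h x.2⟩
  continuous_toFun := by
    classical
    -- The boundary is a finite union of closed facets. On the facet opposite to `w` all supports
    -- lie in `σ.erase w`, which is still a face after `σ` is removed. The facet may be empty,
    -- namely if `σ` is a vertex.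
    let c : σ → Set (simplexBoundary σ) := fun w => {x | x.1 w = 0}
    refine LocallyFinite.continuous (f := c) (locallyFinite_of_finite c) ?_ ?_ ?_
    · exact Set.eq_univ_of_forall fun x => Set.mem_iUnion.2 x.2
    · exact fun w => isClosed_eq ((stdSimplex_continuous_apply w).comp continuous_subtype_val)
        continuous_const
    · intro w
      have hsub : ∀ x ∈ c w, (faceWeight x.1).support ⊆ σ.erase w := fun x hx =>
        Finset.subset_erase.2 ⟨support_faceWeight_subset _, fun hw =>
          Finsupp.mem_support_iff.1 hw ((faceWeight_apply x.1 w).trans hx)⟩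
      rcases (c w).eq_empty_or_nonempty with h0 | ⟨x, hx⟩
      · rw [h0]
        exact continuousOn_empty _
      · rw [continuousOn_iff_continuous_domRestrict]
        refine continuous_of_support_subset (s := σ.erase w) (mem_eraseFace.2
          ⟨mem_of_subset hσ (Finset.erase_subset _ _)
            ((support_nonempty_of_sum (faceWeight_sum x.1)).mono (hsub x hx)), ?_⟩)
          (fun y => hsub y.1 y.2)
          (fun v => (continuous_faceWeight v).comp
            (continuous_subtype_val.comp continuous_subtype_val))
        exact fun h => Finset.notMem_erase (w : V) σ (h.symm ▸ w.2)

/-- A quotient of realizations is obtained by attaching a maximal face. -/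
theorem isAttached_face (hσ : σ ∈ K) (hσL : σ ∉ L) (hmax : ∀ t ∈ K, σ ⊆ t → t = σ) :
    IsAttached (simplexBoundary σ)
      (PointedQuotient.map (incl fun _ hs => (mem_eraseFace.1 hs).1) (fun _ hx => hx) :
        C(RelRealization (eraseFace K σ hmax) L, RelRealization K L))
      ⟨PointedQuotient.proj (subcomplexSet K L) ∘ faceMap hσ,
        PointedQuotient.continuous_proj.comp (continuous_faceMap hσ)⟩
      ((⟨PointedQuotient.proj (subcomplexSet (eraseFace K σ hmax) L),
        PointedQuotient.continuous_proj⟩ : C(_, _)).comp (attachMap hσ hmax)) where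
  comm _ := rfl
  inj := by
    intro q q' h
    rcases PointedQuotient.eq_base_or_proj q with rfl | ⟨x, hx, rfl⟩ <;>
      rcases PointedQuotient.eq_base_or_proj q' with rfl | ⟨y, hy, rfl⟩
    · rfl
    · exact absurd (PointedQuotient.proj_eq_base_iff.1 h.symm) hy
    · exact absurd (PointedQuotient.proj_eq_base_iff.1 h) hx
    · rcases PointedQuotient.proj_eq_proj_iff.1 h with h | ⟨h, -⟩
      · have h : x.weight = y.weight := congrArg (Realization.weight (K := K)) h
        exact congrArg _ (Realization.ext h)
      · exact absurd h hx
  injOn := by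
    intro x hx y _ h
    rcases PointedQuotient.proj_eq_proj_iff.1 h with h | ⟨h, -⟩
    · exact faceWeight_injective (congrArg Realization.weight h)
    · have h : (faceWeight x).support ∈ L := h
      rw [support_faceWeight_eq.2 hx] at h
      exact absurd h hσL
  notMem_range := by
    rintro x hx ⟨q, hq⟩
    have hxL : faceMap hσ x ∉ subcomplexSet K L := fun h => by
      have h : (faceWeight x).support ∈ L := h
      rw [support_faceWeight_eq.2 hx] at h
      exact hσL h
    rcases PointedQuotient.eq_base_or_proj q with rfl | ⟨y, hy, rfl⟩
    · exact hxL (PointedQuotient.proj_eq_base_iff.1 hq.symm)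
    · rcases PointedQuotient.proj_eq_proj_iff.1 hq with h | ⟨-, h⟩
      · have h : y.weight = faceWeight x := congrArg Realization.weight h
        have h' := y.support_mem
        rw [h, support_faceWeight_eq.2 hx] at h'
        exact (mem_eraseFace.1 h').2 rfl
      · exact hxL h
  cover := by
    intro q
    rcases PointedQuotient.eq_base_or_proj q with rfl | ⟨y, hy, rfl⟩
    · exact Or.inl ⟨PointedQuotient.base _ _, rfl⟩
    · by_cases h : y.weight.support = σ
      · refine Or.inr ⟨faceCoord y h.subset, ?_, 
          congrArg (PointedQuotient.proj (subcomplexSet K L)) (faceMap_faceCoord hσ y h.subset)⟩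
        rw [← support_faceWeight_eq, faceWeight_faceCoord, h]
      · exact Or.inl ⟨PointedQuotient.proj _ ⟨y.weight, y.nonneg, y.sum_eq_one, y.support_mem, h⟩,
          rfl⟩
  isOpen := by
    intro W h₁ h₂
    rw [relRealization_isOpen_iff] at h₁ ⊢
    intro s hs
    by_cases h : s = σ
    · subst h
      exact h₂
    · exact h₁ s ⟨hs, h⟩

/-- The Euler characteristic of a quotient of realizations with finitely many cells. -/
theorem hasChi_relRealization (F : Finset (Finset V)) (hLK : ∀ s ∈ L, s ∈ K)
    (hF : ∀ s, s ∈ F ↔ s ∈ K ∧ s ∉ L) :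
    HasChi (RelRealization K L) (1 + ∑ s ∈ F, (-1) ^ (s.card - 1)) := by
  classical
  -- Only the difference of `K` and `L` is finite, so the induction removes its faces one at a time
  -- and ends with a single point, the base point.
  induction hn : F.card generalizing F K with
  | zero =>
    obtain rfl := Finset.card_eq_zero.1 hn
    have hb : ∀ q : RelRealization K L, q = PointedQuotient.base _ _ := by
      intro q
      rcases PointedQuotient.eq_base_or_proj q with rfl | ⟨y, hy, rfl⟩
      · rfl
      · exact absurd ((hF _).2 ⟨y.support_mem, hy⟩) (Finset.notMem_empty _)
    let : Unique (RelRealization K L) := ⟨⟨PointedQuotient.base _ _⟩, hb⟩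
    simpa using hasChi_punit.of_homeomorph
      (Homeomorph.homeomorphOfUnique PUnit (RelRealization K L))
  | succ n ih =>
    obtain ⟨σ, hσF, hσ⟩ := Finset.exists_max_image F Finset.card
      (Finset.card_pos.1 (hn ▸ n.succ_pos))
    obtain ⟨hσK, hσL⟩ := (hF σ).1 hσF
    have hσ0 : σ.Nonempty := (K.isRelLowerSet_faces hσK).1
    -- A face of `K` containing `σ` cannot lie in `L`, as `L` is closed under subfaces; so the
    -- largest cardinality in `F` gives maximality in all of `K`.
    have hmax : ∀ t ∈ K, σ ⊆ t → t = σ := fun t ht hσt =>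
      (Finset.eq_of_subset_of_card_le hσt
        (hσ t ((hF t).2 ⟨ht, fun htL => hσL (mem_of_subset htL hσt hσ0)⟩))).symm
    have h := ih (K := eraseFace K σ hmax) (F.erase σ)
      (fun s hs => ⟨hLK s hs, fun h => hσL (h ▸ hs)⟩)
      (fun s => by
        rw [Finset.mem_erase, hF, mem_eraseFace]
        tauto)
      (by rw [Finset.card_erase_of_mem hσF, hn, Nat.add_sub_cancel])
    have : Nonempty σ := hσ0.to_subtype
    have := (isAttached_face hσK hσL hmax).hasChi simplexCell h
    rw [Fintype.card_coe] at this
    rwa [← Finset.sum_erase_add _ _ hσF, ← add_assoc]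

end RelativeRealization

end MagnitudeHomotopy

namespace MagnitudeHomotopy

/-! ### Causal sequences without slack -/

section Paths

variable {X : Type u} [MetricSpace X]

/-- The sequence `a, l` consists of successively distinct points, ends in `b` and has
length `ℓ`. -/
structure IsPath (ℓ : ℝ) (a b : X) (l : List X) : Prop where
  isChain : (a :: l).IsChain (· ≠ ·)
  getLastD_eq : l.getLastD a = b
  seqLength_eq : seqLength (a :: l) = ℓ

/-- The points of a causal sequence without slack that starts in `p`, except for the first. -/
def liftTail : Spacetime X → List X → List (Spacetime X)
  | _, [] => []
  | p, y :: l => ⟨y, p.time + dist p.point y⟩ ::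
      liftTail ⟨y, p.time + dist p.point y⟩ l

theorem map_liftTail (p : Spacetime X) (l : List X) : (liftTail p l).map Spacetime.point = l := by
  induction l generalizing p with
  | nil => rfl
  | cons y l ih => simp [liftTail, ih]

theorem spacetime_le_iff {p q : Spacetime X} :
    p ≤ q ↔ dist p.point q.point ≤ q.time - p.time := Iff.rfl

/-- Without slack each event precedes the next automatically, so strictness only says that
consecutive points differ. -/
theorem isChain_liftTail (p : Spacetime X) (l : List X) :
    (p :: liftTail p l).IsChain (· < ·) ↔ (p.point :: l).IsChain (· ≠ ·) := by
  induction l generalizing p with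
  | nil => simp [liftTail]
  | cons y l ih =>
    rw [liftTail, List.isChain_cons_cons, List.isChain_cons_cons, ih]
    refine and_congr_left fun _ => ⟨fun h hy => h.ne ?_, fun h => lt_of_le_of_ne ?_ ?_⟩
    · exact Spacetime.ext hy (by simp [hy])
    · rw [spacetime_le_iff]
      simp
    · exact fun hp => h (congrArg Spacetime.point hp)

theorem liftTail_bounds (p : Spacetime X) (l : List X) :
    ∀ q ∈ p :: liftTail p l,
      p ≤ q ∧ q ≤ ⟨l.getLastD p.point, p.time + seqLength (p.point :: l)⟩ := by
  induction l generalizing p with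
  | nil =>
    intro q hq
    obtain rfl : q = p := by simpa [liftTail] using hq
    refine ⟨le_rfl, ?_⟩
    rw [spacetime_le_iff]
    simp [seqLength]
  | cons y l ih =>
    have h := ih ⟨y, p.time + dist p.point y⟩
    have hp : p ≤ ⟨y, p.time + dist p.point y⟩ := by
      rw [spacetime_le_iff]
      simp
    rw [List.getLastD_cons, seqLength, ← add_assoc]
    intro q hq
    rcases List.mem_cons.1 hq with rfl | hq
    · exact ⟨le_rfl, hp.trans (h _ List.mem_cons_self).2⟩
    · exact ⟨hp.trans (h q hq).1, (h q hq).2⟩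

/-- The duration of a causal sequence is at least its length, with equality if there is no
slack. -/
theorem seqLength_le_duration (p : Spacetime X) (m : List (Spacetime X))
    (h : (p :: m).IsChain (· ≤ ·)) :
    p.time + seqLength (p.point :: m.map Spacetime.point) ≤ (m.getLastD p).time ∧
      ((m.getLastD p).time ≤ p.time + seqLength (p.point :: m.map Spacetime.point) →
        m = liftTail p (m.map Spacetime.point)) := by
  induction m generalizing p with
  | nil => simp [seqLength, liftTail]
  | cons q m ih =>
    rw [List.isChain_cons_cons, spacetime_le_iff] at h
    obtain ⟨h₁, h₂⟩ := ih q h.2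
    rw [List.getLastD_cons, List.map_cons, seqLength]
    refine ⟨by linarith [h.1], fun hle => ?_⟩
    have hq : q = ⟨q.point, p.time + dist p.point q.point⟩ :=
      Spacetime.ext rfl (by linarith [h.1])
    have h₃ := h₂ (by linarith [h.1])
    rw [liftTail, ← hq, ← h₃]

/-- The initial wait, the slack between events and the final wait are nonnegative and share what the
length leaves of the duration `ℓ`. If the length is at least `ℓ`, all of them vanish. -/
theorem eq_lift_of_length_le {ℓ : ℝ} {a b : X} {p : Spacetime X} {m : List (Spacetime X)}
    (hm : (p :: m).IsChain (· < ·)) (hp : ⟨a, 0⟩ ≤ p) (hb : m.getLastD p ≤ ⟨b, ℓ⟩)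
    (hl : ℓ ≤ seqLength (p.point :: m.map Spacetime.point)) :
    p = ⟨a, 0⟩ ∧ m = liftTail ⟨a, 0⟩ (m.map Spacetime.point) ∧
      IsPath ℓ a b (m.map Spacetime.point) := by
  obtain ⟨h₁, h₂⟩ := seqLength_le_duration p m (hm.imp fun _ _ h => h.le)
  rw [spacetime_le_iff] at hp hb
  simp only [sub_zero] at hp hb
  have ha0 : 0 ≤ dist a p.point := dist_nonneg
  have hb0 : 0 ≤ dist (m.getLastD p).point b := dist_nonneg
  have hpa : p = ⟨a, 0⟩ := Spacetime.ext
    (dist_eq_zero.1 (by linarith : dist a p.point = 0)).symm (by change p.time = 0; linarith)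
  have hlast : (m.getLastD p).point = b := dist_eq_zero.1 (by linarith)
  have hm' := h₂ (by linarith)
  refine ⟨hpa, hpa ▸ hm', ?_, ?_, ?_⟩
  · rw [hm', isChain_liftTail] at hm
    rwa [hpa] at hm
  · have h := List.getLastD_map (f := Spacetime.point) (l := m) (a := p)
    rwa [hlast, hpa] at h
  · have hpt : p.point = a := congrArg Spacetime.point hpa
    rw [← hpt]
    exact le_antisymm (by linarith) hl

theorem comparable_of_pairwise {P : Type*} [PartialOrder P] {l : List P}
    (h : l.Pairwise (· < ·)) {p q : P} (hp : p ∈ l) (hq : q ∈ l) : p ≤ q ∨ q ≤ p := by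
  have : Std.Symm fun p q : P => p ≤ q ∨ q ≤ p := ⟨fun _ _ => Or.symm⟩
  exact List.Pairwise.forall_of_forall (R := fun p q : P => p ≤ q ∨ q ≤ p) (fun _ _ => Or.inl le_rfl)
    (h.imp fun h => Or.inl h.le) hp hq

/-- Every finite chain in a causal interval can be listed in increasing order. -/
theorem exists_sorted_list {ℓ : ℝ} {a b : X} {s : Finset (CausalInterval X ℓ a b)}
    (hs : IsChain (· ≤ ·) (s : Set (CausalInterval X ℓ a b))) :
    ∃ l : List (CausalInterval X ℓ a b), l.Pairwise (· < ·) ∧ ∀ p, p ∈ l ↔ p ∈ s := by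
  classical
  -- Time is a total preorder on events and determines the order of comparable ones: two comparable
  -- events with equal times coincide.
  let r : CausalInterval X ℓ a b → CausalInterval X ℓ a b → Prop :=
    fun p q => p.1.time ≤ q.1.time
  have : Std.Total r := ⟨fun p q => le_total p.1.time q.1.time⟩
  have : IsTrans _ r := ⟨fun p q t => le_trans⟩
  have hmem : ∀ p, p ∈ s.toList.insertionSort r ↔ p ∈ s := fun p => by
    rw [List.mem_insertionSort, Finset.mem_toList]
  refine ⟨s.toList.insertionSort r, ?_, hmem⟩
  have hnd : (s.toList.insertionSort r).Nodup :=
    ((List.perm_insertionSort r _).nodup_iff).2 s.nodup_toList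
  refine ((List.pairwise_insertionSort r s.toList).and hnd).imp_of_mem ?_
  rintro p q hp hq ⟨hr, hne⟩
  rcases hs ((hmem p).1 hp) ((hmem q).1 hq) hne with h | h
  · exact lt_of_le_of_ne h hne
  · have h' : dist q.1.point p.1.point ≤ p.1.time - q.1.time := h
    have hr : p.1.time ≤ q.1.time := hr
    have h0 : 0 ≤ dist q.1.point p.1.point := dist_nonneg
    exact absurd (Subtype.ext (Spacetime.ext (dist_eq_zero.1 (by linarith)).symm (by linarith))) hne

open Classical in
/-- The set of events of a causal sequence without slack that starts in `(a, 0)`. -/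
noncomputable def pathFace (ℓ : ℝ) (a b : X) (l : List X) : Finset (CausalInterval X ℓ a b) :=
  (⟨a, 0⟩ :: liftTail ⟨a, 0⟩ l).toFinset.subtype (· ∈ Set.Icc (⟨a, 0⟩ : Spacetime X) ⟨b, ℓ⟩)

variable {ℓ : ℝ} {a b : X} {l : List X}

theorem mem_pathFace {p : CausalInterval X ℓ a b} :
    p ∈ pathFace ℓ a b l ↔ p.1 ∈ (⟨a, 0⟩ : Spacetime X) :: liftTail ⟨a, 0⟩ l := by
  classical
  rw [pathFace, Finset.mem_subtype, List.mem_toFinset]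

theorem IsPath.mem_Icc (h : IsPath ℓ a b l) {q : Spacetime X}
    (hq : q ∈ (⟨a, 0⟩ : Spacetime X) :: liftTail ⟨a, 0⟩ l) :
    q ∈ Set.Icc (⟨a, 0⟩ : Spacetime X) ⟨b, ℓ⟩ := by
  have := liftTail_bounds ⟨a, 0⟩ l q hq
  rwa [h.getLastD_eq, h.seqLength_eq, zero_add] at this

theorem IsPath.pairwise (h : IsPath ℓ a b l) :
    ((⟨a, 0⟩ : Spacetime X) :: liftTail ⟨a, 0⟩ l).Pairwise (· < ·) :=
  List.isChain_iff_pairwise.1 ((isChain_liftTail _ _).2 h.isChain)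

theorem IsPath.nodup (h : IsPath ℓ a b l) :
    ((⟨a, 0⟩ : Spacetime X) :: liftTail ⟨a, 0⟩ l).Nodup :=
  h.pairwise.imp fun h => h.ne

theorem IsPath.card_pathFace (h : IsPath ℓ a b l) :
    (pathFace ℓ a b l).card = l.length + 1 := by
  classical
  rw [pathFace, Finset.card_subtype, Finset.filter_true_of_mem fun q hq =>
    h.mem_Icc (List.mem_toFinset.1 hq), List.toFinset_card_of_nodup h.nodup, List.length_cons,
    ← List.length_map (as := liftTail _ _) Spacetime.point, map_liftTail]

/-- An increasing list that contains exactly the events of a path is the path. -/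
theorem IsPath.eq_of_mem_iff (h : IsPath ℓ a b l) {m : List (Spacetime X)}
    (hm : m.Pairwise (· < ·)) (hml : ∀ q, q ∈ m ↔ q ∈ (⟨a, 0⟩ : Spacetime X) :: liftTail ⟨a, 0⟩ l) :
    m = ⟨a, 0⟩ :: liftTail ⟨a, 0⟩ l := by
  refine List.Perm.eq_of_pairwise (fun p q _ _ h₁ h₂ => absurd h₂ h₁.not_gt) hm h.pairwise ?_
  exact (List.perm_ext_iff_of_nodup (hm.imp fun h => h.ne) h.nodup).2 hml

/-- The face determines its increasing listing, and the points of that listing are the path. -/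
theorem pathFace_injOn : Set.InjOn (pathFace ℓ a b) {l | IsPath ℓ a b l} := by
  intro l hl l' hl' h
  have key : ∀ q, q ∈ (⟨a, 0⟩ : Spacetime X) :: liftTail ⟨a, 0⟩ l ↔
      q ∈ (⟨a, 0⟩ : Spacetime X) :: liftTail ⟨a, 0⟩ l' := by
    intro q
    constructor
    · intro hq
      have : (⟨q, IsPath.mem_Icc hl hq⟩ : CausalInterval X ℓ a b) ∈ pathFace ℓ a b l' :=
        h ▸ mem_pathFace.2 hq
      exact mem_pathFace.1 this
    · intro hq
      have : (⟨q, IsPath.mem_Icc hl' hq⟩ : CausalInterval X ℓ a b) ∈ pathFace ℓ a b l :=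
        h.symm ▸ mem_pathFace.2 hq
      exact mem_pathFace.1 this
  have := IsPath.eq_of_mem_iff hl' (IsPath.pairwise hl) key
  have := congrArg (List.map Spacetime.point) (List.cons.inj this).2
  rwa [map_liftTail, map_liftTail] at this

theorem IsPath.pathFace_mem (h : IsPath ℓ a b l) :
    pathFace ℓ a b l ∈ orderComplex (CausalInterval X ℓ a b) := by
  refine ⟨Finset.card_pos.1 (by rw [h.card_pathFace]; exact Nat.succ_pos _), ?_⟩
  intro p hp q hq hne
  exact comparable_of_pairwise h.pairwise (mem_pathFace.1 hp) (mem_pathFace.1 hq)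

/-- Every increasing listing of the face is the lifted path itself, so its length is exactly `ℓ` and
never smaller. -/
theorem IsPath.pathFace_notMem (h : IsPath ℓ a b l) :
    pathFace ℓ a b l ∉ shortComplex X ℓ a b := by
  rintro ⟨-, m, hm, hml, hlt⟩
  have hm' := h.eq_of_mem_iff (m := m.map Subtype.val) (List.pairwise_map.2 hm) fun q => by
    rw [List.mem_map]
    constructor
    · rintro ⟨p, hp, rfl⟩
      exact mem_pathFace.1 ((hml p).1 hp)
    · exact fun hq => ⟨⟨q, h.mem_Icc hq⟩, (hml _).2 (mem_pathFace.2 hq), rfl⟩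
  have hm'' := congrArg (List.map Spacetime.point) hm'
  rw [List.map_map, List.map_cons, map_liftTail] at hm''
  have : seqLength (m.map fun p => p.1.point) = ℓ := (congrArg seqLength hm'').trans h.seqLength_eq
  exact hlt.ne this

/-- The increasing listing of a face outside the subcomplex has length at least `ℓ`, so it has no
slack and is recovered from its points. -/
theorem exists_isPath_of_notMem {s : Finset (CausalInterval X ℓ a b)}
    (hs : s ∈ orderComplex (CausalInterval X ℓ a b)) (hs' : s ∉ shortComplex X ℓ a b) :
    ∃ l, IsPath ℓ a b l ∧ pathFace ℓ a b l = s := by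
  obtain ⟨m, hm, hms⟩ := exists_sorted_list hs.2
  have hlen : ℓ ≤ seqLength (m.map fun p => p.1.point) := by
    by_contra hlt
    exact hs' ⟨hs.1, m, hm, hms, not_le.1 hlt⟩
  cases m with
  | nil =>
    obtain ⟨p, hp⟩ := hs.1
    exact absurd ((hms p).2 hp) List.not_mem_nil
  | cons p m =>
    have hm' : (p.1 :: m.map Subtype.val).IsChain (· < ·) :=
      List.isChain_iff_pairwise.2 (List.pairwise_map (f := Subtype.val) (l := p :: m) |>.2 hm)
    have hlast : (m.map Subtype.val).getLastD p.1 ≤ ⟨b, ℓ⟩ := by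
      rw [List.getLastD_map]
      exact (m.getLastD p).2.2
    have hmap : (m.map Subtype.val).map Spacetime.point =
        m.map fun p : CausalInterval X ℓ a b => p.1.point := by
      rw [List.map_map]
      rfl
    obtain ⟨h₁, h₂, h₃⟩ := eq_lift_of_length_le hm' p.2.1 hlast (by rw [hmap]; exact hlen)
    refine ⟨_, h₃, ?_⟩
    ext q
    rw [mem_pathFace, ← h₂, ← hms, List.mem_cons, List.mem_cons, List.mem_map, Subtype.ext_iff, h₁]
    refine or_congr_right ⟨?_, fun h => ⟨q, h, rfl⟩⟩
    rintro ⟨t, ht, htq⟩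
    rwa [← Subtype.ext htq]

/-- A finite space has a positive lower bound `δ` for its nonzero distances, so a path of length `ℓ`
has at most `ℓ / δ` steps. -/
theorem finite_setOf_isPath [Finite X] (ℓ : ℝ) (a b : X) : {l | IsPath ℓ a b l}.Finite := by
  obtain ⟨δ, hδ, hδX⟩ : ∃ δ > 0, ∀ x y : X, x ≠ y → δ ≤ dist x y := by
    have hfin : {d | ∃ x y : X, x ≠ y ∧ dist x y = d}.Finite := by
      refine (Set.finite_range fun z : X × X => dist z.1 z.2).subset ?_
      rintro _ ⟨x, y, -, rfl⟩
      exact ⟨(x, y), rfl⟩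
    rcases Set.eq_empty_or_nonempty {d | ∃ x y : X, x ≠ y ∧ dist x y = d} with h | h
    · exact ⟨1, one_pos, fun x y hxy => absurd ⟨x, y, hxy, rfl⟩
        (Set.eq_empty_iff_forall_notMem.1 h (dist x y))⟩
    · obtain ⟨d, ⟨x, y, hxy, rfl⟩, hd⟩ := Set.exists_min_image _ id hfin h
      exact ⟨_, dist_pos.2 hxy, fun x' y' h' => hd _ ⟨x', y', h', rfl⟩⟩
  have hlen : ∀ (l : List X) (a : X), (a :: l).IsChain (· ≠ ·) →
      δ * l.length ≤ seqLength (a :: l) := by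
    intro l
    induction l with
    | nil => simp [seqLength]
    | cons y l ih =>
      intro a h
      rw [List.isChain_cons_cons] at h
      have h₁ := ih y h.2
      have h₂ := hδX a y h.1
      rw [seqLength, List.length_cons]
      push_cast
      linarith
  refine (List.finite_length_le X ⌊ℓ / δ⌋₊).subset fun l hl => ?_
  refine Nat.le_floor ?_
  rw [le_div_iff₀ hδ, mul_comm]
  exact (hlen l a hl.isChain).trans hl.seqLength_eq.le

/-- The signed number of paths of length `ℓ` from `a` to `b`. -/
noncomputable def pathChar (ℓ : ℝ) (a b : X) : ℤ :=
  ∑ᶠ l ∈ {l | IsPath ℓ a b l}, (-1) ^ l.length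

/-- The faces outside the subcomplex are exactly those of paths. A path with `n` steps has `n + 1`
events, so its cell has dimension `n`; the summand `1` is the base point. -/
theorem hasChi_magnitudeHomotopyType [Finite X] (ℓ : ℝ) (a b : X) :
    HasChi (MagnitudeHomotopyType X ℓ a b) (1 + pathChar ℓ a b) := by
  classical
  have hfin := finite_setOf_isPath ℓ a b
  have hinj : Set.InjOn (pathFace ℓ a b) hfin.toFinset := by
    rw [hfin.coe_toFinset]
    exact pathFace_injOn
  have h := hasChi_relRealization (K := orderComplex (CausalInterval X ℓ a b))
    (L := shortComplex X ℓ a b) (hfin.toFinset.image (pathFace ℓ a b)) ?_ ?_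
  · rw [Finset.sum_image hinj] at h
    rw [pathChar, finsum_mem_eq_finite_toFinset_sum _ hfin]
    convert h using 3 with l hl
    rw [IsPath.card_pathFace ((hfin.mem_toFinset).1 hl), Nat.add_sub_cancel]
  · rintro s ⟨hs, m, hm, hms, -⟩
    exact ⟨hs, fun p hp q hq _ => comparable_of_pairwise hm ((hms p).2 hp) ((hms q).2 hq)⟩
  · intro s
    rw [Finset.mem_image]
    constructor
    · rintro ⟨l, hl, rfl⟩
      have hl : IsPath ℓ a b l := hfin.mem_toFinset.1 hl
      exact ⟨hl.pathFace_mem, hl.pathFace_notMem⟩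
    · rintro ⟨hs, hs'⟩
      obtain ⟨l, hl, rfl⟩ := exists_isPath_of_notMem hs hs'
      exact ⟨l, hfin.mem_toFinset.2 hl, rfl⟩

theorem magnitudeHomotopyType_reduced [Finite X] (ℓ : ℝ) (a b : X) :
    HasFiniteReducedHomology (MagnitudeHomotopyType X ℓ a b) ∧
      reducedEulerChar (MagnitudeHomotopyType X ℓ a b) = pathChar ℓ a b := by
  obtain ⟨h₁, h₂⟩ := (hasChi_magnitudeHomotopyType ℓ a b).reduced
  exact ⟨h₁, by rw [h₂, add_sub_cancel_left]⟩

end Paths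

end MagnitudeHomotopy

namespace MagnitudeHomotopy

/-! ### Isometric invariance -/

section Isometry

variable {X : Type u} {Y : Type v} [MetricSpace X] [MetricSpace Y]

theorem seqLength_map (f : X → Y) (hf : ∀ x y, dist (f x) (f y) = dist x y) :
    ∀ l : List X, seqLength (l.map f) = seqLength l
  | [] => rfl
  | [_] => rfl
  | x :: y :: l => by
    rw [List.map_cons, List.map_cons, seqLength, seqLength, hf, ← List.map_cons,
      seqLength_map f hf (y :: l)]

/-- The isomorphism of spacetimes induced by a bijection. -/
def spacetimeEquiv (e : X ≃ Y) : Spacetime X ≃ Spacetime Y where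
  toFun p := ⟨e p.point, p.time⟩
  invFun p := ⟨e.symm p.point, p.time⟩
  left_inv p := by simp
  right_inv p := by simp

theorem spacetimeEquiv_le (e : X ≃ Y) (he : ∀ x y, dist (e x) (e y) = dist x y)
    (p q : Spacetime X) : spacetimeEquiv e p ≤ spacetimeEquiv e q ↔ p ≤ q := by
  change dist (e p.point) (e q.point) ≤ q.time - p.time ↔ _
  rw [he]
  rfl

/-- The isomorphism of causal intervals induced by a bijective isometry. -/
def causalIso (e : X ≃ Y) (he : ∀ x y, dist (e x) (e y) = dist x y) (ℓ : ℝ) (a b : X) :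
    CausalInterval X ℓ a b ≃o CausalInterval Y ℓ (e a) (e b) where
  toEquiv := (spacetimeEquiv e).subtypeEquiv fun p => and_congr
    (spacetimeEquiv_le e he ⟨a, 0⟩ p).symm (spacetimeEquiv_le e he p ⟨b, ℓ⟩).symm
  map_rel_iff' := spacetimeEquiv_le e he _ _

theorem map_mem_orderComplex {P : Type u} {Q : Type v} [PartialOrder P] [PartialOrder Q]
    (e : P ≃o Q) {s : Finset P} (hs : s ∈ orderComplex P) :
    s.map e.toEquiv.toEmbedding ∈ orderComplex Q := by
  refine ⟨hs.1.map, ?_⟩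
  rw [Finset.coe_map]
  rintro _ ⟨p, hp, rfl⟩ _ ⟨q, hq, rfl⟩ hne
  exact (hs.2 hp hq fun h => hne (congrArg _ h)).imp e.le_iff_le.2 e.le_iff_le.2

theorem map_mem_shortComplex (e : X ≃ Y) (he : ∀ x y, dist (e x) (e y) = dist x y) {ℓ : ℝ}
    {a b : X} {a' b' : Y} (E : CausalInterval X ℓ a b ≃o CausalInterval Y ℓ a' b')
    (hE : ∀ p, (E p).1.point = e p.1.point)
    {s : Finset (CausalInterval X ℓ a b)} (hs : s ∈ shortComplex X ℓ a b) :
    s.map E.toEquiv.toEmbedding ∈ shortComplex Y ℓ a' b' := by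
  obtain ⟨hs, l, hl, hls, hlt⟩ := hs
  refine ⟨hs.map, l.map E, List.pairwise_map.2 (hl.imp E.lt_iff_lt.2), fun p => ?_, ?_⟩
  · rw [List.mem_map, Finset.mem_map]
    exact exists_congr fun q => and_congr_left fun _ => hls q
  · have h : (l.map E).map (fun p => p.1.point) = (l.map fun p => p.1.point).map e := by
      rw [List.map_map, List.map_map]
      exact List.map_congr_left fun p _ => hE p
    rwa [h, seqLength_map e he]

theorem map_map_symm {P : Type u} {Q : Type v} [PartialOrder P] [PartialOrder Q] (e : P ≃o Q)
    (s : Finset P) : (s.map e.toEquiv.toEmbedding).map e.symm.toEquiv.toEmbedding = s := by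
  ext p
  simp

/-- Bijective isometries induce homeomorphisms of magnitude homotopy types. -/
theorem exists_homeomorph_of_isometry (e : X ≃ Y) (he : ∀ x y, dist (e x) (e y) = dist x y)
    (ℓ : ℝ) (a b : X) :
    ∃ E : MagnitudeHomotopyType X ℓ a b ≃ₜ MagnitudeHomotopyType Y ℓ (e a) (e b),
      E (MagnitudeHomotopyType.base X ℓ a b) =
        MagnitudeHomotopyType.base Y ℓ (e a) (e b) := by
  let E := causalIso e he ℓ a b
  have he' : ∀ x y, dist (e.symm x) (e.symm y) = dist x y := fun x y => by
    rw [← he, e.apply_symm_apply, e.apply_symm_apply]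
  refine exists_homeomorph_relRealization E.toEquiv
    (fun s => ⟨fun h => ?_, map_mem_orderComplex E⟩)
    (fun s => ⟨fun h => ?_, map_mem_shortComplex e he E fun _ => rfl⟩)
  · have := map_mem_orderComplex E.symm h
    rwa [map_map_symm] at this
  · have := map_mem_shortComplex e.symm he' E.symm (fun _ => rfl) h
    rwa [map_map_symm] at this

theorem IsPath.map (e : X ≃ Y) (he : ∀ x y, dist (e x) (e y) = dist x y) {ℓ : ℝ} {a b : X}
    {l : List X} (h : IsPath ℓ a b l) : IsPath ℓ (e a) (e b) (l.map e) where
  isChain := by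
    rw [← List.map_cons, List.isChain_map]
    exact h.isChain.imp fun _ _ hne h => hne (e.injective h)
  getLastD_eq := by rw [List.getLastD_map, h.getLastD_eq]
  seqLength_eq := by rw [← List.map_cons, seqLength_map e he, h.seqLength_eq]

theorem pathChar_map (e : X ≃ Y) (he : ∀ x y, dist (e x) (e y) = dist x y) (ℓ : ℝ) (a b : X) :
    pathChar ℓ (e a) (e b) = pathChar ℓ a b := by
  have he' : ∀ x y, dist (e.symm x) (e.symm y) = dist x y := fun x y => by
    rw [← he, e.apply_symm_apply, e.apply_symm_apply]
  refine (finsum_mem_eq_of_bijOn (List.map e) ⟨fun l hl => IsPath.map e he hl,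
    (List.map_injective_iff.2 e.injective).injOn, fun l hl => ⟨l.map e.symm, ?_, by simp⟩⟩
    fun l _ => by rw [List.length_map]).symm
  have := IsPath.map e.symm he' hl
  rwa [e.symm_apply_apply, e.symm_apply_apply] at this

theorem pointedHomotopyEquivalent_of_homeomorph {A : Type u} {B : Type v} [TopologicalSpace A]
    [TopologicalSpace B] (E : A ≃ₜ B) {a₀ : A} {b₀ : B} (h : E a₀ = b₀) :
    PointedHomotopyEquivalent a₀ b₀ := by
  refine ⟨E, E.symm, h, by simp [← h], ?_, ?_⟩
  · rw [show (E.symm : C(B, A)).comp (E : C(A, B)) = ContinuousMap.id A by ext; simp]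
    exact ContinuousMap.HomotopicRel.refl _
  · rw [show (E : C(A, B)).comp (E.symm : C(B, A)) = ContinuousMap.id B by ext; simp]
    exact ContinuousMap.HomotopicRel.refl _

theorem nonempty_homotopyEquiv_of_pointed {A : Type u} {B : Type v} [TopologicalSpace A]
    [TopologicalSpace B] {a₀ : A} {b₀ : B} (h : PointedHomotopyEquivalent a₀ b₀) :
    Nonempty (ContinuousMap.HomotopyEquiv A B) := by
  obtain ⟨f, g, -, -, h₁, h₂⟩ := h
  exact ⟨⟨f, g, h₁.homotopic, h₂.homotopic⟩⟩

/-- Homotopy equivalent magnitude homotopy types have the same Euler characteristic. -/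
theorem pathChar_eq_of_homotopyEquiv [Finite X] [Finite Y] {ℓ : ℝ} {a b : X} {a' b' : Y}
    (h : Nonempty (ContinuousMap.HomotopyEquiv (MagnitudeHomotopyType X ℓ a b)
      (MagnitudeHomotopyType Y ℓ a' b'))) : pathChar ℓ a b = pathChar ℓ a' b' := by
  obtain ⟨E⟩ := h
  -- Invariance of `HasChi` compares spaces in one universe, so both metric spaces are first
  -- replaced by isometric copies in a common one.
  let eX : X ≃ ULift.{v} X := Equiv.ulift.symm
  let eY : Y ≃ ULift.{u} Y := Equiv.ulift.symm
  obtain ⟨EX, -⟩ := exists_homeomorph_of_isometry eX (fun _ _ => rfl) ℓ a b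
  obtain ⟨EY, -⟩ := exists_homeomorph_of_isometry eY (fun _ _ => rfl) ℓ a' b'
  have hX := hasChi_magnitudeHomotopyType ℓ (eX a) (eX b)
  have hY := hasChi_magnitudeHomotopyType ℓ (eY a') (eY b')
  have := (hX.of_homotopyEquiv
    ((EX.symm.toHomotopyEquiv.trans E).trans EY.toHomotopyEquiv)).unique hY
  rw [pathChar_map eX fun _ _ => rfl, pathChar_map eY fun _ _ => rfl] at this
  exact add_left_cancel this

end Isometry

/-! ### Recovering the metric -/

section Recover

variable {X : Type u} {Y : Type v} [MetricSpace X] [MetricSpace Y]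

theorem isPath_zero_iff {a b : X} {l : List X} : IsPath 0 a b l ↔ l = [] ∧ a = b := by
  constructor
  · rintro ⟨h₁, h₂, h₃⟩
    cases l with
    | nil => exact ⟨rfl, h₂⟩
    | cons y l =>
      rw [seqLength] at h₃
      have := dist_pos.2 (List.isChain_cons_cons.1 h₁).1
      have := seqLength_nonneg (y :: l)
      linarith
  · rintro ⟨rfl, rfl⟩
    exact ⟨by simp, rfl, rfl⟩

theorem pathChar_zero_self (a : X) : pathChar 0 a a = 1 := by
  have : {l : List X | IsPath 0 a a l} = {[]} := by
    ext l
    simp [isPath_zero_iff]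
  rw [pathChar, this, finsum_mem_singleton, List.length_nil, pow_zero]

theorem pathChar_zero_of_ne {a b : X} (h : a ≠ b) : pathChar 0 a b = 0 := by
  have : {l : List X | IsPath 0 a b l} = ∅ := by
    ext l
    simp [isPath_zero_iff, h]
  rw [pathChar, this, finsum_mem_empty]

/-- No step of a sequence exceeds its total length, so every step here is among the preserved
distances. -/
theorem seqLength_map_of_lt (f : X → Y) {ℓ : ℝ}
    (hf : ∀ x y, dist x y < ℓ → dist (f x) (f y) = dist x y) :
    ∀ l : List X, seqLength l < ℓ → seqLength (l.map f) = seqLength l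
  | [], _ => rfl
  | [_], _ => rfl
  | x :: y :: l, h => by
    rw [seqLength] at h
    have h₁ : dist x y < ℓ := by linarith [seqLength_nonneg (y :: l)]
    have h₂ : seqLength (y :: l) < ℓ := by linarith [dist_nonneg (x := x) (y := y)]
    rw [List.map_cons, List.map_cons, seqLength, seqLength, hf x y h₁, ← List.map_cons,
      seqLength_map_of_lt f hf (y :: l) h₂]

/-- A path with more than one step is preserved if all shorter distances are preserved. -/
theorem IsPath.map_of_lt (e : X ≃ Y) {ℓ : ℝ}
    (he : ∀ x y, dist x y < ℓ → dist (e x) (e y) = dist x y) {a b : X} (hab : a ≠ b)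
    {l : List X} (h : IsPath ℓ a b l) (hl : l ≠ [b]) : IsPath ℓ (e a) (e b) (l.map e) where
  isChain := by
    rw [← List.map_cons, List.isChain_map]
    exact h.isChain.imp fun _ _ hne h => hne (e.injective h)
  getLastD_eq := by rw [List.getLastD_map, h.getLastD_eq]
  seqLength_eq := by
    obtain ⟨h₁, h₂, h₃⟩ := h
    match l with
    | [] => exact absurd h₂ hab
    | [y] => exact absurd (congrArg (fun y => [y]) h₂) hl
    -- With at least two steps of positive length, both the first step and the remaining path are
    -- strictly shorter than `ℓ`.
    | y :: z :: l =>
      rw [List.isChain_cons_cons, List.isChain_cons_cons] at h₁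
      rw [seqLength] at h₃
      have hy := dist_pos.2 h₁.1
      have hz := dist_pos.2 h₁.2.1
      have hyz : dist y z ≤ seqLength (y :: z :: l) := by
        rw [seqLength]
        linarith [seqLength_nonneg (z :: l)]
      have := seqLength_map_of_lt e he (y :: z :: l) (by linarith)
      rw [List.map_cons] at this ⊢
      rw [seqLength, this, he a y (by linarith), h₃]

/-- The first distance that is not preserved changes the number of paths. -/
theorem pathChar_ne [Finite X] (e : X ≃ Y) {ℓ : ℝ} {a b : X} (hab : dist a b = ℓ)
    (hlt : ℓ < dist (e a) (e b)) (h₁ : ∀ x y, dist x y < ℓ → dist (e x) (e y) = dist x y)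
    (h₂ : ∀ x y, dist x y < ℓ → dist (e.symm x) (e.symm y) = dist x y) :
    pathChar ℓ a b ≠ pathChar ℓ (e a) (e b) := by
  have hne : a ≠ b := by
    rintro rfl
    rw [dist_self] at hab hlt
    exact hlt.ne hab.symm
  have hb : IsPath ℓ a b [b] := ⟨by simpa using hne, rfl, by simpa [seqLength] using hab⟩
  have hfin := finite_setOf_isPath ℓ a b
  have hY : pathChar ℓ (e a) (e b) = ∑ᶠ l ∈ {l | IsPath ℓ a b l} \ {[b]}, (-1) ^ l.length := by
    refine (finsum_mem_eq_of_bijOn (List.map e) ⟨fun l hl => IsPath.map_of_lt e h₁ hne hl.1 hl.2,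
      (List.map_injective_iff.2 e.injective).injOn, fun l hl => ?_⟩
      fun l _ => by rw [List.length_map]).symm
    -- The direct step from `e a` to `e b` is longer than `ℓ`, so every path of length `ℓ` in `Y`
    -- has at least two steps and pulls back.
    have hlb : l ≠ [e b] := by
      rintro rfl
      have := hl.seqLength_eq
      simp only [seqLength, add_zero] at this
      exact hlt.ne' this
    have := IsPath.map_of_lt e.symm h₂ (e.injective.ne hne) hl hlb
    rw [e.symm_apply_apply, e.symm_apply_apply] at this
    refine ⟨l.map e.symm, ⟨this, fun h => hlb ?_⟩, by simp⟩
    rw [Set.mem_singleton_iff] at h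
    have := congrArg (List.map e) h
    simpa using this
  have hX : pathChar ℓ a b = (-1) ^ [b].length +
      ∑ᶠ l ∈ {l | IsPath ℓ a b l} \ {[b]}, (-1) ^ l.length := by
    have hnot : [b] ∉ {l | IsPath ℓ a b l} \ {[b]} := fun h => h.2 rfl
    rw [pathChar, ← finsum_mem_insert (fun l : List X => (-1 : ℤ) ^ l.length) hnot hfin.sdiff, Set.insert_sdiff_singleton,
      Set.insert_eq_of_mem (show [b] ∈ {l | IsPath ℓ a b l} from hb)]
  rw [hX, hY]
  simp

/-- Among the pairs whose distance changes, take one where the smaller of the two distances is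
least. Minimizing over both sides makes `e` and its inverse preserve all smaller distances, so the
comparison of counts applies to whichever of them increases this one. -/
theorem dist_eq_of_pathChar_eq [Finite X] [Finite Y] (e : X ≃ Y)
    (h : ∀ ℓ : ℝ, 0 ≤ ℓ → ∀ a b, pathChar ℓ a b = pathChar ℓ (e a) (e b)) (a b : X) :
    dist (e a) (e b) = dist a b := by
  by_contra hab
  obtain ⟨⟨a, b⟩, hab, hmin⟩ := Set.exists_min_image
    {z : X × X | dist (e z.1) (e z.2) ≠ dist z.1 z.2}
    (fun z => min (dist (e z.1) (e z.2)) (dist z.1 z.2)) (Set.toFinite _) ⟨(a, b), hab⟩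
  simp only [Set.mem_ofPred_eq, Prod.forall] at hab hmin
  have h₁ : ∀ x y, dist x y < min (dist (e a) (e b)) (dist a b) →
      dist (e x) (e y) = dist x y := by
    intro x y hxy
    by_contra hne
    exact absurd ((hmin x y hne).trans (min_le_right _ _)) hxy.not_ge
  have h₂ : ∀ x y, dist x y < min (dist (e a) (e b)) (dist a b) →
      dist (e.symm x) (e.symm y) = dist x y := by
    intro x y hxy
    by_contra hne
    have := hmin (e.symm x) (e.symm y)
    rw [e.apply_symm_apply, e.apply_symm_apply] at this
    exact absurd ((this (Ne.symm hne)).trans (min_le_left _ _)) hxy.not_ge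
  rcases lt_or_gt_of_ne hab with hlt | hlt
  · rw [min_eq_left hlt.le] at h₁ h₂
    have := pathChar_ne e.symm (a := e a) (b := e b) rfl (by simpa using hlt) h₂ (by simpa using h₁)
    rw [e.symm_apply_apply, e.symm_apply_apply] at this
    exact this (h _ dist_nonneg a b).symm
  · rw [min_eq_right hlt.le] at h₁ h₂
    exact pathChar_ne e rfl hlt h₁ h₂ (h _ dist_nonneg a b)

end Recover

end MagnitudeHomotopy

/-! ### The equivalence of the four conditions -/

theorem mainTheorem8 {X : Type u} {Y : Type v} [MetricSpace X] [MetricSpace Y]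
    [Finite X] [Finite Y] (hcard : Nat.card X = Nat.card Y) (f : X → Y) :
    (∀ (ℓ : ℝ), 0 ≤ ℓ → ∀ a b : X,
      MagnitudeHomotopy.HasFiniteReducedHomology
        (MagnitudeHomotopy.MagnitudeHomotopyType X ℓ a b)) ∧
    (∀ (ℓ : ℝ), 0 ≤ ℓ → ∀ a b : Y,
      MagnitudeHomotopy.HasFiniteReducedHomology
        (MagnitudeHomotopy.MagnitudeHomotopyType Y ℓ a b)) ∧
    List.TFAE [
      ∀ a b : X, dist (f a) (f b) = dist a b,
      ∀ (ℓ : ℝ), 0 ≤ ℓ → ∀ a b : X,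
        Nonempty (ContinuousMap.HomotopyEquiv
          (MagnitudeHomotopy.MagnitudeHomotopyType X ℓ a b)
          (MagnitudeHomotopy.MagnitudeHomotopyType Y ℓ (f a) (f b))),
      ∀ (ℓ : ℝ), 0 ≤ ℓ → ∀ a b : X,
        MagnitudeHomotopy.PointedHomotopyEquivalent
          (MagnitudeHomotopy.MagnitudeHomotopyType.base X ℓ a b)
          (MagnitudeHomotopy.MagnitudeHomotopyType.base Y ℓ (f a) (f b)),
      ∀ (ℓ : ℝ), 0 ≤ ℓ → ∀ a b : X,
        MagnitudeHomotopy.reducedEulerChar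
            (MagnitudeHomotopy.MagnitudeHomotopyType X ℓ a b) =
          MagnitudeHomotopy.reducedEulerChar
            (MagnitudeHomotopy.MagnitudeHomotopyType Y ℓ (f a) (f b))] := by
  refine ⟨fun ℓ _ a b => (MagnitudeHomotopy.magnitudeHomotopyType_reduced ℓ a b).1,
    fun ℓ _ a b => (MagnitudeHomotopy.magnitudeHomotopyType_reduced ℓ a b).1, ?_⟩
  have hbij : Function.Injective f → Function.Bijective f := fun h =>
    (Nat.bijective_iff_injective_and_card f).2 ⟨h, hcard⟩
  simp only [(MagnitudeHomotopy.magnitudeHomotopyType_reduced _ _ _).2]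
  tfae_have 1 → 3 := by
    intro h ℓ _ a b
    have hinj : Function.Injective f := fun x y hxy => by
      rw [← dist_eq_zero, ← h, hxy, dist_self]
    obtain ⟨E, hE⟩ := MagnitudeHomotopy.exists_homeomorph_of_isometry
      (Equiv.ofBijective f (hbij hinj)) h ℓ a b
    exact MagnitudeHomotopy.pointedHomotopyEquivalent_of_homeomorph E hE
  tfae_have 3 → 2 := fun h ℓ hℓ a b =>
    MagnitudeHomotopy.nonempty_homotopyEquiv_of_pointed (h ℓ hℓ a b)
  tfae_have 2 → 4 := fun h ℓ hℓ a b =>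
    MagnitudeHomotopy.pathChar_eq_of_homotopyEquiv (h ℓ hℓ a b)
  tfae_have 4 → 1 := by
    intro h
    have hinj : Function.Injective f := fun x y hxy => by
      by_contra hne
      -- At `ℓ = 0` the only possible path is the empty one, so the count detects equality of the
      -- end points.
      have := h 0 le_rfl x y
      rw [hxy, MagnitudeHomotopy.pathChar_zero_self,
        MagnitudeHomotopy.pathChar_zero_of_ne hne] at this
      exact zero_ne_one this
    exact MagnitudeHomotopy.dist_eq_of_pathChar_eq (Equiv.ofBijective f (hbij hinj)) h
  tfae_finish
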